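/- Let $k$ be a field of characteristic $p>0$, let $\mathbb G$ be a connected linear algebraic group, smooth over $k$, and let $r>0$. Let $F^r:\mathbb G\to\mathbb G^{(r)}$ be the $r$-th iterate of Frobenius, with $(F^r)^*:k[\mathbb G^{(r)}]=k\otimes_{\phi^r}k[\mathbb G]\to k[\mathbb G]$, $\lambda\otimes f\mapsto\lambda f^{p^r}$, where $\phi(a)=a^p$, and let $\mathbb G_{(r)}=\ker F^r$ be the $r$-th Frobenius kernel; its coordinate algebra $k[\mathbb G_{(r)}]$ is the quotient of $k[\mathbb G]$ by the ideal generated by the $p^r$-th powers of the functions vanishing at the identity. For a finite group scheme $G$ over $k$ let $kG$ be its group algebra, the linear dual of the Hopf algebra $k[G]$. Put $$\tilde D(\mathbb G_{(r)})=k[\mathbb G_{(r+1)}]\,\#\,k\mathbb G_{(r)},\qquad O(\mathbb G_{(r)})=k[\mathbb G_{(r+1)}/\mathbb G_{(r)}]\otimes k\mathbb G_{(r)}.$$ Here the smash product is formed with respect to the left coadjoint action, induced by $(g\cdot f)(x)=f(g^{-1}xg)$, and has the multiplication $(f\#h)(f'\#h')=\sum f\,(h_1\cdot f')\,\#\,h_2h'$.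 The quotient $\mathbb G_{(r+1)}/\mathbb G_{(r)}$ is identified by $F^r$ with $(\mathbb G^{(r)})_{(1)}$, so that $k[\mathbb G_{(r+1)}/\mathbb G_{(r)}]=k[(\mathbb G^{(r)})_{(1)}]$ maps to $k[\mathbb G_{(r+1)}]$ by $\lambda\otimes f\mapsto\lambda f^{p^r}$. Its image is acted on trivially by $k\mathbb G_{(r)}$, which gives the algebra embedding $i_O:O(\mathbb G_{(r)})\hookrightarrow\tilde D(\mathbb G_{(r)})$, $a\otimes h\mapsto a\#h$. For a field extension $K/k$ a subscript $K$ denotes base change to $K$. A $\pi$-point of a finite group scheme $G$ over $k$ is a flat map of $K$-algebras $K[t]/t^p\to KG$, for a field extension $K/k$, which factors through the group algebra $KC$ of a unipotent abelian closed subgroup scheme $C\subset G_K$. A $\pi$-point pair of $\tilde D(\mathbb G_{(r)})$ is a pair $(\alpha_K,\beta_K)$ of maps of $K$-algebras $$\alpha_K:K[t]/t^p\to K[\mathbb G_{(r+1)}/\mathbb G_{(r)}],\qquad \beta_K:K[t]/t^p\to K\mathbb G_{(r)},$$ for a field extension $K/k$, such that $\alpha_K$ sends $t$ to $0$ or is flat,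 $\beta_K$ sends $t$ to $0$ or is a $\pi$-point of $\mathbb G_{(r)}$, and at least one of $\alpha_K,\beta_K$ is flat. It defines the map $\alpha_K+\beta_K:K[t]/t^p\to O(\mathbb G_{(r)})_K$, $t\mapsto\alpha_K(t)\otimes1+1\otimes\beta_K(t)$, which for $\tilde D(\mathbb G_{(r)})$-modules is composed with $i_O$. Two $\pi$-point pairs $(\alpha_K,\beta_K)$, $(\alpha'_L,\beta'_L)$ of $\tilde D(\mathbb G_{(r)})$ are called equivalent (respectively, $O(\mathbb G_{(r)})$-equivalent) if there is a common field extension $\Omega$ of $K$ and $L$ over $k$ such that for all finite dimensional $\tilde D(\mathbb G_{(r)})$-modules (respectively, $O(\mathbb G_{(r)})$-modules) $M$ the $\Omega[t]/t^p$-module $(\alpha_\Omega+\beta_\Omega)^*(M_\Omega)$ is projective if and only if $(\alpha'_\Omega+\beta'_\Omega)^*(M_\Omega)$ is projective. These are equivalence relations. Let $\Pi(\tilde D(\mathbb G_{(r)}))$ and $\Pi(O(\mathbb G_{(r)}))$ be the sets of equivalence classes, and for a finite dimensional module $M$ over $\tilde D(\mathbb G_{(r)})$ (respectively, over $O(\mathbb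 G_{(r)})$) let $\Pi(\tilde D(\mathbb G_{(r)}))_M$ (respectively, $\Pi(O(\mathbb G_{(r)}))_M$) be the subset of the classes of those $\pi$-point pairs for which $(\alpha_K+\beta_K)^*(M_K)$ is not projective over $K[t]/t^p$. Since $O(\mathbb G_{(r)})$-equivalent pairs are equivalent, there is a natural surjection $$\Pi_{\tilde D}:\Pi(O(\mathbb G_{(r)}))\twoheadrightarrow\Pi(\tilde D(\mathbb G_{(r)})).$$ **Proposition.** The map $\Pi_{\tilde D}$ is a bijection. Moreover, for every finite dimensional $\tilde D(\mathbb G_{(r)})$-module $M$ it restricts to a bijection $$\Pi(O(\mathbb G_{(r)}))_M\ \stackrel{\sim}{\longrightarrow}\ \Pi(\tilde D(\mathbb G_{(r)}))_M,$$ where on the left hand side $M$ is regarded as an $O(\mathbb G_{(r)})$-module through $i_O$. -/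

import Mathlib

universe u
open scoped TensorProduct
open Coalgebra
noncomputable section

theorem add_pow_char_pow_of_algebra (k : Type u) [Field k] (p s : ℕ) [Fact p.Prime] [CharP k p]
    {S : Type u} [CommRing S] [Algebra k S] (a b : S) :
    (a + b) ^ p ^ s = a ^ p ^ s + b ^ p ^ s := by
  rcases subsingleton_or_nontrivial S with h | h
  · exact Subsingleton.elim _ _
  · have : CharP S p := charP_of_injective_algebraMap (algebraMap k S).injective p
    exact add_pow_char_pow a b p s

section FrobeniusKernel
variable (k : Type u) [Field k] (p s : ℕ) (R : Type u) [CommRing R] [HopfAlgebra k R]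

/-- For a Hopf algebra `R` over a field `k` of characteristic `p`, the ideal generated by the
`p^s`-th powers of the elements of the augmentation ideal. -/
def frobeniusIdeal : Ideal R :=
  Ideal.span {y : R | ∃ x : R, counit (R := k) x = 0 ∧ y = x ^ p ^ s}

/-- The coordinate algebra `k[𝔾_(s)]` of the `s`-th Frobenius kernel of the affine group scheme
`𝔾` with coordinate algebra `R = k[𝔾]`: the quotient of `R` by the ideal generated by the `p^s`-th
powers of the functions vanishing at the identity. (This quotient is already local, so one need not
localize at the identity first.) -/
def FrobeniusKernel : Type u := R ⧸ frobeniusIdeal k p s R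

instance : CommRing (FrobeniusKernel k p s R) :=
  inferInstanceAs (CommRing (R ⧸ frobeniusIdeal k p s R))

variable [Fact p.Prime] [CharP k p]

theorem frobeniusIdeal_isHopfIdeal : (frobeniusIdeal k p s R).IsHopfIdeal k := by
  have key : ∀ {S : Type u} [CommRing S] [Algebra k S] (f : R →ₐ[k] S),
      (∀ x : R, counit (R := k) x = 0 → f x ^ p ^ s = 0) → ∀ x ∈ frobeniusIdeal k p s R, f x = 0 := by
    intro S _ _ f hf x hx
    have : frobeniusIdeal k p s R ≤ RingHom.ker f := by
      rw [frobeniusIdeal, Ideal.span_le]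
      rintro _ ⟨x, hx, rfl⟩
      simpa using hf x hx
    exact this hx
  have hmem : ∀ x : R, counit (R := k) x = 0 →
      (Ideal.Quotient.mkₐ k (frobeniusIdeal k p s R) x) ^ p ^ s = 0 := by
    intro x hx
    rw [← map_pow]
    exact Ideal.Quotient.eq_zero_iff_mem.2 (Ideal.subset_span ⟨x, hx, rfl⟩)
  have hp : p ^ s ≠ 0 := pow_ne_zero _ (Fact.out : p.Prime).ne_zero
  let π := Ideal.Quotient.mkₐ k (frobeniusIdeal k p s R)
  have hpi : ∀ z : R, (π z) ^ p ^ s = algebraMap k _ (counit (R := k) z ^ p ^ s) := by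
    intro z
    have h1 := hmem (z - algebraMap k R (counit (R := k) z)) (by simp)
    have h2 : π z = π (z - algebraMap k R (counit (R := k) z)) +
        algebraMap k _ (counit (R := k) z) := by
      rw [← AlgHom.commutes π, ← map_add, sub_add_cancel]
    rw [h2, add_pow_char_pow_of_algebra k, h1, zero_add, map_pow]
  have hten : ∀ z : R ⊗[k] R, (Algebra.TensorProduct.map π π z) ^ p ^ s = algebraMap k _
      (TensorProduct.lid k k (TensorProduct.map counit counit z) ^ p ^ s) := by
    intro z
    induction z using TensorProduct.induction_on with
    | zero => simp only [map_zero, zero_pow hp]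
    | tmul a b =>
      simp only [Algebra.TensorProduct.map_tmul, Algebra.TensorProduct.tmul_pow, hpi,
        TensorProduct.map_tmul, TensorProduct.lid_tmul, smul_eq_mul, mul_pow, map_mul]
      simp only [Algebra.algebraMap_eq_smul_one, TensorProduct.smul_tmul_smul,
        Algebra.TensorProduct.one_def, smul_mul_smul_comm]
      simp
    | add a b ha hb =>
      rw [map_add, add_pow_char_pow_of_algebra k, ha, hb, map_add, map_add,
        add_pow_char_pow_of_algebra k, map_add]
  refine { counit_eq_zero := ?_, map_mkQ_comul_eq_zero := ?_, antipode_mem := ?_ }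
  · intro x hx
    exact key (Bialgebra.counitAlgHom k R) (fun x hx => by simp only [Bialgebra.counitAlgHom_apply, hx, zero_pow hp]) x hx
  · intro x hx
    have := key ((Algebra.TensorProduct.map π π).comp (Bialgebra.comulAlgHom k R)) ?_ x hx
    · exact this
    · intro x hx
      rw [AlgHom.comp_apply, hten]
      have : TensorProduct.map counit counit (comul (R := k) x) = 1 ⊗ₜ[k] counit (R := k) x := by
        rw [← LinearMap.lTensor_comp_rTensor, LinearMap.comp_apply, rTensor_counit_comul]
        simp
      simp only [Bialgebra.comulAlgHom_apply, this, hx, TensorProduct.tmul_zero, map_zero,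
        zero_pow hp]
  · intro x hx
    have := key (π.comp (HopfAlgebra.antipodeAlgHom k R)) (fun x hx => hmem _ (by simp [hx])) x hx
    exact Ideal.Quotient.eq_zero_iff_mem.1 this

/-- The Hopf algebra structure making `R → k[𝔾_(s)]` a map of Hopf algebras. -/
instance : HopfAlgebra k (FrobeniusKernel k p s R) :=
  have := frobeniusIdeal_isHopfIdeal k p s R
  inferInstanceAs (HopfAlgebra k (R ⧸ frobeniusIdeal k p s R))

namespace FrobeniusKernel

/-- The restriction of functions `k[𝔾] → k[𝔾_(s)]`. -/
def mk : R →ₐc[k] FrobeniusKernel k p s R :=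
  have := frobeniusIdeal_isHopfIdeal k p s R
  Bialgebra.Quotient.mkBialgHom (frobeniusIdeal k p s R)

theorem mk_surjective : Function.Surjective (mk k p s R) := Ideal.Quotient.mk_surjective

theorem mk_pow_eq_zero (x : R) (hx : counit (R := k) x = 0) : mk k p s R x ^ p ^ s = 0 := by
  rw [← map_pow]
  exact Ideal.Quotient.eq_zero_iff_mem.2 (Ideal.subset_span ⟨x, hx, rfl⟩)

theorem pow_eq (y : FrobeniusKernel k p s R) :
    y ^ p ^ s = algebraMap k _ (counit (R := k) y ^ p ^ s) := by
  obtain ⟨x, rfl⟩ := mk_surjective k p s R y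
  have h2 : mk k p s R x = mk k p s R
      (x - algebraMap k R (counit (R := k) x)) + algebraMap k _ (counit (R := k) x) := by
    rw [← AlgHomClass.commutes (mk k p s R), ← map_add, sub_add_cancel]
  rw [CoalgHomClass.counit_comp_apply, h2, add_pow_char_pow_of_algebra k,
    mk_pow_eq_zero _ _ _ _ _ (by simp), zero_add, ← map_pow]

variable {k p s R}

/-- The universal property of `k[𝔾_(s)]` as a quotient of `R`. -/
def lift {S : Type u} [CommRing S] [Algebra k S] (f : R →ₐ[k] S)
    (hf : ∀ x, counit (R := k) x = 0 → f x ^ p ^ s = 0) : FrobeniusKernel k p s R →ₐ[k] S :=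
  Ideal.Quotient.liftₐ (frobeniusIdeal k p s R) f (by
    have : frobeniusIdeal k p s R ≤ RingHom.ker f := by
      rw [frobeniusIdeal, Ideal.span_le]
      rintro _ ⟨x, hx, rfl⟩
      simpa using hf x hx
    exact fun a ha => this ha)

theorem lift_mk {S : Type u} [CommRing S] [Algebra k S] (f : R →ₐ[k] S)
    (hf : ∀ x, counit (R := k) x = 0 → f x ^ p ^ s = 0) (x : R) :
    lift f hf (mk k p s R x) = f x := rfl

/-- The restriction of functions `k[𝔾_(s+1)] → k[𝔾_(s)]`. -/
def restrict : FrobeniusKernel k p (s + 1) R →ₐc[k] FrobeniusKernel k p s R :=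
  .ofAlgHom (lift (mk k p s R : R →ₐ[k] FrobeniusKernel k p s R) (by
      intro x hx
      rw [pow_succ, pow_mul]
      change (mk k p s R x ^ p ^ s) ^ p = 0
      rw [mk_pow_eq_zero k p s R x hx, zero_pow (Fact.out : p.Prime).ne_zero]))
    (by
      ext y
      obtain ⟨x, rfl⟩ := mk_surjective k p (s + 1) R y
      simp [lift_mk])
    (by
      ext y
      obtain ⟨x, rfl⟩ := mk_surjective k p (s + 1) R y
      rw [AlgHom.comp_apply, AlgHom.comp_apply, lift_mk, Bialgebra.comulAlgHom_apply,
        Bialgebra.comulAlgHom_apply, ← CoalgHomClass.map_comp_comul_apply, ← (ℛ k x).eq]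
      change _ = comul (R := k) (mk k p s R x)
      rw [← CoalgHomClass.map_comp_comul_apply, ← (ℛ k x).eq]
      simp [lift_mk])

theorem restrict_mk (x : R) : restrict (mk k p (s + 1) R x) = mk k p s R x := rfl

instance [Algebra.FiniteType k R] : Module.Finite k (FrobeniusKernel k p s R) := by
  have : Algebra.FiniteType k (FrobeniusKernel k p s R) :=
    .of_surjective (mk k p s R : R →ₐ[k] FrobeniusKernel k p s R) (mk_surjective k p s R)
  have : Algebra.IsIntegral k (FrobeniusKernel k p s R) := by
    refine ⟨fun y => IsIntegral.of_pow (pow_pos (Fact.out : p.Prime).pos s) ?_⟩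
    rw [pow_eq]
    exact isIntegral_algebraMap
  exact Algebra.IsIntegral.finite

end FrobeniusKernel

end FrobeniusKernel

section Twist
variable (k : Type u) [Field k] (p r : ℕ) [Fact p.Prime] [CharP k p] (R : Type u) [CommRing R] [HopfAlgebra k R]

/-- The field `k`, regarded as a `k`-algebra through the `p^r`-th power map. -/
def TwistField (k : Type u) (_p _r : ℕ) : Type u := k

instance : Field (TwistField k p r) := inferInstanceAs (Field k)

instance : Algebra k (TwistField k p r) := RingHom.toAlgebra (S := TwistField k p r) (iterateFrobenius k p r)

/-- The coordinate algebra `k[𝔾^(r)] = k ⊗_φ k[𝔾]` of the `r`-th Frobenius twist, the base change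
of `R` along the `p^r`-th power map `φ` of `k`; `k` acts through the left hand factor. -/
def FrobeniusTwist : Type u := TwistField k p r ⊗[k] R

instance : CommRing (FrobeniusTwist k p r R) := inferInstanceAs (CommRing (TwistField k p r ⊗[k] R))

instance : HopfAlgebra k (FrobeniusTwist k p r R) :=
  inferInstanceAs (HopfAlgebra (TwistField k p r) (TwistField k p r ⊗[k] R))

variable {k p r R}

namespace FrobeniusTwist

/-- The element `c ⊗ f` of `k[𝔾^(r)]`. -/
def tmul (c : k) (f : R) : FrobeniusTwist k p r R :=
  TensorProduct.tmul k (M := TwistField k p r) (N := R) c f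

theorem counit_tmul (c : k) (f : R) :
    counit (R := k) (tmul c f : FrobeniusTwist k p r R) = c * counit (R := k) f ^ p ^ r := by
  refine (TensorProduct.counit_tmul (S := TwistField k p r) (R := k)
    (A := TwistField k p r) c f).trans ?_
  refine (Algebra.smul_def (A := TwistField k p r) _ _).trans ?_
  exact mul_comm (counit (R := k) f ^ p ^ r) c

variable {S : Type u} [CommRing S] [Algebra k S]

/-- The ring map `f ↦ g(f)^(p^r)`. -/
def powHom (g : R →ₐ[k] S) : R →+* S where
  toFun f := g f ^ p ^ r
  map_one' := by simp
  map_zero' := by simp [(Fact.out : p.Prime).ne_zero]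
  map_mul' := by simp [mul_pow]
  map_add' := by simp [add_pow_char_pow_of_algebra k]

/-- The algebra `S`, with `k` acting through the `p^r`-th power map. -/
def Pushed (k : Type u) (_p _r : ℕ) (S : Type u) [Field k] [CommRing S] [Algebra k S] : Type u := S

instance : CommRing (Pushed k p r S) := inferInstanceAs (CommRing S)

instance : Algebra (TwistField k p r) (Pushed k p r S) := inferInstanceAs (Algebra k S)

instance : Algebra k (Pushed k p r S) :=
  Algebra.compHom (Pushed k p r S) (algebraMap k (TwistField k p r))

instance : IsScalarTower k (TwistField k p r) (Pushed k p r S) :=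
  IsScalarTower.of_algebraMap_eq fun _ => rfl

/-- `powHom` as an algebra map. -/
def powAlgHom (g : R →ₐ[k] S) : R →ₐ[k] Pushed k p r S where
  __ := powHom (p := p) (r := r) g
  commutes' c := by
    change g (algebraMap k R c) ^ p ^ r = algebraMap k S (c ^ p ^ r)
    rw [AlgHom.commutes, map_pow]

/-- The map of `frobenius`, before identifying the scalars. -/
def frobeniusAux (g : R →ₐ[k] S) : TwistField k p r ⊗[k] R →ₐ[TwistField k p r] Pushed k p r S :=
  Algebra.TensorProduct.lift (Algebra.ofId (TwistField k p r) (Pushed k p r S)) (powAlgHom g)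
    (fun _ _ => Commute.all _ _)

/-- The `k`-algebra map `k[𝔾^(r)] → S`, `c ⊗ f ↦ c g(f)^(p^r)`, for `g : k[𝔾] → S`: the comorphism of
`Spec S → 𝔾 → 𝔾^(r)`, the second map being the `r`-th iterate of Frobenius. -/
def frobenius (g : R →ₐ[k] S) : FrobeniusTwist k p r R →ₐ[k] S :=
  { toFun := frobeniusAux (p := p) (r := r) g
    map_one' := map_one (frobeniusAux (p := p) (r := r) g)
    map_mul' := map_mul (frobeniusAux (p := p) (r := r) g)
    map_zero' := map_zero (frobeniusAux (p := p) (r := r) g)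
    map_add' := map_add (frobeniusAux (p := p) (r := r) g)
    commutes' := (frobeniusAux (p := p) (r := r) g).commutes }

theorem frobenius_tmul (g : R →ₐ[k] S) (c : k) (f : R) :
    frobenius g (tmul c f : FrobeniusTwist k p r R) = c • g f ^ p ^ r := by
  refine Eq.trans (b := (Algebra.ofId (TwistField k p r) (Pushed k p r S) c * powAlgHom g f : Pushed k p r S)) ?_ ?_
  · exact Algebra.TensorProduct.lift_tmul (R := k) (S := TwistField k p r)
      (Algebra.ofId (TwistField k p r) (Pushed k p r S)) (powAlgHom g) (fun _ _ => Commute.all _ _)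
      c f
  · exact (Algebra.smul_def (A := S) c (g f ^ p ^ r)).symm

@[elab_as_elim]
theorem induction {P : FrobeniusTwist k p r R → Prop} (h0 : P 0) (ht : ∀ c f, P (tmul c f))
    (ha : ∀ x y, P x → P y → P (x + y)) (x : FrobeniusTwist k p r R) : P x :=
  TensorProduct.induction_on x h0 ht ha

end FrobeniusTwist

/-- The comorphism `k[(𝔾^(r))_(1)] → k[𝔾_(r+1)]`, `c ⊗ f ↦ c f^(p^r)`, of the map
`F^r : 𝔾_(r+1) → (𝔾^(r))_(1)` which identifies `𝔾_(r+1)/𝔾_(r)` with `(𝔾^(r))_(1)`. -/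
def frobeniusQuotientHom : FrobeniusKernel k p 1 (FrobeniusTwist k p r R) →ₐ[k]
    FrobeniusKernel k p (r + 1) R :=
  FrobeniusKernel.lift (FrobeniusTwist.frobenius
      (FrobeniusKernel.mk k p (r + 1) R : R →ₐ[k] FrobeniusKernel k p (r + 1) R)) (by
    intro y hy
    have key : ∀ y : FrobeniusTwist k p r R, FrobeniusTwist.frobenius
        (FrobeniusKernel.mk k p (r + 1) R : R →ₐ[k] FrobeniusKernel k p (r + 1) R) y ^ p ^ 1 =
          algebraMap k _ (counit (R := k) y ^ p) := by
      intro y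
      induction y using FrobeniusTwist.induction with
      | h0 => simp [(Fact.out : p.Prime).ne_zero]
      | ht c f =>
        rw [FrobeniusTwist.frobenius_tmul, FrobeniusTwist.counit_tmul, smul_pow, ← pow_mul, pow_one,
          mul_pow, ← pow_mul, ← pow_succ]
        change c ^ p • (FrobeniusKernel.mk k p (r + 1) R f) ^ p ^ (r + 1) = _
        rw [FrobeniusKernel.pow_eq, Algebra.smul_def, ← map_mul, CoalgHomClass.counit_comp_apply]
      | ha x y hx hy =>
        rw [map_add, map_add, add_pow_char_pow_of_algebra k, hx, hy, ← map_add]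
        have := add_pow_char_pow_of_algebra k p 1 (counit (R := k) x) (counit (R := k) y)
        rw [pow_one] at this
        rw [this]
    rw [key, hy, zero_pow (Fact.out : p.Prime).ne_zero, map_zero])

theorem frobeniusQuotientHom_mk_tmul (c : k) (f : R) :
    frobeniusQuotientHom (FrobeniusKernel.mk k p 1 _ (FrobeniusTwist.tmul c f)) =
      c • (FrobeniusKernel.mk k p (r + 1) R f) ^ p ^ r :=
  FrobeniusTwist.frobenius_tmul
    (FrobeniusKernel.mk k p (r + 1) R : R →ₐ[k] FrobeniusKernel k p (r + 1) R) c f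

end Twist

section GroupAlgebra
variable (k : Type u) [Field k] (B : Type u) [CommRing B] [HopfAlgebra k B]

/-- The group algebra `kG` of a finite group scheme `G` with coordinate algebra `B = k[G]`: the
linear dual of `B`, with the convolution product `(f * g)(b) = ∑ f(b₁) g(b₂)`. -/
def GroupAlg : Type u := WithConv (B →ₗ[k] k)

instance : Ring (GroupAlg k B) := inferInstanceAs (Ring (WithConv (B →ₗ[k] k)))

instance : Algebra k (GroupAlg k B) := inferInstanceAs (Algebra k (WithConv (B →ₗ[k] k)))

namespace GroupAlg

/-- The identification of the group algebra with the linear dual of `B`. -/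
def toDual : GroupAlg k B ≃ₗ[k] Module.Dual k B where
  toFun := WithConv.ofConv
  invFun := WithConv.toConv
  map_add' _ _ := rfl
  map_smul' _ _ := rfl
  left_inv _ := rfl
  right_inv _ := rfl

variable {k B} in
theorem toDual_mul (f g : GroupAlg k B) {ι : Type*} {b : B} (rb : Coalgebra.Repr k b ι) :
    toDual k B (f * g) b = ∑ i ∈ rb.index, toDual k B f (rb.left i) * toDual k B g (rb.right i) :=
  rb.convMul_apply (f : WithConv (B →ₗ[k] k)) g

variable {k B} in
theorem toDual_one (b : B) : toDual k B 1 b = counit (R := k) b := rfl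

variable {k B} in
theorem toDual_mul_one (f g : GroupAlg k B) :
    toDual k B (f * g) 1 = toDual k B f 1 * toDual k B g 1 := by
  rw [toDual_mul f g (b := 1) ⟨{()}, fun _ => 1, fun _ => 1, by simp [Algebra.TensorProduct.one_def]⟩]
  simp

variable [Module.Finite k B]

/-- The identification of `kG ⊗ kG` with the dual of `B ⊗ B`. -/
def pairing : GroupAlg k B ⊗[k] GroupAlg k B ≃ₗ[k] Module.Dual k (B ⊗[k] B) :=
  (TensorProduct.congr (toDual k B) (toDual k B)).trans
    (TensorProduct.dualDistribEquiv k B B)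

theorem pairing_tmul (f g : GroupAlg k B) (b c : B) :
    pairing k B (f ⊗ₜ g) (b ⊗ₜ c) = toDual k B f b * toDual k B g c := rfl

/-- The coproduct of `kG` is dual to the product of `B`; the counit is evaluation at `1`. -/
instance : CoalgebraStruct k (GroupAlg k B) where
  comul := (pairing k B).symm.toLinearMap ∘ₗ (LinearMap.mul' k B).dualMap ∘ₗ
    (toDual k B).toLinearMap
  counit := LinearMap.applyₗ (1 : B) ∘ₗ (toDual k B).toLinearMap

theorem pairing_comul (h : GroupAlg k B) :
    pairing k B (comul h) = toDual k B h ∘ₗ LinearMap.mul' k B :=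
  (pairing k B).apply_symm_apply _

theorem counit_apply (h : GroupAlg k B) : counit (R := k) h = toDual k B h 1 := rfl

/-- The identification of `kG ⊗ kG ⊗ kG` with the dual of `B ⊗ B ⊗ B`. -/
def pairing₃ : GroupAlg k B ⊗[k] (GroupAlg k B ⊗[k] GroupAlg k B) ≃ₗ[k]
    Module.Dual k (B ⊗[k] (B ⊗[k] B)) :=
  (TensorProduct.congr (toDual k B) (pairing k B)).trans
    (TensorProduct.dualDistribEquiv k B (B ⊗[k] B))

theorem pairing₃_tmul (f : GroupAlg k B) (z : GroupAlg k B ⊗[k] GroupAlg k B) (b : B) (w : B ⊗[k] B) :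
    pairing₃ k B (f ⊗ₜ z) (b ⊗ₜ w) = toDual k B f b * pairing k B z w := rfl

instance : Coalgebra k (GroupAlg k B) where
  coassoc := by
    ext h
    apply (pairing₃ k B).injective
    have h1 : ∀ (z : GroupAlg k B ⊗[k] GroupAlg k B) (a b c : B),
        pairing₃ k B (comul.lTensor _ z) (a ⊗ₜ (b ⊗ₜ c)) = pairing k B z (a ⊗ₜ (b * c)) := by
      intro z a b c
      induction z using TensorProduct.induction_on with
      | zero => simp
      | tmul f g => rw [LinearMap.lTensor_tmul, pairing₃_tmul, pairing_comul]; rfl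
      | add x y hx hy => simp only [map_add, LinearMap.add_apply, hx, hy]
    have h2 : ∀ (w : GroupAlg k B ⊗[k] GroupAlg k B) (g : GroupAlg k B) (a b c : B),
        pairing₃ k B (TensorProduct.assoc k _ _ _ (w ⊗ₜ g)) (a ⊗ₜ (b ⊗ₜ c)) =
          pairing k B w (a ⊗ₜ b) * toDual k B g c := by
      intro w g a b c
      induction w using TensorProduct.induction_on with
      | zero => simp
      | tmul f f' =>
        rw [TensorProduct.assoc_tmul, pairing₃_tmul, pairing_tmul, pairing_tmul, mul_assoc]
      | add x y hx hy => simp only [map_add, LinearMap.add_apply, hx, hy, TensorProduct.add_tmul, add_mul]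
    have h3 : ∀ (z : GroupAlg k B ⊗[k] GroupAlg k B) (a b c : B),
        pairing₃ k B (TensorProduct.assoc k _ _ _ (comul.rTensor _ z)) (a ⊗ₜ (b ⊗ₜ c)) =
          pairing k B z ((a * b) ⊗ₜ c) := by
      intro z a b c
      induction z using TensorProduct.induction_on with
      | zero => simp
      | tmul f g => rw [LinearMap.rTensor_tmul, h2, pairing_comul]; rfl
      | add x y hx hy => simp only [map_add, LinearMap.add_apply, hx, hy]
    ext a b c
    refine (h3 (comul h) a b c).trans (Eq.trans ?_ (h1 (comul h) a b c).symm)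
    rw [pairing_comul]
    simp [mul_assoc]
  rTensor_counit_comp_comul := by
    ext h
    apply (TensorProduct.lid k _).injective
    have h1 : ∀ (z : GroupAlg k B ⊗[k] GroupAlg k B) (a : B),
        toDual k B (TensorProduct.lid k _ (counit.rTensor _ z)) a = pairing k B z (1 ⊗ₜ a) := by
      intro z a
      induction z using TensorProduct.induction_on with
      | zero => simp
      | tmul f g => simp [pairing_tmul, counit_apply]
      | add x y hx hy =>
        simp only [map_add, LinearMap.add_apply] at hx hy ⊢
        rw [hx, hy]
    apply (toDual k B).injective
    ext a
    refine (h1 _ a).trans ?_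
    rw [pairing_comul]
    simp
  lTensor_counit_comp_comul := by
    ext h
    apply (TensorProduct.rid k _).injective
    have h1 : ∀ (z : GroupAlg k B ⊗[k] GroupAlg k B) (a : B),
        toDual k B (TensorProduct.rid k _ (counit.lTensor _ z)) a = pairing k B z (a ⊗ₜ 1) := by
      intro z a
      induction z using TensorProduct.induction_on with
      | zero => simp
      | tmul f g => simp [pairing_tmul, counit_apply, mul_comm]
      | add x y hx hy =>
        simp only [map_add, LinearMap.add_apply] at hx hy ⊢
        rw [hx, hy]
    apply (toDual k B).injective
    ext a
    refine (h1 _ a).trans ?_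
    rw [pairing_comul]
    simp

theorem pairing_mul (z w : GroupAlg k B ⊗[k] GroupAlg k B) {ι κ : Type*} {a b : B}
    (ra : Coalgebra.Repr k a ι) (rb : Coalgebra.Repr k b κ) :
    pairing k B (z * w) (a ⊗ₜ b) = ∑ i ∈ ra.index, ∑ j ∈ rb.index,
      pairing k B z (ra.left i ⊗ₜ rb.left j) * pairing k B w (ra.right i ⊗ₜ rb.right j) := by
  induction z using TensorProduct.induction_on with
  | zero => simp
  | add x y hx hy =>
    simp only [add_mul, map_add, LinearMap.add_apply, hx, hy, Finset.sum_add_distrib]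
  | tmul f g =>
    induction w using TensorProduct.induction_on with
    | zero => simp
    | add x y hx hy =>
      simp only [mul_add, map_add, LinearMap.add_apply, hx, hy, Finset.sum_add_distrib]
    | tmul f' g' =>
      rw [Algebra.TensorProduct.tmul_mul_tmul, pairing_tmul, toDual_mul _ _ ra, toDual_mul _ _ rb,
        Finset.sum_mul_sum]
      refine Finset.sum_congr rfl fun i _ => Finset.sum_congr rfl fun j _ => ?_
      exact mul_mul_mul_comm _ _ _ _

instance : Bialgebra k (GroupAlg k B) where
  counit_one := by rw [counit_apply, toDual_one, Bialgebra.counit_one]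
  mul_compr₂_counit := by
    ext f g
    exact toDual_mul_one f g
  comul_one := by
    apply (pairing k B).injective
    rw [pairing_comul, Algebra.TensorProduct.one_def]
    ext a b
    simp [pairing_tmul, toDual_one]
  mul_compr₂_comul := by
    ext f g
    apply (pairing k B).injective
    ext a b
    refine Eq.trans ?_ (pairing_mul k B _ _ (ℛ k a) (ℛ k b)).symm
    simp only [LinearMap.compr₂_apply, LinearMap.mul_apply', pairing_comul]
    change toDual k B (f * g) (a * b) = _
    rw [toDual_mul f g ((ℛ k a).mul (ℛ k b))]
    simp [Finset.sum_product]
end GroupAlg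
end GroupAlgebra

section Smash
variable (k : Type u) [Field k] (A H : Type u) [Ring A] [Algebra k A] [Ring H] [Bialgebra k H]

/-- A left action of a bialgebra `H` on an algebra `A` by which `A` is an `H`-module algebra:
`h(1) = ε(h) 1` and `h(ab) = ∑ h₁(a) h₂(b)`. -/
class LeftModuleAlgebra where
  act : H →ₐ[k] Module.End k A
  act_one : ∀ h : H, act h 1 = algebraMap k A (counit (R := k) h)
  act_mul : ∀ (h : H) (a b : A), act h (a * b) =
    LinearMap.mul' k A (TensorProduct.map (act.toLinearMap.flip a) (act.toLinearMap.flip b)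
      (comul (R := k) h))

/-- The smash product `A # H` of an `H`-module algebra `A` with `H`: the space `A ⊗ H`, with product
`(f # h)(f' # h') = ∑ f h₁(f') # h₂ h'`, see `SmashProduct.tmul_mul_tmul`. -/
def SmashProduct (k : Type u) [Field k] (A H : Type u) [Ring A] [Algebra k A] [Ring H]
    [Bialgebra k H] : Type u := A ⊗[k] H

namespace SmashProduct

instance : AddCommGroup (SmashProduct k A H) := inferInstanceAs (AddCommGroup (A ⊗[k] H))
instance : Module k (SmashProduct k A H) := inferInstanceAs (Module k (A ⊗[k] H))
variable {k A H} in
/-- The element `f # h`. -/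
def tmul (f : A) (h : H) : SmashProduct k A H := (f ⊗ₜ[k] h : A ⊗[k] H)

variable {k A H} in
@[elab_as_elim]
theorem induction {P : SmashProduct k A H → Prop} (h0 : P 0) (ht : ∀ f h, P (tmul f h))
    (ha : ∀ x y, P x → P y → P (x + y)) (x : SmashProduct k A H) : P x :=
  TensorProduct.induction_on x h0 ht ha


variable [LeftModuleAlgebra k A H]

/-- The map `h ⊗ a ↦ ∑ h₁(a) ⊗ h₂`. -/
def cross : H →ₗ[k] A →ₗ[k] A ⊗[k] H :=
  LinearMap.mk₂ k (fun h a => TensorProduct.map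
    ((LeftModuleAlgebra.act (k := k) (A := A) (H := H)).toLinearMap.flip a) LinearMap.id (comul h))
    (by intros; simp) (by intros; simp)
    (by intros; simp [TensorProduct.map_add_left]) (by intros; simp [TensorProduct.map_smul_left])

/-- The product of the smash product. -/
def mulHom : A ⊗[k] H →ₗ[k] A ⊗[k] H →ₗ[k] A ⊗[k] H :=
  TensorProduct.lift (LinearMap.mk₂ k
    (fun f h => TensorProduct.lift (LinearMap.mk₂ k
      (fun f' h' => (f ⊗ₜ[k] 1 * cross k A H h f' * 1 ⊗ₜ[k] h' : A ⊗[k] H))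
      (by intros; simp [mul_add, add_mul]) (by intros; simp)
      (by intros; simp [TensorProduct.tmul_add, mul_add]) (by intros; simp)))
      (by intros; ext; simp [TensorProduct.add_tmul, add_mul])
      (by intros; ext; simp [← TensorProduct.smul_tmul'])
      (by intros; ext; simp [mul_add, add_mul])
      (by intros; ext; simp))

variable {k A H}

instance : Mul (SmashProduct k A H) := ⟨fun x y => mulHom k A H x y⟩
instance : One (SmashProduct k A H) := ⟨tmul 1 1⟩

theorem tmul_mul_tmul (f f' : A) (h h' : H) {ι : Type*} (rh : Coalgebra.Repr k h ι) :
    (tmul f h * tmul f' h' : SmashProduct k A H) = ∑ i ∈ rh.index,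
      tmul (f * LeftModuleAlgebra.act (k := k) (rh.left i) f') (rh.right i * h') := by
  change (f ⊗ₜ[k] 1 * cross k A H h f' * 1 ⊗ₜ[k] h' : A ⊗[k] H) = ∑ i ∈ rh.index,
      (f * LeftModuleAlgebra.act (k := k) (rh.left i) f') ⊗ₜ[k] (rh.right i * h')
  rw [cross, LinearMap.mk₂_apply, ← rh.eq]
  simp [Finset.mul_sum, Finset.sum_mul]

theorem act_mul_repr (h : H) (a b : A) {ι : Type*} (rh : Coalgebra.Repr k h ι) :
    LeftModuleAlgebra.act (k := k) h (a * b) = ∑ i ∈ rh.index,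
      LeftModuleAlgebra.act (k := k) (rh.left i) a * LeftModuleAlgebra.act (k := k) (rh.right i) b := by
  rw [LeftModuleAlgebra.act_mul, ← rh.eq]
  simp

theorem add_mul' (x y z : SmashProduct k A H) : (x + y) * z = x * z + y * z :=
  LinearMap.congr_fun (map_add (mulHom k A H) x y) z
theorem mul_add' (x y z : SmashProduct k A H) : x * (y + z) = x * y + x * z :=
  map_add (mulHom k A H x) y z
theorem zero_mul' (z : SmashProduct k A H) : 0 * z = 0 :=
  LinearMap.congr_fun (map_zero (mulHom k A H)) z
theorem mul_zero' (z : SmashProduct k A H) : z * 0 = 0 := map_zero (mulHom k A H z)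

theorem sum_mul' {ι : Type*} (s : Finset ι) (f : ι → SmashProduct k A H) (z : SmashProduct k A H) :
    (∑ i ∈ s, f i) * z = ∑ i ∈ s, f i * z := by
  classical
  induction s using Finset.induction_on with
  | empty => simp [zero_mul']
  | insert a s h ih => simp only [Finset.sum_insert h, add_mul', ih]
theorem mul_sum' {ι : Type*} (s : Finset ι) (f : ι → SmashProduct k A H) (z : SmashProduct k A H) :
    z * (∑ i ∈ s, f i) = ∑ i ∈ s, z * f i := by
  classical
  induction s using Finset.induction_on with
  | empty => simp [mul_zero']
  | insert a s h ih => simp only [Finset.sum_insert h, mul_add', ih]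

theorem mul_assoc_tmul (f f' f'' : A) (h h' h'' : H) :
    (tmul f h * tmul f' h' * tmul f'' h'' : SmashProduct k A H) =
      tmul f h * (tmul f' h' * tmul f'' h'') := by
  rw [tmul_mul_tmul f f' h h' (ℛ k h), tmul_mul_tmul f' f'' h' h'' (ℛ k h'), sum_mul', mul_sum']
  have hl : ∀ i ∈ (ℛ k h).index,
      (tmul (f * LeftModuleAlgebra.act (k := k) ((ℛ k h).left i) f') ((ℛ k h).right i * h') *
        tmul f'' h'' : SmashProduct k A H) = ∑ b ∈ (ℛ k h').index,
          ∑ a ∈ (ℛ k ((ℛ k h).right i)).index,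
          tmul (f * LeftModuleAlgebra.act (k := k) ((ℛ k h).left i) f' *
            LeftModuleAlgebra.act (k := k) ((ℛ k ((ℛ k h).right i)).left a)
              (LeftModuleAlgebra.act (k := k) ((ℛ k h').left b) f''))
            ((ℛ k ((ℛ k h).right i)).right a * ((ℛ k h').right b * h'')) := by
    intro i _
    rw [tmul_mul_tmul _ _ _ _ ((ℛ k ((ℛ k h).right i)).mul (ℛ k h')), Finset.sum_comm]
    simp [Finset.sum_product, map_mul, mul_assoc]
  have hr : ∀ b ∈ (ℛ k h').index,
      (tmul f h * tmul (f' * LeftModuleAlgebra.act (k := k) ((ℛ k h').left b) f'')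
        ((ℛ k h').right b * h'') : SmashProduct k A H) = ∑ i ∈ (ℛ k h).index,
          ∑ a ∈ (ℛ k ((ℛ k h).left i)).index,
          tmul (f * LeftModuleAlgebra.act (k := k) ((ℛ k ((ℛ k h).left i)).left a) f' *
            LeftModuleAlgebra.act (k := k) ((ℛ k ((ℛ k h).left i)).right a)
              (LeftModuleAlgebra.act (k := k) ((ℛ k h').left b) f''))
            ((ℛ k h).right i * ((ℛ k h').right b * h'')) := by
    intro b _
    rw [tmul_mul_tmul _ _ _ _ (ℛ k h)]
    refine Finset.sum_congr rfl fun i _ => ?_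
    rw [act_mul_repr _ _ _ (ℛ k ((ℛ k h).left i)), Finset.mul_sum]
    simp only [← mul_assoc]
    exact TensorProduct.sum_tmul _ _ _
  rw [Finset.sum_congr rfl hl, Finset.sum_congr rfl hr, Finset.sum_comm]
  refine Finset.sum_congr rfl fun b _ => ?_
  have := Coalgebra.sum_tmul_tmul_eq (ℛ k h) (fun i => ℛ k ((ℛ k h).left i))
    (fun i => ℛ k ((ℛ k h).right i))
  let L := (LeftModuleAlgebra.act (k := k) (A := A) (H := H)).toLinearMap
  let F : H ⊗[k] (H ⊗[k] H) →ₗ[k] A ⊗[k] H :=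
    (LinearMap.mul' k A).rTensor H ∘ₗ (TensorProduct.assoc k A A H).symm.toLinearMap ∘ₗ
      TensorProduct.map (LinearMap.mulLeft k f ∘ₗ L.flip f')
        (TensorProduct.map (L.flip (LeftModuleAlgebra.act (k := k) ((ℛ k h').left b) f''))
          (LinearMap.mulRight k ((ℛ k h').right b * h'')))
  have h2 := congrArg F this
  simp only [map_sum] at h2
  exact h2.symm

instance : Ring (SmashProduct k A H) where
  __ := (inferInstance : AddCommGroup (SmashProduct k A H))
  left_distrib := mul_add'
  right_distrib := add_mul'
  zero_mul := zero_mul'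
  mul_zero := mul_zero'
  mul_assoc x y z := by
    induction x using induction with
    | h0 => simp only [zero_mul']
    | ha x x' hx hx' => simp only [add_mul', hx, hx']
    | ht f h =>
      induction y using induction with
      | h0 => simp only [zero_mul', mul_zero']
      | ha x x' hx hx' => simp only [add_mul', mul_add', hx, hx']
      | ht f' h' =>
        induction z using induction with
        | h0 => simp only [mul_zero']
        | ha x x' hx hx' => simp only [mul_add', hx, hx']
        | ht f'' h'' => exact mul_assoc_tmul ..
  one_mul x := by
    induction x using induction with
    | h0 => exact mul_zero' _
    | ha x y hx hy => rw [mul_add', hx, hy]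
    | ht f h =>
      refine (tmul_mul_tmul 1 f 1 h ⟨{()}, fun _ => 1, fun _ => 1, by
        simp [Algebra.TensorProduct.one_def]⟩).trans ?_
      simp
  mul_one x := by
    induction x using induction with
    | h0 => exact zero_mul' _
    | ha x y hx hy => rw [add_mul', hx, hy]
    | ht f h =>
      refine (tmul_mul_tmul f 1 h 1 (ℛ k h)).trans ?_
      have h1 : ∀ i ∈ (ℛ k h).index, (tmul (f * LeftModuleAlgebra.act (k := k) ((ℛ k h).left i) 1)
          ((ℛ k h).right i * 1) : SmashProduct k A H) =
          (f ⊗ₜ[k] (counit (R := k) ((ℛ k h).left i) • (ℛ k h).right i) : A ⊗[k] H) := by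
        intro i _
        rw [LeftModuleAlgebra.act_one, mul_one, ← TensorProduct.smul_tmul, Algebra.algebraMap_eq_smul_one,
          mul_smul_comm, mul_one]
        rfl
      rw [Finset.sum_congr rfl h1]
      refine (TensorProduct.tmul_sum _ _ _).symm.trans ?_
      rw [Coalgebra.sum_counit_smul]
      rfl

instance : Algebra k (SmashProduct k A H) :=
  Algebra.ofModule
    (fun r x y => LinearMap.congr_fun (map_smul (mulHom k A H) r x) y)
    (fun r x y => map_smul (mulHom k A H x) r y)

theorem add_tmul (f f' : A) (h : H) : (tmul (f + f') h : SmashProduct k A H) = tmul f h + tmul f' h :=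
  TensorProduct.add_tmul f f' h

theorem tmul_add (f : A) (h h' : H) : (tmul f (h + h') : SmashProduct k A H) = tmul f h + tmul f h' :=
  TensorProduct.tmul_add f h h'

theorem smul_tmul' (c : k) (f : A) (h : H) : (tmul (c • f) h : SmashProduct k A H) = c • tmul f h :=
  (TensorProduct.smul_tmul' c f h).symm

theorem tmul_smul (c : k) (f : A) (h : H) : (tmul f (c • h) : SmashProduct k A H) = c • tmul f h :=
  TensorProduct.tmul_smul c f h

/-- The coproduct of `1`. -/
def oneRepr : Coalgebra.Repr k (1 : H) Unit :=
  ⟨{()}, fun _ => 1, fun _ => 1, by simp [Algebra.TensorProduct.one_def]⟩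

theorem tmul_one_mul_tmul (f f' : A) (h : H) :
    (tmul f 1 * tmul f' h : SmashProduct k A H) = tmul (f * f') h := by
  rw [tmul_mul_tmul _ _ _ _ oneRepr]
  simp [oneRepr]

/-- The embedding `f ↦ f # 1`. -/
def inl : A →ₐ[k] SmashProduct k A H :=
  AlgHom.ofLinearMap
    { toFun := fun f => tmul f 1
      map_add' := fun f f' => add_tmul f f' 1
      map_smul' := fun c f => smul_tmul' c f 1 } rfl
    (fun f f' => (tmul_one_mul_tmul f f' 1).symm)

theorem inr_mul_aux (h h' : H) :
    (tmul 1 h * tmul 1 h' : SmashProduct k A H) = tmul 1 (h * h') := by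
  rw [tmul_mul_tmul _ _ _ _ (ℛ k h)]
  have h3 : ∀ i ∈ (ℛ k h).index, (tmul (1 * LeftModuleAlgebra.act (k := k) ((ℛ k h).left i) 1)
      ((ℛ k h).right i * h') : SmashProduct k A H) =
      (1 ⊗ₜ[k] ((counit (R := k) ((ℛ k h).left i) • (ℛ k h).right i) * h') : A ⊗[k] H) := by
    intro i _
    rw [LeftModuleAlgebra.act_one, one_mul, smul_mul_assoc, ← TensorProduct.smul_tmul,
      Algebra.algebraMap_eq_smul_one]
    rfl
  rw [Finset.sum_congr rfl h3]
  refine (TensorProduct.tmul_sum _ _ _).symm.trans ?_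
  rw [← Finset.sum_mul, Coalgebra.sum_counit_smul]
  rfl

/-- The embedding `h ↦ 1 # h`. -/
def inr : H →ₐ[k] SmashProduct k A H :=
  AlgHom.ofLinearMap
    { toFun := fun h => tmul 1 h
      map_add' := fun h h' => tmul_add 1 h h'
      map_smul' := fun c h => tmul_smul c 1 h } rfl
    (fun h h' => (inr_mul_aux h h').symm)

theorem inl_mul_inr (f : A) (h : H) : (inl f * inr h : SmashProduct k A H) = tmul f h :=
  (tmul_one_mul_tmul f 1 h).trans (by rw [mul_one])

theorem inr_mul_inl_of_trivial (f : A) (h : H)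
    (hf : ∀ h : H, LeftModuleAlgebra.act (k := k) h f = counit (R := k) h • f) :
    (inr h * inl f : SmashProduct k A H) = tmul f h := by
  refine (tmul_mul_tmul 1 f h 1 (ℛ k h)).trans ?_
  have h3 : ∀ i ∈ (ℛ k h).index, (tmul (1 * LeftModuleAlgebra.act (k := k) ((ℛ k h).left i) f)
      ((ℛ k h).right i * 1) : SmashProduct k A H) =
      (f ⊗ₜ[k] (counit (R := k) ((ℛ k h).left i) • (ℛ k h).right i) : A ⊗[k] H) := by
    intro i _
    rw [hf, one_mul, mul_one, ← TensorProduct.smul_tmul]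
    rfl
  rw [Finset.sum_congr rfl h3]
  refine (TensorProduct.tmul_sum _ _ _).symm.trans ?_
  rw [Coalgebra.sum_counit_smul]
  rfl

end SmashProduct
end Smash

section Coadjoint
variable (k : Type u) [Field k] (A B : Type u) [CommRing A] [HopfAlgebra k A]
  [CommRing B] [HopfAlgebra k B]

open WithConv Algebra.TensorProduct

variable {k A B}

/-- For points `g, x` of the group scheme `Spec A` with values in `C`, the point `g⁻¹ x g`. -/
def conjHom {C : Type u} [CommRing C] [Algebra k C] (g x : A →ₐ[k] C) : A →ₐ[k] C :=
  (toConv (g.comp (HopfAlgebra.antipodeAlgHom k A)) * toConv x * toConv g).ofConv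

/-- For a map `G = Spec B → 𝔾 = Spec A` of group schemes with comorphism `π`, the comorphism
`k[𝔾] → k[𝔾] ⊗ k[G]` of the conjugation map `𝔾 × G → 𝔾`, `(x, g) ↦ g⁻¹ x g`. -/
def conjCoaction (π : A →ₐ[k] B) : A →ₐ[k] A ⊗[k] B :=
  conjHom (includeRight.comp π) includeLeft

theorem conv_comp_mul {C D : Type u} [CommRing C] [Algebra k C] [CommRing D] [Algebra k D]
    (φ : C →ₐ[k] D) (f g : WithConv (A →ₐ[k] C)) :
    toConv (φ.comp (f * g).ofConv) = toConv (φ.comp f.ofConv) * toConv (φ.comp g.ofConv) := by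
  rw [AlgHom.comp_convMul_distrib]

theorem conv_comp_one {C D : Type u} [CommRing C] [Algebra k C] [CommRing D] [Algebra k D]
    (φ : C →ₐ[k] D) :
    toConv (φ.comp (1 : WithConv (A →ₐ[k] C)).ofConv) = 1 := by
  apply WithConv.ext
  ext x
  simp [AlgHom.convOne_def, Algebra.ofId_apply]

theorem conv_inv_mul {C : Type u} [CommRing C] [Algebra k C] (g : A →ₐ[k] C) :
    toConv (g.comp (HopfAlgebra.antipodeAlgHom k A)) * toConv g = 1 := by
  have := conv_comp_mul g (toConv (HopfAlgebra.antipodeAlgHom k A)) (toConv (AlgHom.id k A))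
  rw [AlgHom.antipode_id_cancel, conv_comp_one] at this
  exact this.symm

theorem conv_mul_inv {C : Type u} [CommRing C] [Algebra k C] (g : A →ₐ[k] C) :
    toConv g * toConv (g.comp (HopfAlgebra.antipodeAlgHom k A)) = 1 := by
  have h : toConv (AlgHom.id k A) * toConv (HopfAlgebra.antipodeAlgHom k A) = 1 := by
    apply WithConv.ofConv_injective
    apply AlgHom.toLinearMap_injective
    apply WithConv.toConv_injective
    rw [AlgHom.toLinearMap_convMul, AlgHom.toLinearMap_convOne]
    simp [LinearMap.id_mul_antipode]
  have := conv_comp_mul g (toConv (AlgHom.id k A)) (toConv (HopfAlgebra.antipodeAlgHom k A))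
  rw [h, conv_comp_one] at this
  exact this.symm

theorem comp_conjHom {C D : Type u} [CommRing C] [Algebra k C] [CommRing D] [Algebra k D]
    (φ : C →ₐ[k] D) (g x : A →ₐ[k] C) :
    φ.comp (conjHom g x) = conjHom (φ.comp g) (φ.comp x) := by
  apply WithConv.toConv_injective
  rw [conjHom, conv_comp_mul, conv_comp_mul]
  rfl

theorem conjHom_one {C : Type u} [CommRing C] [Algebra k C] (x : A →ₐ[k] C) :
    conjHom (1 : WithConv (A →ₐ[k] C)).ofConv x = x := by
  have h := conv_inv_mul (1 : WithConv (A →ₐ[k] C)).ofConv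
  rw [toConv_ofConv, mul_one] at h
  rw [conjHom, toConv_ofConv, mul_one, h, one_mul]

theorem conjHom_mul {C : Type u} [CommRing C] [Algebra k C] (g h : WithConv (A →ₐ[k] C))
    (x : A →ₐ[k] C) :
    conjHom (g * h).ofConv x = conjHom h.ofConv (conjHom g.ofConv x) := by
  have : toConv ((g * h).ofConv.comp (HopfAlgebra.antipodeAlgHom k A)) =
      toConv (h.ofConv.comp (HopfAlgebra.antipodeAlgHom k A)) *
        toConv (g.ofConv.comp (HopfAlgebra.antipodeAlgHom k A)) := by
    refine left_inv_eq_right_inv (a := g * h) (conv_inv_mul _) ?_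
    have h1 := conv_mul_inv h.ofConv
    have h2 := conv_mul_inv g.ofConv
    rw [toConv_ofConv] at h1 h2
    rw [mul_assoc, ← mul_assoc h, h1, one_mul, h2]
  rw [conjHom, conjHom, conjHom, this]
  simp only [toConv_ofConv, mul_assoc]

theorem conjCoaction_counit (π : A →ₐ[k] B)
    (hπ : ∀ x, counit (R := k) (π x) = counit (R := k) x) :
    (Algebra.TensorProduct.rid k k A).toAlgHom.comp
      ((Algebra.TensorProduct.map (AlgHom.id k A) (Bialgebra.counitAlgHom k B)).comp
        (conjCoaction π)) = AlgHom.id k A := by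
  rw [← AlgHom.comp_assoc, conjCoaction, comp_conjHom]
  set φ := (Algebra.TensorProduct.rid k k A).toAlgHom.comp
    (Algebra.TensorProduct.map (AlgHom.id k A) (Bialgebra.counitAlgHom k B)) with hφ
  have h1 : φ.comp (includeRight.comp π) = (1 : WithConv (A →ₐ[k] A)).ofConv := by
    ext x
    simp [hφ, AlgHom.convOne_def, Algebra.ofId_apply, hπ, Algebra.algebraMap_eq_smul_one]
  rw [h1, conjHom_one]
  ext x
  simp [hφ]

theorem conjCoaction_coassoc (π : A →ₐ[k] B)
    (hπ : (Algebra.TensorProduct.map π π).comp (Bialgebra.comulAlgHom k A) =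
      (Bialgebra.comulAlgHom k B).comp π) :
    (Algebra.TensorProduct.map (AlgHom.id k A) (Bialgebra.comulAlgHom k B)).comp
        (conjCoaction π) =
      (Algebra.TensorProduct.assoc k k k A B B).toAlgHom.comp
        ((Algebra.TensorProduct.map (conjCoaction π) (AlgHom.id k B)).comp
          (conjCoaction π)) := by
  rw [← AlgHom.comp_assoc]
  set φ := Algebra.TensorProduct.map (AlgHom.id k A) (Bialgebra.comulAlgHom k B)
  set ψ := (Algebra.TensorProduct.assoc k k k A B B).toAlgHom.comp
    (Algebra.TensorProduct.map (conjCoaction π) (AlgHom.id k B))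
  let g₁ : A →ₐ[k] A ⊗[k] (B ⊗[k] B) := includeRight.comp (includeLeft.comp π)
  let g₂ : A →ₐ[k] A ⊗[k] (B ⊗[k] B) := includeRight.comp (includeRight.comp π)
  have hφ1 : φ.comp (includeRight.comp π) = (toConv g₁ * toConv g₂).ofConv := by
    have h3 : (toConv (includeLeft.comp π) * toConv (includeRight.comp π) :
        WithConv (A →ₐ[k] B ⊗[k] B)).ofConv = (Bialgebra.comulAlgHom k B).comp π := by
      rw [← hπ, AlgHom.convMul_def]
      rw [ofConv_toConv, ← AlgHom.comp_assoc]
      congr 1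
      ext <;> simp
    have h4 := conv_comp_mul (includeRight : B ⊗[k] B →ₐ[k] A ⊗[k] (B ⊗[k] B))
      (toConv (includeLeft.comp π)) (toConv (includeRight.comp π))
    rw [h3] at h4
    refine Eq.trans ?_ (congrArg WithConv.ofConv h4)
    ext y
    simp [φ]
  have hφ2 : φ.comp includeLeft = includeLeft := by
    ext y
    simp [φ]
  have hψ1 : ψ.comp (includeRight.comp π) = g₂ := by
    ext y
    simp only [ψ, AlgHom.comp_apply, includeRight_apply, map_tmul, map_one, AlgHom.id_apply]
    rfl
  have hψ2 : ψ.comp includeLeft = conjHom g₁ includeLeft := by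
    have : ψ.comp includeLeft = ((Algebra.TensorProduct.assoc k k k A B B).toAlgHom.comp
        includeLeft).comp (conjCoaction π) := by
      ext y
      simp [ψ]
    rw [this, conjCoaction, comp_conjHom]
    rfl
  change φ.comp (conjHom _ _) = ψ.comp (conjHom _ _)
  rw [comp_conjHom, comp_conjHom, hφ1, hφ2, hψ1, hψ2]
  exact conjHom_mul (toConv g₁) (toConv g₂) includeLeft

/-- Contraction of the second tensor factor with an element of the group algebra. -/
def contract (z : A ⊗[k] B) : GroupAlg k B →ₗ[k] A where
  toFun h := TensorProduct.rid k A ((GroupAlg.toDual k B h).lTensor A z)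
  map_add' h h' := by simp
  map_smul' c h := by simp

theorem contract_tmul (a : A) (b : B) (h : GroupAlg k B) :
    contract (a ⊗ₜ[k] b) h = GroupAlg.toDual k B h b • a := by
  simp [contract]

theorem contract_add (z w : A ⊗[k] B) (h : GroupAlg k B) :
    contract (z + w) h = contract z h + contract w h := by
  simp [contract]

theorem contract_zero (h : GroupAlg k B) : contract (0 : A ⊗[k] B) h = 0 := by
  simp [contract]

theorem contract_smul (c : k) (z : A ⊗[k] B) (h : GroupAlg k B) :
    contract (c • z) h = c • contract z h := by
  simp [contract]

theorem contract_mul (z : A ⊗[k] B) (h h' : GroupAlg k B) (T : A ⊗[k] (B ⊗[k] B) →ₗ[k] A)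
    (hT : ∀ a b b', T (a ⊗ₜ (b ⊗ₜ b')) =
      (GroupAlg.toDual k B h b * GroupAlg.toDual k B h' b') • a) :
    contract z (h * h') =
      T (Algebra.TensorProduct.map (AlgHom.id k A) (Bialgebra.comulAlgHom k B) z) := by
  induction z using TensorProduct.induction_on with
  | zero => rw [contract_zero, map_zero, map_zero]
  | add x y hx hy => rw [contract_add, hx, hy, map_add, map_add]
  | tmul a b =>
    rw [contract_tmul, GroupAlg.toDual_mul h h' (ℛ k b), map_tmul, Bialgebra.comulAlgHom_apply,
      ← (ℛ k b).eq, TensorProduct.tmul_sum, map_sum, Finset.sum_smul]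
    simp [hT]

theorem contract_contract (ρ : A →ₐ[k] A ⊗[k] B) (z : A ⊗[k] B) (h h' : GroupAlg k B)
    (T : A ⊗[k] (B ⊗[k] B) →ₗ[k] A)
    (hT : ∀ a b b', T (a ⊗ₜ (b ⊗ₜ b')) =
      (GroupAlg.toDual k B h b * GroupAlg.toDual k B h' b') • a) :
    contract (ρ (contract z h')) h = T ((Algebra.TensorProduct.assoc k k k A B B)
      (Algebra.TensorProduct.map ρ (AlgHom.id k B) z)) := by
  have key : ∀ (w : A ⊗[k] B) (b : B), T ((Algebra.TensorProduct.assoc k k k A B B) (w ⊗ₜ b)) =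
      GroupAlg.toDual k B h' b • contract w h := by
    intro w b
    induction w using TensorProduct.induction_on with
    | zero => simp [contract_zero]
    | add x y hx hy => rw [contract_add, TensorProduct.add_tmul, map_add, map_add, hx, hy, smul_add]
    | tmul a b' =>
      rw [Algebra.TensorProduct.assoc_tmul, hT, contract_tmul, smul_smul, mul_comm]
  induction z using TensorProduct.induction_on with
  | zero => rw [contract_zero, map_zero, map_zero, contract_zero, map_zero, map_zero]
  | add x y hx hy =>
    rw [contract_add, map_add, contract_add, hx, hy, map_add, map_add, map_add]
  | tmul a b =>
    rw [contract_tmul, map_smul, contract_smul, map_tmul, AlgHom.id_apply, key]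

theorem mul_contract [Module.Finite k B] (z w : A ⊗[k] B) (h : GroupAlg k B) :
    contract (z * w) h =
      LinearMap.mul' k A (TensorProduct.map (contract z) (contract w) (comul (R := k) h)) := by
  induction z using TensorProduct.induction_on with
  | zero =>
    have : contract (0 : A ⊗[k] B) = 0 := LinearMap.ext contract_zero
    rw [zero_mul, this, TensorProduct.map_zero_left]; simp
  | add x y hx hy =>
    have : contract (x + y) = contract x + contract y := LinearMap.ext (contract_add x y)
    rw [add_mul, contract_add, hx, hy, this, TensorProduct.map_add_left]; simp
  | tmul a b =>
    induction w using TensorProduct.induction_on with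
    | zero =>
      have : contract (0 : A ⊗[k] B) = 0 := LinearMap.ext contract_zero
      rw [mul_zero, this, TensorProduct.map_zero_right]; simp
    | add x y hx hy =>
      have : contract (x + y) = contract x + contract y := LinearMap.ext (contract_add x y)
      rw [mul_add, contract_add, hx, hy, this, TensorProduct.map_add_right]; simp
    | tmul a' b' =>
      have key : ∀ y : GroupAlg k B ⊗[k] GroupAlg k B,
          LinearMap.mul' k A (TensorProduct.map (contract (a ⊗ₜ[k] b)) (contract (a' ⊗ₜ[k] b')) y) =
            GroupAlg.pairing k B y (b ⊗ₜ b') • (a * a') := by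
        intro y
        induction y using TensorProduct.induction_on with
        | zero => simp
        | add x y hx hy => rw [map_add, map_add, hx, hy, map_add, LinearMap.add_apply, add_smul]
        | tmul f g =>
          rw [TensorProduct.map_tmul, LinearMap.mul'_apply, contract_tmul, contract_tmul,
            GroupAlg.pairing_tmul, smul_mul_smul_comm]
      rw [key, GroupAlg.pairing_comul, tmul_mul_tmul, contract_tmul]
      rfl


/-- The coadjoint action of `kG` on `k[𝔾]`, as a linear map. -/
def coadjointLinear (π : A →ₐ[k] B) : GroupAlg k B →ₗ[k] Module.End k A where
  toFun h :=
    { toFun := fun f => contract (conjCoaction π f) h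
      map_add' := fun f f' => by rw [map_add, contract_add]
      map_smul' := fun c f => by rw [map_smul, contract_smul, RingHom.id_apply] }
  map_add' h h' := by ext f; exact map_add (contract (conjCoaction π f)) h h'
  map_smul' c h := by ext f; exact map_smul (contract (conjCoaction π f)) c h

theorem coadjointLinear_apply (π : A →ₐ[k] B) (h : GroupAlg k B) (f : A) :
    coadjointLinear π h f = contract (conjCoaction π f) h := rfl

/-- The (left) coadjoint action of `kG` on `k[𝔾]`, induced by `(g f)(x) = f(g⁻¹ x g)`. -/
def coadjointAct (π : A →ₐc[k] B) : GroupAlg k B →ₐ[k] Module.End k A :=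
  AlgHom.ofLinearMap (coadjointLinear (π : A →ₐ[k] B))
    (by
      ext f
      exact DFunLike.congr_fun (conjCoaction_counit (π : A →ₐ[k] B) (by simp)) f)
    (by
      intro h h'
      ext f
      let T : A ⊗[k] (B ⊗[k] B) →ₗ[k] A := (TensorProduct.rid k A).toLinearMap ∘ₗ
        (TensorProduct.lid k k).toLinearMap.lTensor A ∘ₗ
        (TensorProduct.map (GroupAlg.toDual k B h) (GroupAlg.toDual k B h')).lTensor A
      have hT : ∀ a b b', T (a ⊗ₜ (b ⊗ₜ b')) =
          (GroupAlg.toDual k B h b * GroupAlg.toDual k B h' b') • a := by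
        intro a b b'
        simp [T]
      have h1 := DFunLike.congr_fun (conjCoaction_coassoc (π : A →ₐ[k] B) (by ext; simp)) f
      refine (contract_mul _ h h' T hT).trans (Eq.trans (congrArg T h1)
        (contract_contract (conjCoaction (π : A →ₐ[k] B)) _ h h' T hT).symm))

theorem coadjointAct_apply (π : A →ₐc[k] B) (h : GroupAlg k B) (f : A) :
    coadjointAct π h f = contract (conjCoaction (π : A →ₐ[k] B) f) h := rfl

variable [Module.Finite k B]

/-- The coadjoint action makes `k[𝔾]` a module algebra over `kG`. -/
@[reducible]
def coadjointModuleAlgebra (π : A →ₐc[k] B) : LeftModuleAlgebra k A (GroupAlg k B) where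
  act := coadjointAct π
  act_one h := by
    rw [coadjointAct_apply, map_one, one_def, contract_tmul, Algebra.algebraMap_eq_smul_one,
      GroupAlg.counit_apply]
  act_mul h a b := by
    have hc : ∀ f, (coadjointAct π).toLinearMap.flip f = contract (conjCoaction (π : A →ₐ[k] B) f) :=
      fun f => rfl
    rw [hc, hc, coadjointAct_apply, map_mul, mul_contract]

end Coadjoint

section Doubles
variable (k : Type u) [Field k] (p r : ℕ) [Fact p.Prime] [CharP k p] (R : Type u) [CommRing R]
  [HopfAlgebra k R]

/-- The coordinate algebra `k[𝔾_(r+1)/𝔾_(r)] = k[(𝔾^(r))_(1)]`. -/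
abbrev QuotientCoord : Type u := FrobeniusKernel k p 1 (FrobeniusTwist k p r R)

/-- The algebra `O(𝔾_(r)) = k[𝔾_(r+1)/𝔾_(r)] ⊗ k𝔾_(r)`. -/
def SubDouble (k : Type u) [Field k] (p r : ℕ) [Fact p.Prime] [CharP k p] (R : Type u)
    [CommRing R] [HopfAlgebra k R] : Type u :=
  QuotientCoord k p r R ⊗[k] GroupAlg k (FrobeniusKernel k p r R)

instance : Ring (SubDouble k p r R) :=
  inferInstanceAs (Ring (QuotientCoord k p r R ⊗[k] GroupAlg k (FrobeniusKernel k p r R)))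

instance : Algebra k (SubDouble k p r R) :=
  inferInstanceAs (Algebra k (QuotientCoord k p r R ⊗[k] GroupAlg k (FrobeniusKernel k p r R)))

variable {k p r R}

theorem pow_tensor {A : Type u} [CommRing A] [Algebra k A]
    (z : A ⊗[k] FrobeniusKernel k p r R) :
    z ^ p ^ r = ((Algebra.TensorProduct.rid k k A).toAlgHom.comp (Algebra.TensorProduct.map
      (AlgHom.id k A) (Bialgebra.counitAlgHom k (FrobeniusKernel k p r R))) z ^ p ^ r) ⊗ₜ 1 := by
  have hp : p ^ r ≠ 0 := pow_ne_zero _ (Fact.out : p.Prime).ne_zero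
  induction z using TensorProduct.induction_on with
  | zero => rw [map_zero, zero_pow hp, zero_pow hp, TensorProduct.zero_tmul]
  | add x y hx hy =>
    rw [map_add, add_pow_char_pow_of_algebra k, add_pow_char_pow_of_algebra k, hx, hy,
      TensorProduct.add_tmul]
  | tmul a b =>
    rw [Algebra.TensorProduct.tmul_pow, FrobeniusKernel.pow_eq]
    simp [Algebra.algebraMap_eq_smul_one, smul_pow, TensorProduct.smul_tmul]

theorem conjCoaction_frobeniusQuotientHom (a : QuotientCoord k p r R) :
    conjCoaction ((FrobeniusKernel.restrict : FrobeniusKernel k p (r + 1) R →ₐc[k]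
      FrobeniusKernel k p r R) : FrobeniusKernel k p (r + 1) R →ₐ[k] FrobeniusKernel k p r R)
        (frobeniusQuotientHom a) = frobeniusQuotientHom a ⊗ₜ 1 := by
  obtain ⟨y, rfl⟩ := FrobeniusKernel.mk_surjective k p 1 _ a
  induction y using FrobeniusTwist.induction with
  | h0 => simp
  | ha x y hx hy =>
    rw [map_add, map_add, map_add, hx, hy, TensorProduct.add_tmul]
  | ht c f =>
    rw [frobeniusQuotientHom_mk_tmul, map_smul, map_pow, pow_tensor, ← TensorProduct.smul_tmul']
    congr 3
    exact DFunLike.congr_fun (conjCoaction_counit _ (by simp)) (FrobeniusKernel.mk k p (r + 1) R f)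

namespace SubDouble

/-- The embedding of the first tensor factor in `O(𝔾_(r))`. -/
def inl : QuotientCoord k p r R →ₐ[k] SubDouble k p r R :=
  (Algebra.TensorProduct.includeLeft : QuotientCoord k p r R →ₐ[k]
    QuotientCoord k p r R ⊗[k] GroupAlg k (FrobeniusKernel k p r R))

/-- The embedding of the second tensor factor in `O(𝔾_(r))`. -/
def inr : GroupAlg k (FrobeniusKernel k p r R) →ₐ[k] SubDouble k p r R :=
  (Algebra.TensorProduct.includeRight : GroupAlg k (FrobeniusKernel k p r R) →ₐ[k]
    QuotientCoord k p r R ⊗[k] GroupAlg k (FrobeniusKernel k p r R))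

theorem commute (a : QuotientCoord k p r R) (b : GroupAlg k (FrobeniusKernel k p r R)) :
    Commute (inl a : SubDouble k p r R) (inr b) := by
  have h : (a ⊗ₜ[k] 1 * 1 ⊗ₜ[k] b : QuotientCoord k p r R ⊗[k]
      GroupAlg k (FrobeniusKernel k p r R)) = 1 ⊗ₜ[k] b * a ⊗ₜ[k] 1 := by simp
  exact h

end SubDouble

variable [Algebra.FiniteType k R]

variable (k p r R) in
/-- The coadjoint action of `k𝔾_(r)` on `k[𝔾_(r+1)]`. -/
instance : LeftModuleAlgebra k (FrobeniusKernel k p (r + 1) R)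
    (GroupAlg k (FrobeniusKernel k p r R)) :=
  coadjointModuleAlgebra FrobeniusKernel.restrict

/-- The extended Drinfeld double `D̃(𝔾_(r)) = k[𝔾_(r+1)] # k𝔾_(r)`, the smash product for the
coadjoint action. -/
def ExtendedDouble (k : Type u) [Field k] (p r : ℕ) [Fact p.Prime] [CharP k p] (R : Type u)
    [CommRing R] [HopfAlgebra k R] [Algebra.FiniteType k R] : Type u :=
  SmashProduct k (FrobeniusKernel k p (r + 1) R) (GroupAlg k (FrobeniusKernel k p r R))

variable (k p r R) in
instance : Ring (ExtendedDouble k p r R) := inferInstanceAs (Ring (SmashProduct k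
  (FrobeniusKernel k p (r + 1) R) (GroupAlg k (FrobeniusKernel k p r R))))

variable (k p r R) in
instance : Algebra k (ExtendedDouble k p r R) := inferInstanceAs (Algebra k (SmashProduct k
  (FrobeniusKernel k p (r + 1) R) (GroupAlg k (FrobeniusKernel k p r R))))

theorem incl_commute (a : QuotientCoord k p r R) (h : GroupAlg k (FrobeniusKernel k p r R)) :
    Commute (SmashProduct.inl (frobeniusQuotientHom a) : SmashProduct k
      (FrobeniusKernel k p (r + 1) R) (GroupAlg k (FrobeniusKernel k p r R)))
      (SmashProduct.inr h) := by
  refine (SmashProduct.inl_mul_inr _ _).trans (SmashProduct.inr_mul_inl_of_trivial _ _ ?_).symm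
  intro h
  change coadjointAct FrobeniusKernel.restrict h (frobeniusQuotientHom a) = _
  rw [coadjointAct_apply, conjCoaction_frobeniusQuotientHom, contract_tmul,
    GroupAlg.counit_apply]

variable (k p r R) in
/-- The map of `SubDouble.incl`. -/
def inclSmash : QuotientCoord k p r R ⊗[k] GroupAlg k (FrobeniusKernel k p r R) →ₐ[k]
    SmashProduct k (FrobeniusKernel k p (r + 1) R) (GroupAlg k (FrobeniusKernel k p r R)) :=
  Algebra.TensorProduct.lift (SmashProduct.inl.comp frobeniusQuotientHom) SmashProduct.inr
    incl_commute

theorem inclSmash_tmul (a : QuotientCoord k p r R) (h : GroupAlg k (FrobeniusKernel k p r R)) :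
    inclSmash k p r R (a ⊗ₜ[k] h) = SmashProduct.tmul (frobeniusQuotientHom a) h :=
  (Algebra.TensorProduct.lift_tmul _ _ incl_commute a h).trans (SmashProduct.inl_mul_inr _ _)

variable (k p r R) in
/-- The embedding `i_O : O(𝔾_(r)) → D̃(𝔾_(r))`, `a ⊗ h ↦ a # h`, where `a` in `k[𝔾_(r+1)/𝔾_(r)]` is
regarded as a function on `𝔾_(r+1)`, see `inclSmash_tmul`. -/
def SubDouble.incl : SubDouble k p r R →ₐ[k] ExtendedDouble k p r R := inclSmash k p r R

end Doubles

section TruncatedPolynomials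
open Polynomial

/-- The truncated polynomial algebra `K[t]/t^p`. -/
abbrev TruncPoly (K : Type u) [Field K] (p : ℕ) : Type u := K[X] ⧸ Ideal.span {(X : K[X]) ^ p}

variable {K : Type u} [Field K] {p : ℕ}

namespace TruncPoly

/-- The class of `t` in `K[t]/t^p`. -/
def t (K : Type u) [Field K] (p : ℕ) : TruncPoly K p := Ideal.Quotient.mk _ X

theorem t_pow : t K p ^ p = 0 := by
  rw [t, ← map_pow]
  exact Ideal.Quotient.eq_zero_iff_mem.2 (Ideal.mem_span_singleton_self _)

/-- The algebra map `K[t]/t^p → E` which sends `t` to an element `e` with `e^p = 0`. -/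
def lift {E : Type u} [Ring E] [Algebra K E] (e : E) (he : e ^ p = 0) : TruncPoly K p →ₐ[K] E :=
  Ideal.Quotient.liftₐ _ (aeval e) (by
    intro a ha
    obtain ⟨b, rfl⟩ := Ideal.mem_span_singleton'.1 ha
    simp [he])

theorem lift_t {E : Type u} [Ring E] [Algebra K E] (e : E) (he : e ^ p = 0) :
    lift e he (t K p) = e :=
  aeval_X e

theorem map_t_pow {E : Type u} [Ring E] [Algebra K E] (φ : TruncPoly K p →ₐ[K] E) :
    φ (t K p) ^ p = 0 := by
  rw [← map_pow, t_pow, map_zero]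

end TruncPoly

/-- A ring map `φ : T → E` is flat if `E` is flat as a (left) `T`-module through `φ`. -/
def IsFlatHom {T E : Type u} [CommRing T] [Ring E] (φ : T →+* E) : Prop :=
  @Module.Flat T E _ _ (Module.compHom E φ)

/-- A representation `ρ` of `K[t]/t^p` on `V` is projective if `V` is a projective
`K[t]/t^p`-module through `ρ`. -/
def IsProjectiveVia {V : Type u} [AddCommGroup V] [Module K V]
    (ρ : TruncPoly K p →ₐ[K] Module.End K V) : Prop :=
  @Module.Projective (TruncPoly K p) _ V _ (Module.compHom V ρ.toRingHom)

namespace TruncPoly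

theorem exists_eq (a : TruncPoly K p) : ∃ (c : K) (b : TruncPoly K p),
    a = algebraMap K _ c + t K p * b := by
  obtain ⟨f, rfl⟩ := Ideal.Quotient.mk_surjective a
  refine ⟨f.coeff 0, Ideal.Quotient.mk _ f.divX, ?_⟩
  conv_lhs => rw [← divX_mul_X_add f]
  rw [map_add, map_mul, mul_comm, add_comm]
  rfl

theorem eq_of_t_mul_eq_zero (a : TruncPoly K p) (h : t K p * a = 0) :
    ∃ b, a = t K p ^ (p - 1) * b := by
  obtain ⟨f, rfl⟩ := Ideal.Quotient.mk_surjective a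
  rcases p with _ | p
  · exact ⟨Ideal.Quotient.mk _ f, by simp⟩
  · rw [t, ← map_mul, Ideal.Quotient.eq_zero_iff_mem] at h
    obtain ⟨g, hg⟩ := Ideal.mem_span_singleton'.1 h
    have : f = X ^ p * g := by
      apply mul_left_cancel₀ (X_ne_zero (R := K))
      rw [← hg]
      ring
    exact ⟨Ideal.Quotient.mk _ g, by rw [this, map_mul, map_pow]; rfl⟩

theorem nontrivial (hp : p ≠ 0) : Nontrivial (TruncPoly K p) := by
  refine Ideal.Quotient.nontrivial_iff.2 fun h => ?_
  rw [Ideal.span_singleton_eq_top] at h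
  exact not_isUnit_X ((isUnit_pow_iff hp).1 h)

theorem isUnit_of_ne_zero (c : K) (hc : c ≠ 0) (b : TruncPoly K p) :
    IsUnit (algebraMap K (TruncPoly K p) c + t K p * b) := by
  have h : IsNilpotent (t K p * b) := ⟨p, by rw [mul_pow, t_pow, zero_mul]⟩
  exact h.isUnit_add_left_of_commute ((IsUnit.mk0 c hc).map _) (Commute.all _ _)

theorem not_isUnit (hp : p ≠ 0) (b : TruncPoly K p) : ¬ IsUnit (t K p * b) := by
  have := nontrivial (K := K) hp
  have h : IsNilpotent (t K p * b) := ⟨p, by rw [mul_pow, t_pow, zero_mul]⟩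
  exact h.not_isUnit

theorem exists_of_not_isUnit (a : TruncPoly K p) (ha : ¬ IsUnit a) : ∃ b, a = t K p * b := by
  obtain ⟨c, b, rfl⟩ := exists_eq a
  by_cases hc : c = 0
  · exact ⟨b, by simp [hc]⟩
  · exact (ha (isUnit_of_ne_zero c hc b)).elim

theorem isLocalRing (hp : p ≠ 0) : IsLocalRing (TruncPoly K p) := by
  have := nontrivial (K := K) hp
  refine IsLocalRing.of_nonunits_add fun a b ha hb => ?_
  obtain ⟨a', rfl⟩ := exists_of_not_isUnit a ha
  obtain ⟨b', rfl⟩ := exists_of_not_isUnit b hb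
  rw [← mul_add]
  exact not_isUnit hp _

end TruncPoly

theorem isProjectiveVia_iff (hp : p ≠ 0) {V : Type u} [AddCommGroup V] [Module K V]
    [Module.Finite K V] (ρ : TruncPoly K p →ₐ[K] Module.End K V) :
    IsProjectiveVia ρ ↔
      Function.Exact (ρ (TruncPoly.t K p) ^ (p - 1)) (ρ (TruncPoly.t K p)) := by
  let : Module (TruncPoly K p) V := Module.compHom V ρ.toRingHom
  have hs : ∀ (a : TruncPoly K p) (v : V), a • v = ρ a v := fun _ _ => rfl
  have : IsScalarTower K (TruncPoly K p) V := ⟨fun c a v => by rw [hs, hs, map_smul]; rfl⟩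
  have : IsLocalRing (TruncPoly K p) := TruncPoly.isLocalRing hp
  have h0 : ∀ v : V, ρ (TruncPoly.t K p) ((ρ (TruncPoly.t K p) ^ (p - 1)) v) = 0 := by
    intro v
    rw [← Module.End.mul_apply, ← pow_succ', Nat.sub_add_cancel (Nat.one_le_iff_ne_zero.2 hp),
      TruncPoly.map_t_pow]
    rfl
  constructor
  · intro h v
    refine ⟨fun hv => ?_, fun ⟨w, hw⟩ => hw ▸ h0 w⟩
    obtain ⟨s, hs'⟩ := (Module.projective_def' (R := TruncPoly K p) (P := V)).1 h
    have h1 : TruncPoly.t K p • s v = 0 := by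
      rw [← map_smul, hs, hv, map_zero]
    have h2 := LinearMap.congr_fun hs' v
    rw [LinearMap.comp_apply, LinearMap.id_apply, Finsupp.linearCombination_apply] at h2
    have h3 : ∀ w : V, ∃ u : V, s v w • w = (ρ (TruncPoly.t K p) ^ (p - 1)) u := by
      intro w
      obtain ⟨b, hb⟩ := TruncPoly.eq_of_t_mul_eq_zero (s v w) (by
        simpa using DFunLike.congr_fun h1 w)
      exact ⟨b • w, by rw [hb, mul_smul, hs, map_pow]⟩
    choose u hu using h3
    refine ⟨∑ w ∈ (s v).support, u w, ?_⟩
    rw [map_sum]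
    exact (Finset.sum_congr rfl fun w _ => (hu w).symm).trans h2
  · intro h
    change Module.Projective (TruncPoly K p) V
    have : Module.Finite (TruncPoly K p) V := Module.Finite.of_restrictScalars_finite K _ _
    have : Module.FinitePresentation (TruncPoly K p) V := Module.finitePresentation_of_finite _ _
    have : Module.Free (TruncPoly K p) V := by
      apply Module.free_of_maximalIdeal_rTensor_injective
      rw [injective_iff_map_eq_zero]
      have hz : ∀ z : IsLocalRing.maximalIdeal (TruncPoly K p) ⊗[TruncPoly K p] V, ∃ v : V,
          z = (⟨TruncPoly.t K p, by
            rw [IsLocalRing.mem_maximalIdeal, mem_nonunits_iff]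
            simpa using TruncPoly.not_isUnit (K := K) hp 1⟩ :
              IsLocalRing.maximalIdeal (TruncPoly K p)) ⊗ₜ v := by
        intro z
        induction z using TensorProduct.induction_on with
        | zero => exact ⟨0, by simp⟩
        | add x y hx hy =>
          obtain ⟨v, rfl⟩ := hx
          obtain ⟨w, rfl⟩ := hy
          exact ⟨v + w, by rw [TensorProduct.tmul_add]⟩
        | tmul a v =>
          obtain ⟨b, hb⟩ := TruncPoly.exists_of_not_isUnit a.1 a.2
          refine ⟨b • v, ?_⟩
          rw [← TensorProduct.smul_tmul]
          congr 1
          ext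
          rw [hb, mul_comm]
          rfl
      intro z h1
      obtain ⟨v, rfl⟩ := hz z
      have h2 : ρ (TruncPoly.t K p) v = 0 := by
        have := congrArg (TensorProduct.lid (TruncPoly K p) V) h1
        simpa [hs] using this
      obtain ⟨w, rfl⟩ := (h v).1 h2
      rw [← map_pow, ← hs, ← TensorProduct.smul_tmul]
      refine (congrArg (· ⊗ₜ[TruncPoly K p] w) (Subtype.ext ?_)).trans
        (TensorProduct.zero_tmul _ w)
      change TruncPoly.t K p ^ (p - 1) * TruncPoly.t K p = 0
      rw [← pow_succ, Nat.sub_add_cancel (Nat.one_le_iff_ne_zero.2 hp), TruncPoly.t_pow]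
    infer_instance

end TruncatedPolynomials

section PiPoints

/-- The affine group scheme with coordinate algebra `S` is unipotent: it is isomorphic to a closed
subgroup scheme of the group scheme of upper unitriangular `n × n` matrices for some `n`. That is,
`S` is generated by the entries of an upper unitriangular matrix `X` with `Δ X_ij = ∑ X_il ⊗ X_lj`. -/
structure IsUnipotentHopf (K S : Type u) [Field K] [CommRing S] [HopfAlgebra K S] : Prop where
  exists_embedding : ∃ (n : ℕ) (X : Matrix (Fin n) (Fin n) S),
    (∀ i, X i i = 1) ∧ (∀ i j, j < i → X i j = 0) ∧
    (∀ i j, comul (R := K) (X i j) = ∑ l, X i l ⊗ₜ[K] X l j) ∧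
    Algebra.adjoin K {y : S | ∃ i j, y = X i j} = ⊤

variable {k : Type u} [Field k] {B : Type u} [CommRing B] [HopfAlgebra k B]

/-- The natural identification of `KG = K ⊗ kG` with the `K`-linear dual of `K[G] = K ⊗ k[G]`, see
`GroupAlg.baseChangeToDual_tmul`. -/
def GroupAlg.baseChangeToDual (K : Type u) [Field K] [Algebra k K] :
    K ⊗[k] GroupAlg k B →ₗ[K] Module.Dual K (K ⊗[k] B) :=
  TensorProduct.AlgebraTensorModule.lift
    { toFun := fun c =>
        { toFun := fun h => c • Module.Dual.baseChange K (GroupAlg.toDual k B h)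
          map_add' := fun h h' => by simp
          map_smul' := fun a h => by
            simp only [map_smul, RingHom.id_apply]
            exact smul_comm c a _ }
      map_add' := fun c c' => by ext; simp [add_smul]
      map_smul' := fun a c => by ext; simp }

theorem GroupAlg.baseChangeToDual_tmul (K : Type u) [Field K] [Algebra k K] (c d : K)
    (h : GroupAlg k B) (b : B) :
    GroupAlg.baseChangeToDual K (c ⊗ₜ[k] h) (d ⊗ₜ[k] b) =
      c * (d * algebraMap k K (GroupAlg.toDual k B h b)) := by
  simp [GroupAlg.baseChangeToDual, Algebra.smul_def, mul_comm]

/-- A `π`-point `β : K[t]/t^p → KG` of the finite group scheme `G` with coordinate algebra `B`: a flat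
map of `K`-algebras which factors through the group algebra `KC` of a unipotent abelian closed
subgroup scheme `C` of `G_K`. Here `C` is given by a surjection `π` of Hopf algebras from `K[G]` to a
cocommutative Hopf algebra `S = K[C]`, and `KC`, the dual of `S`, lies in `KG`, the dual of `K[G]`, by
composition with `π`. -/
structure IsPiPoint {p : ℕ} {K : Type u} [Field K] [Algebra k K]
    (β : TruncPoly K p →ₐ[K] K ⊗[k] GroupAlg k B) : Prop where
  flat : IsFlatHom β.toRingHom
  factors : ∃ (S : Type u) (_ : CommRing S) (_ : HopfAlgebra K S) (π : K ⊗[k] B →ₐc[K] S),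
    Function.Surjective π ∧ Coalgebra.IsCocomm K S ∧ IsUnipotentHopf K S ∧
    ∀ x, ∃ θ : Module.Dual K S, ∀ y, GroupAlg.baseChangeToDual K (β x) y = θ (π y)

end PiPoints

section PiPairs
variable (k : Type u) [Field k] (p r : ℕ) [Fact p.Prime] [CharP k p] (R : Type u) [CommRing R]
  [HopfAlgebra k R]

/-- A `π`-point pair `(α_K, β_K)` of `D̃(𝔾_(r))`, over some field extension `K` of `k`. -/
structure PiPair : Type (u + 1) where
  K : Type u
  [field : Field K]
  [algebra : Algebra k K]
  α : TruncPoly K p →ₐ[K] K ⊗[k] QuotientCoord k p r R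
  β : TruncPoly K p →ₐ[K] K ⊗[k] GroupAlg k (FrobeniusKernel k p r R)
  α_zero_or_flat : α (TruncPoly.t K p) = 0 ∨ IsFlatHom α.toRingHom
  β_zero_or_piPoint : β (TruncPoly.t K p) = 0 ∨ IsPiPoint β
  flat_or_flat : IsFlatHom α.toRingHom ∨ IsFlatHom β.toRingHom

attribute [instance] PiPair.field PiPair.algebra

variable {k p r R}

theorem add_pow_char_of_commute_algebra {E : Type u} [Ring E] [Algebra k E] (a b : E)
    (h : Commute a b) : (a + b) ^ p = a ^ p + b ^ p := by
  rcases subsingleton_or_nontrivial E with h' | h'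
  · exact Subsingleton.elim _ _
  · have : CharP E p := charP_of_injective_algebraMap (algebraMap k E).injective p
    exact add_pow_char_of_commute p h

/-- The base change `φ_Ω` of a map `φ : K[t]/t^p → K ⊗ E` along `f : K → Ω`. -/
def TruncPoly.extend {E K Ω : Type u} [Ring E] [Algebra k E] [Field K] [Algebra k K] [Field Ω]
    [Algebra k Ω] (f : K →ₐ[k] Ω) (φ : TruncPoly K p →ₐ[K] K ⊗[k] E) :
    TruncPoly Ω p →ₐ[Ω] Ω ⊗[k] E :=
  TruncPoly.lift (Algebra.TensorProduct.map f (AlgHom.id k E) (φ (TruncPoly.t K p))) (by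
    rw [← map_pow, TruncPoly.map_t_pow, map_zero])

/-- The map `α + β : K[t]/t^p → O(𝔾_(r))_K`, `t ↦ α(t) ⊗ 1 + 1 ⊗ β(t)`. -/
def piSum {K : Type u} [Field K] [Algebra k K]
    (α : TruncPoly K p →ₐ[K] K ⊗[k] QuotientCoord k p r R)
    (β : TruncPoly K p →ₐ[K] K ⊗[k] GroupAlg k (FrobeniusKernel k p r R)) :
    TruncPoly K p →ₐ[K] K ⊗[k] SubDouble k p r R :=
  TruncPoly.lift
    (Algebra.TensorProduct.map (AlgHom.id K K) SubDouble.inl (α (TruncPoly.t K p)) +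
      Algebra.TensorProduct.map (AlgHom.id K K) SubDouble.inr (β (TruncPoly.t K p))) (by
    rw [add_pow_char_of_commute_algebra (k := k), ← map_pow _ (α _), ← map_pow _ (β _),
      TruncPoly.map_t_pow, TruncPoly.map_t_pow, map_zero, map_zero, add_zero]
    have h1 : ∀ (a : QuotientCoord k p r R) (b : GroupAlg k (FrobeniusKernel k p r R)),
        Commute (SubDouble.inl a) (SubDouble.inr b) := SubDouble.commute
    generalize α (TruncPoly.t K p) = z
    generalize β (TruncPoly.t K p) = w
    induction z using TensorProduct.induction_on with
    | zero => rw [map_zero]; exact Commute.zero_left _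
    | add x y hx hy => rw [map_add]; exact hx.add_left hy
    | tmul c a =>
      induction w using TensorProduct.induction_on with
      | zero => rw [map_zero]; exact Commute.zero_right _
      | add x y hx hy => rw [map_add]; exact hx.add_right hy
      | tmul d b =>
        simp only [Algebra.TensorProduct.map_tmul, AlgHom.id_apply, Commute, SemiconjBy,
          Algebra.TensorProduct.tmul_mul_tmul, (h1 a b).eq, mul_comm c d])

end PiPairs

section Representations
variable {k : Type u} [Field k]

/-- The representation of `E_K = K ⊗ E` on `M_K = K ⊗ M` for an `E`-module `M`, see `baseRep_tmul`. -/
def baseRep {E : Type u} [Ring E] [Algebra k E] (K : Type u) [Field K] [Algebra k K] (M : Type u)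
    [AddCommGroup M] [Module k M] [Module E M] [IsScalarTower k E M] :
    K ⊗[k] E →ₐ[K] Module.End K (K ⊗[k] M) :=
  AlgHom.liftEquiv k K E (Module.End K (K ⊗[k] M))
   ((Module.End.baseChangeHom k K M).comp (Algebra.lsmul k k M))

theorem baseRep_tmul {E : Type u} [Ring E] [Algebra k E] (K : Type u) [Field K] [Algebra k K]
    (M : Type u) [AddCommGroup M] [Module k M] [Module E M] [IsScalarTower k E M] (c d : K) (e : E)
    (m : M) : baseRep K M (c ⊗ₜ[k] e) (d ⊗ₜ[k] m) = (c * d) ⊗ₜ (e • m) := by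
  rw [baseRep, AlgHom.liftEquiv_tmul, LinearMap.smul_apply]
  change c • (d ⊗ₜ[k] (e • m) : K ⊗[k] M) = _
  rw [TensorProduct.smul_tmul', smul_eq_mul]

/-- For `φ : K[t]/t^p → E_K` and an `E`-module `M`: the `K[t]/t^p`-module `φ^*(M_K)` is projective. -/
def IsProjectiveAlong {E : Type u} [Ring E] [Algebra k E] {K : Type u} [Field K] [Algebra k K]
    {p : ℕ} (φ : TruncPoly K p →ₐ[K] K ⊗[k] E) (M : Type u)
    [AddCommGroup M] [Module k M] [Module E M] [IsScalarTower k E M] : Prop :=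
  IsProjectiveVia ((baseRep K M).comp φ)

theorem isProjectiveAlong_extend {E : Type u} [Ring E] [Algebra k E] {K Ω : Type u} [Field K]
    [Algebra k K] [Field Ω] [Algebra k Ω] (f : K →ₐ[k] Ω) {p : ℕ} (hp : p ≠ 0)
    (φ : TruncPoly K p →ₐ[K] K ⊗[k] E) (M : Type u) [AddCommGroup M] [Module k M] [Module E M]
    [IsScalarTower k E M] [Module.Finite k M] :
    IsProjectiveAlong (TruncPoly.extend f φ) M ↔ IsProjectiveAlong φ M := by
  let : Algebra K Ω := f.toRingHom.toAlgebra
  have : IsScalarTower k K Ω := IsScalarTower.of_algebraMap_eq fun c => (f.commutes c).symm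
  rw [IsProjectiveAlong, IsProjectiveAlong, isProjectiveVia_iff hp, isProjectiveVia_iff hp]
  set σ := (baseRep Ω M).comp (TruncPoly.extend f φ) (TruncPoly.t Ω p) with hσ
  set τ := (baseRep K M).comp φ (TruncPoly.t K p) with hτ
  let e := TensorProduct.AlgebraTensorModule.cancelBaseChange k K Ω Ω M
  have h1 : ∀ z : Ω ⊗[K] (K ⊗[k] M), e (τ.lTensor Ω z) = σ (e z) := by
    have h2 : σ = baseRep Ω M (Algebra.TensorProduct.map f (AlgHom.id k E)
        (φ (TruncPoly.t K p))) := by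
      rw [hσ, AlgHom.comp_apply, TruncPoly.extend, TruncPoly.lift_t]
    rw [h2, hτ, AlgHom.comp_apply]
    generalize φ (TruncPoly.t K p) = y
    intro z
    induction z using TensorProduct.induction_on with
    | zero => simp
    | add a b ha hb => simp only [map_add, ha, hb]
    | tmul ω v =>
      induction v using TensorProduct.induction_on with
      | zero => simp
      | add a b ha hb => simp only [TensorProduct.tmul_add, map_add, ha, hb]
      | tmul c m =>
        induction y using TensorProduct.induction_on with
        | zero => simp
        | add a b ha hb =>
          simp only [LinearMap.lTensor_tmul, map_add, LinearMap.add_apply, TensorProduct.tmul_add] at ha hb ⊢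
          rw [ha, hb]
        | tmul d x =>
          simp only [LinearMap.lTensor_tmul, baseRep_tmul, Algebra.TensorProduct.map_tmul, e,
            TensorProduct.AlgebraTensorModule.cancelBaseChange_tmul, AlgHom.id_apply,
            Algebra.smul_def, map_mul]
          congr 1
          change f d * f c * ω = f d * (f c * ω)
          ring
  have h3 : ∀ (n : ℕ) (z : Ω ⊗[K] (K ⊗[k] M)), e ((τ ^ n).lTensor Ω z) = (σ ^ n) (e z) := by
    intro n
    induction n with
    | zero => intro z; simp [Module.End.one_eq_id]
    | succ n ih =>
      intro z
      rw [pow_succ', pow_succ', Module.End.mul_apply, Module.End.mul_eq_comp,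
        LinearMap.lTensor_comp, LinearMap.comp_apply, h1, ih]
  rw [← Module.FaithfullyFlat.lTensor_exact_iff_exact K Ω (τ ^ (p - 1)) τ]
  constructor
  · intro h z
    have h4 := h (e z)
    rw [← h1, EmbeddingLike.map_eq_zero_iff] at h4
    rw [h4]
    constructor
    · rintro ⟨w, hw⟩
      refine ⟨e.symm w, e.injective ?_⟩
      rw [h3, e.apply_symm_apply, hw]
    · rintro ⟨w, rfl⟩
      exact ⟨e w, (h3 _ _).symm⟩
  · intro h z
    have h4 := h (e.symm z)
    rw [← EmbeddingLike.map_eq_zero_iff (f := e), h1, e.apply_symm_apply] at h4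
    rw [h4]
    constructor
    · rintro ⟨w, hw⟩
      refine ⟨e w, ?_⟩
      rw [← h3, hw, e.apply_symm_apply]
    · rintro ⟨w, rfl⟩
      refine ⟨e.symm w, e.injective ?_⟩
      rw [h3, e.apply_symm_apply, e.apply_symm_apply]

theorem exists_common_extension {K L₁ L₂ : Type u} [Field K] [Algebra k K] [Field L₁]
    [Algebra k L₁] [Field L₂] [Algebra k L₂] (f₁ : K →ₐ[k] L₁) (f₂ : K →ₐ[k] L₂) :
    ∃ (Ω : Type u) (_ : Field Ω) (_ : Algebra k Ω) (g₁ : L₁ →ₐ[k] Ω) (g₂ : L₂ →ₐ[k] Ω),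
      g₁.comp f₁ = g₂.comp f₂ := by
  let : Algebra K L₁ := f₁.toRingHom.toAlgebra
  let : Algebra K L₂ := f₂.toRingHom.toAlgebra
  have : IsScalarTower k K L₁ := IsScalarTower.of_algebraMap_eq fun c => (f₁.commutes c).symm
  have : IsScalarTower k K L₂ := IsScalarTower.of_algebraMap_eq fun c => (f₂.commutes c).symm
  obtain ⟨I, hI⟩ := Ideal.exists_maximal (L₁ ⊗[K] L₂)
  let : Field (L₁ ⊗[K] L₂ ⧸ I) := Ideal.Quotient.field I
  refine ⟨L₁ ⊗[K] L₂ ⧸ I, inferInstance, inferInstance,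
    ((Ideal.Quotient.mkₐ K I).comp Algebra.TensorProduct.includeLeft).restrictScalars k,
    ((Ideal.Quotient.mkₐ K I).comp Algebra.TensorProduct.includeRight).restrictScalars k, ?_⟩
  ext c
  exact (AlgHom.commutes ((Ideal.Quotient.mkₐ K I).comp
    (Algebra.TensorProduct.includeLeft : L₁ →ₐ[K] L₁ ⊗[K] L₂)) c).trans
      (AlgHom.commutes ((Ideal.Quotient.mkₐ K I).comp
        (Algebra.TensorProduct.includeRight : L₂ →ₐ[K] L₁ ⊗[K] L₂)) c).symm

end Representations

section Equivalence
variable {k : Type u} [Field k] {p : ℕ}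

theorem TruncPoly.hom_ext {K : Type u} [Field K] {E : Type u} [Ring E] [Algebra K E]
    {φ ψ : TruncPoly K p →ₐ[K] E} (h : φ (TruncPoly.t K p) = ψ (TruncPoly.t K p)) : φ = ψ :=
  Ideal.Quotient.algHom_ext K (Polynomial.algHom_ext h)

/-- The composite of `φ : K[t]/t^p → D_K` with `j_K : D_K → E_K`. -/
def TruncPoly.along {D E : Type u} [Ring D] [Algebra k D] [Ring E] [Algebra k E] (j : D →ₐ[k] E)
    {K : Type u} [Field K] [Algebra k K] (φ : TruncPoly K p →ₐ[K] K ⊗[k] D) :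
    TruncPoly K p →ₐ[K] K ⊗[k] E :=
  (Algebra.TensorProduct.map (AlgHom.id K K) j).comp φ

theorem map_map_comm {D E : Type u} [Ring D] [Algebra k D] [Ring E] [Algebra k E]
    (j : D →ₐ[k] E) {K Ω : Type u} [Field K] [Algebra k K] [Field Ω] [Algebra k Ω]
    (f : K →ₐ[k] Ω) (z : K ⊗[k] D) :
    Algebra.TensorProduct.map f (AlgHom.id k E) (Algebra.TensorProduct.map (AlgHom.id K K) j z) =
      Algebra.TensorProduct.map (AlgHom.id Ω Ω) j
        (Algebra.TensorProduct.map f (AlgHom.id k D) z) := by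
  induction z using TensorProduct.induction_on with
  | zero => simp
  | add x y hx hy => simp only [map_add, hx, hy]
  | tmul a b => simp

theorem TruncPoly.extend_along {D E : Type u} [Ring D] [Algebra k D] [Ring E] [Algebra k E]
    (j : D →ₐ[k] E) {K Ω : Type u} [Field K] [Algebra k K] [Field Ω] [Algebra k Ω]
    (f : K →ₐ[k] Ω) (φ : TruncPoly K p →ₐ[K] K ⊗[k] D) :
    TruncPoly.extend f (TruncPoly.along j φ) = TruncPoly.along j (TruncPoly.extend f φ) := by
  apply TruncPoly.hom_ext
  simp only [TruncPoly.extend, TruncPoly.along, TruncPoly.lift_t, AlgHom.comp_apply, map_map_comm]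

theorem TruncPoly.extend_comp {E : Type u} [Ring E] [Algebra k E] {K Ω Ω' : Type u} [Field K]
    [Algebra k K] [Field Ω] [Algebra k Ω] [Field Ω'] [Algebra k Ω'] (f : K →ₐ[k] Ω)
    (g : Ω →ₐ[k] Ω') (φ : TruncPoly K p →ₐ[K] K ⊗[k] E) :
    TruncPoly.extend (g.comp f) φ = TruncPoly.extend g (TruncPoly.extend f φ) := by
  apply TruncPoly.hom_ext
  simp only [TruncPoly.extend, TruncPoly.lift_t]
  generalize φ (TruncPoly.t K p) = z
  induction z using TensorProduct.induction_on with
  | zero => simp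
  | add x y hx hy => simp only [map_add, hx, hy]
  | tmul a b => simp

/-- The restriction of an `E`-module `M` along `j : D → E`. -/
def Restrict {D E : Type u} [Ring D] [Algebra k D] [Ring E] [Algebra k E] (_j : D →ₐ[k] E)
    (M : Type u) : Type u := M

namespace Restrict
variable {D E : Type u} [Ring D] [Algebra k D] [Ring E] [Algebra k E] (j : D →ₐ[k] E)
  (M : Type u) [AddCommGroup M] [Module k M] [Module E M] [IsScalarTower k E M]

instance : AddCommGroup (Restrict j M) := inferInstanceAs (AddCommGroup M)
instance : Module k (Restrict j M) := inferInstanceAs (Module k M)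
instance : Module D (Restrict j M) := Module.compHom M j.toRingHom
instance : IsScalarTower k D (Restrict j M) := ⟨fun c d m =>
  (congrArg (fun e : E => e • (show M from m)) (map_smul j c d)).trans
    (smul_assoc c (j d) (show M from m))⟩
instance [Module.Finite k M] : Module.Finite k (Restrict j M) :=
  inferInstanceAs (Module.Finite k M)

end Restrict

theorem isProjectiveAlong_restrict {D E : Type u} [Ring D] [Algebra k D] [Ring E] [Algebra k E]
    (j : D →ₐ[k] E) {K : Type u} [Field K] [Algebra k K] (φ : TruncPoly K p →ₐ[K] K ⊗[k] D)
    (M : Type u) [AddCommGroup M] [Module k M] [Module E M] [IsScalarTower k E M] :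
    IsProjectiveAlong φ (Restrict j M) ↔ IsProjectiveAlong (TruncPoly.along j φ) M := by
  have h : (baseRep K (Restrict j M)).comp φ = (baseRep K M).comp (TruncPoly.along j φ) := by
    rw [TruncPoly.along, ← AlgHom.comp_assoc]
    congr 1
    ext d m
    have h1 := baseRep_tmul (k := k) (E := D) K (Restrict j M) 1 1 d m
    have h2 := fun m : M => baseRep_tmul (k := k) (E := E) K M 1 1 (j d) m
    exact h1.trans (h2 m).symm
  exact iff_of_eq (congrArg IsProjectiveVia h)

variable {r : ℕ} [Fact p.Prime] [CharP k p] {R : Type u} [CommRing R] [HopfAlgebra k R]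

namespace PiPair

/-- The map `α_K + β_K : K[t]/t^p → O(𝔾_(r))_K` of a `π`-point pair. -/
def sum (x : PiPair k p r R) : TruncPoly x.K p →ₐ[x.K] x.K ⊗[k] SubDouble k p r R :=
  piSum x.α x.β

/-- The map `α_Ω + β_Ω : Ω[t]/t^p → O(𝔾_(r))_Ω` of a `π`-point pair and an extension `f : K → Ω`. -/
def sumOver (x : PiPair k p r R) {Ω : Type u} [Field Ω] [Algebra k Ω] (f : x.K →ₐ[k] Ω) :
    TruncPoly Ω p →ₐ[Ω] Ω ⊗[k] SubDouble k p r R :=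
  piSum (TruncPoly.extend f x.α) (TruncPoly.extend f x.β)

theorem sumOver_eq (x : PiPair k p r R) {Ω : Type u} [Field Ω] [Algebra k Ω]
    (f : x.K →ₐ[k] Ω) : x.sumOver f = TruncPoly.extend f x.sum := by
  apply TruncPoly.hom_ext
  simp only [sumOver, sum, piSum, TruncPoly.extend, TruncPoly.lift_t, map_add, map_map_comm]

theorem sumOver_comp (x : PiPair k p r R) {Ω Ω' : Type u} [Field Ω] [Algebra k Ω] [Field Ω']
    [Algebra k Ω'] (f : x.K →ₐ[k] Ω) (g : Ω →ₐ[k] Ω') :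
    x.sumOver (g.comp f) = TruncPoly.extend g (x.sumOver f) := by
  rw [sumOver_eq, sumOver_eq, TruncPoly.extend_comp]

/-- Equivalence of `π`-point pairs over `K` and `L` with respect to the modules of an algebra `E` to
which `O(𝔾_(r))` maps by `j`: for some common field extension `Ω` of `K` and `L` over `k` and every
finite dimensional `E`-module `M`, the pull-back of `M_Ω` along one of the two maps
`Ω[t]/t^p → O(𝔾_(r))_Ω → E_Ω` is projective if and only if the other one is. -/
def IsEquiv {E : Type u} [Ring E] [Algebra k E] (j : SubDouble k p r R →ₐ[k] E)
    (x y : PiPair k p r R) : Prop :=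
  ∃ (Ω : Type u) (_ : Field Ω) (_ : Algebra k Ω) (f : x.K →ₐ[k] Ω) (g : y.K →ₐ[k] Ω),
    ∀ (M : Type u) [AddCommGroup M] [Module k M] [Module E M] [IsScalarTower k E M]
      [Module.Finite k M],
      IsProjectiveAlong (TruncPoly.along j (x.sumOver f)) M ↔
        IsProjectiveAlong (TruncPoly.along j (y.sumOver g)) M

theorem isProjectiveAlong_sumOver_comp {E : Type u} [Ring E] [Algebra k E]
    (j : SubDouble k p r R →ₐ[k] E) (x : PiPair k p r R) {Ω Ω' : Type u} [Field Ω] [Algebra k Ω]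
    [Field Ω'] [Algebra k Ω'] (f : x.K →ₐ[k] Ω) (g : Ω →ₐ[k] Ω') (M : Type u) [AddCommGroup M]
    [Module k M] [Module E M] [IsScalarTower k E M] [Module.Finite k M] :
    IsProjectiveAlong (TruncPoly.along j (x.sumOver (g.comp f))) M ↔
      IsProjectiveAlong (TruncPoly.along j (x.sumOver f)) M := by
  rw [sumOver_comp, ← TruncPoly.extend_along,
    isProjectiveAlong_extend g (Fact.out : p.Prime).ne_zero]

theorem isEquiv_equivalence {E : Type u} [Ring E] [Algebra k E] (j : SubDouble k p r R →ₐ[k] E) :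
    Equivalence (IsEquiv j) where
  refl x := ⟨x.K, inferInstance, inferInstance, AlgHom.id k x.K, AlgHom.id k x.K,
    fun _ _ _ _ _ _ => Iff.rfl⟩
  symm := by
    rintro x y ⟨Ω, i₁, i₂, f, g, h⟩
    exact ⟨Ω, i₁, i₂, g, f, fun M => (h M).symm⟩
  trans := by
    rintro x y z ⟨Ω₁, i₁, i₁', f₁, g₁, h₁⟩ ⟨Ω₂, i₂, i₂', f₂, g₂, h₂⟩
    obtain ⟨Ω, i, i', e₁, e₂, he⟩ := exists_common_extension g₁ f₂
    refine ⟨Ω, i, i', e₁.comp f₁, e₂.comp g₂, fun M _ _ _ _ _ => ?_⟩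
    rw [isProjectiveAlong_sumOver_comp, h₁ M, ← isProjectiveAlong_sumOver_comp j y g₁ e₁, he,
      isProjectiveAlong_sumOver_comp, h₂ M, isProjectiveAlong_sumOver_comp]

/-- `IsEquiv j` is an equivalence relation. -/
def setoid {E : Type u} [Ring E] [Algebra k E] (j : SubDouble k p r R →ₐ[k] E) :
    Setoid (PiPair k p r R) := ⟨IsEquiv j, isEquiv_equivalence j⟩

end PiPair

variable (k p r R) in
/-- The set `Π(O(𝔾_(r)))` of `O(𝔾_(r))`-equivalence classes of `π`-point pairs. -/
def PiO : Type (u + 1) := Quotient (PiPair.setoid (AlgHom.id k (SubDouble k p r R)))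

/-- The subset `Π(O(𝔾_(r)))_N` of the classes of the `π`-point pairs for which
`(α_K + β_K)^*(N_K)` is not projective. -/
def PiO.supp (N : Type u) [AddCommGroup N] [Module k N] [Module (SubDouble k p r R) N]
    [IsScalarTower k (SubDouble k p r R) N] : Set (PiO k p r R) :=
  {c | ∃ x : PiPair k p r R, Quotient.mk _ x = c ∧ ¬ IsProjectiveAlong x.sum N}

variable [Algebra.FiniteType k R]

variable (k p r R) in
/-- The set `Π(D̃(𝔾_(r)))` of equivalence classes of `π`-point pairs. -/
def PiD : Type (u + 1) := Quotient (PiPair.setoid (SubDouble.incl k p r R))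

/-- The subset `Π(D̃(𝔾_(r)))_M` of the classes of the `π`-point pairs for which
`(α_K + β_K)^*(M_K)` is not projective, `α_K + β_K` being composed with `i_O`. -/
def PiD.supp (M : Type u) [AddCommGroup M] [Module k M] [Module (ExtendedDouble k p r R) M]
    [IsScalarTower k (ExtendedDouble k p r R) M] : Set (PiD k p r R) :=
  {c | ∃ x : PiPair k p r R, Quotient.mk _ x = c ∧
    ¬ IsProjectiveAlong (TruncPoly.along (SubDouble.incl k p r R) x.sum) M}

theorem PiPair.isEquiv_incl_of_isEquiv_id {x y : PiPair k p r R}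
    (h : IsEquiv (AlgHom.id k (SubDouble k p r R)) x y) :
    IsEquiv (SubDouble.incl k p r R) x y := by
  obtain ⟨Ω, i, i', f, g, h⟩ := h
  have hid : ∀ φ : TruncPoly Ω p →ₐ[Ω] Ω ⊗[k] SubDouble k p r R,
      TruncPoly.along (AlgHom.id k (SubDouble k p r R)) φ = φ := by
    intro φ
    rw [TruncPoly.along, Algebra.TensorProduct.map_id, AlgHom.id_comp]
  refine ⟨Ω, i, i', f, g, fun M _ _ _ _ _ => ?_⟩
  have := h (Restrict (SubDouble.incl k p r R) M)
  rwa [hid, hid, isProjectiveAlong_restrict, isProjectiveAlong_restrict] at this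

variable (k p r R) in
/-- The natural map `Π(O(𝔾_(r))) → Π(D̃(𝔾_(r)))`, which sends the class of a `π`-point pair to its
class. -/
def piMap : PiO k p r R → PiD k p r R :=
  Quotient.map' (s₁ := PiPair.setoid _) (s₂ := PiPair.setoid _) id
    fun _ _ h => PiPair.isEquiv_incl_of_isEquiv_id h

end Equivalence

end

/-! Surjectivity of `piMap` is immediate, and the statement on supports holds representative by
representative, because restricting a module along `SubDouble.incl` does not change the operator by
which `t` acts. The content is injectivity: two pairs that no module over the extended double tells
apart must not be told apart by any module `N` over `SubDouble k p r R`.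

Write A_s = k[𝔾_(s)] and Z = k[𝔾_(r+1)/𝔾_(r)]. The test module is the induced module M = A_(r+1) ⊗_Z
N. The key claim, `SubDouble.isProjectiveAlong_induced_iff`, is that along α + β the module M is
projective exactly when N is. Given this, an equivalence for M is an equivalence for N over the same
field. A finite dimensional representation of K[t]/t^p is projective iff it is acyclic, that is, ker
t = im t^(p-1). So let V = K ⊗ N; two comparisons are needed.

From M to A_(r+1) ⊗ V. By smoothness A_s is the truncated polynomial algebra in local coordinates
x_i with x_i^(p^s) = 0 (`IsCoordinates.isTruncBasis`). Let z_i in Z correspond to x_i^(p^r). On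
A_(r+2) ⊗ V the operators g_i = x_i^(p^r) ⊗ 1 - 1 ⊗ z_i commute with each other and with t, since
p^r-th powers are invariant under conjugation by 𝔾_(r). Dividing by all g_i gives K ⊗ M. Since z_i^p
= 0, one has g_i^p = x_i^(p^(r+1)) ⊗ 1, and dividing by all g_i^p gives A_(r+1) ⊗ V. Modulo the
other g's, each g_i behaves like a truncated variable (`IsTruncBasis.diffEnd_regular`), and then
acyclicity modulo g_i and modulo g_i^p are equivalent (`IsAcyclicMod.iSup_range_iff`).

From A_(r+1) ⊗ V to V. Here α acts on V alone and β acts diagonally. Constants and evaluation at the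
identity make V a direct summand, because the identity is fixed by conjugation
(`acyclic_of_twistedEnd_acyclic`). Conversely, β(t) lies in the group algebra of a unipotent group
scheme, so its coproduct is 1 ⊗ β(t) plus terms whose left factors lie in a nilpotent augmentation
ideal (`IsPiPoint.isUnipotentElement`). In the filtration of A_(r+1) ⊗ V by powers of that ideal, t
acts on the graded pieces through V only, so acyclicity of V carries over
(`twistedEnd_acyclic_of_acyclic`). -/

/-! ### Acyclicity of an operator modulo a subspace -/

section Acyclic
variable {k : Type*} [CommRing k] {T : Type*} [AddCommGroup T] [Module k T]

/-- For an endomorphism `t` of `T` which preserves the submodule `L`: on `T / L`, the kernel of `t`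
is contained in the image of `t^(p-1)`. -/
def IsAcyclicMod (p : ℕ) (t : Module.End k T) (L : Submodule k T) : Prop :=
  ∀ z, t z ∈ L → ∃ w, z - (t ^ (p - 1)) w ∈ L

namespace IsAcyclicMod
variable {p : ℕ} {t : Module.End k T} {L : Submodule k T}

theorem pow_apply_mem (hL : ∀ z ∈ L, t z ∈ L) (j : ℕ) : ∀ z ∈ L, (t ^ j) z ∈ L := by
  induction j with
  | zero => intro z hz; simpa using hz
  | succ j ih => intro z hz; rw [pow_succ, Module.End.mul_apply]; exact ih _ (hL _ hz)

/-- If ker t = im t^(p-1), then ker t^j = im t^(p-j) for every j ≤ p. One factor t is peeled off at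
a time: acyclicity writes t^j z as t^j applied to a vector t^(p-j-1) w, and the difference is killed
by t^j. -/
theorem exists_of_pow_mem (h : IsAcyclicMod p t L) {j : ℕ} (hj : j ≤ p)
    (z : T) (hz : (t ^ j) z ∈ L) : ∃ w, z - (t ^ (p - j)) w ∈ L := by
  induction j generalizing z with
  | zero => exact ⟨0, by simpa using hz⟩
  | succ j ih =>
    rw [pow_succ', Module.End.mul_apply] at hz
    obtain ⟨w, hw⟩ := h _ hz
    have h1 : (t ^ (p - 1)) w = (t ^ j) ((t ^ (p - (j + 1))) w) := by
      rw [← Module.End.mul_apply, ← pow_add]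
      congr 2
      omega
    rw [h1, ← map_sub] at hw
    obtain ⟨w', hw'⟩ := ih (by omega) _ hw
    refine ⟨w + t w', ?_⟩
    have h2 : (t ^ (p - (j + 1))) (t w') = (t ^ (p - j)) w' := by
      rw [← Module.End.mul_apply, ← pow_succ]
      congr 2
      omega
    rwa [map_add, h2, ← sub_sub]

/-- Modulo L, the quotient by c^p is filtered by the powers of c with layers isomorphic to the
quotient by c, and an extension of acyclic representations is acyclic. `hc` ensures that no layer is
smaller than it should be. -/
theorem sup_range_pow {c : Module.End k T} (hp : 1 ≤ p) (htc : Commute t c)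
    (hLc : ∀ z ∈ L, c z ∈ L) (hLt : ∀ z ∈ L, t z ∈ L) (htp : t ^ p = 0)
    (hc : ∀ w, (c ^ p) w ∈ L → ∃ v, w - (c ^ p) v ∈ L)
    (h : IsAcyclicMod p t (L ⊔ LinearMap.range c)) :
    IsAcyclicMod p t (L ⊔ LinearMap.range (c ^ p)) := by
  have htc' : ∀ z, t (c z) = c (t z) := fun z => LinearMap.congr_fun htc z
  have htcp : ∀ (a : ℕ) z, (t ^ a) (c z) = c ((t ^ a) z) := fun a z =>
    LinearMap.congr_fun (htc.pow_left a).eq z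
  have htp' : ∀ z, t ((t ^ (p - 1)) z) = 0 := by
    intro z
    rw [← Module.End.mul_apply, ← pow_succ', Nat.sub_add_cancel hp, htp]
    rfl
  -- The annihilator of c modulo L is contained in that of c^p, hence by `hc` in the image of c^p.
  have hcc : ∀ w, c w ∈ L → ∃ v, w - (c ^ p) v ∈ L := by
    intro w hw
    apply hc
    rw [← Nat.sub_add_cancel hp, pow_succ, Module.End.mul_apply]
    exact pow_apply_mem hLc _ _ hw
  have key : ∀ a, 1 ≤ a → a ≤ p → IsAcyclicMod p t (L ⊔ LinearMap.range (c ^ a)) := by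
    intro a ha hap
    induction a, ha using Nat.le_induction with
    | base => rwa [pow_one]
    | succ a ha ih =>
      intro z hz
      have hle : L ⊔ LinearMap.range (c ^ (a + 1)) ≤ L ⊔ LinearMap.range c := by
        refine sup_le_sup_left ?_ _
        rintro _ ⟨w, rfl⟩
        exact ⟨(c ^ a) w, by rw [← Module.End.mul_apply, ← pow_succ']⟩
      obtain ⟨u, hu⟩ := h z (hle hz)
      obtain ⟨l, hl, _, ⟨z1, rfl⟩, h1⟩ := Submodule.mem_sup.1 hu
      obtain ⟨l1, hl1, _, ⟨w, rfl⟩, h2⟩ := Submodule.mem_sup.1 hz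
      have hz' : z = (t ^ (p - 1)) u + l + c z1 := by
        rw [add_assoc, h1]; abel
      have h3 : c (t z1 - (c ^ a) w) = l1 - t l := by
        have : t z = t l + c (t z1) := by
          rw [hz', map_add, map_add, htp', zero_add, htc']
        rw [this, pow_succ' c a, Module.End.mul_apply] at h2
        rw [map_sub, sub_eq_sub_iff_add_eq_add, h2]
        abel
      obtain ⟨v, hv⟩ := hcc _ (h3 ▸ L.sub_mem hl1 (hLt _ hl))
      -- Since a < p, the multiple of c^p left over by `hcc` is a multiple of c^a, so the induction
      -- hypothesis applies to the coefficient z1 in z = t^(p-1) u + l + c z1.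
      have h4 : t z1 ∈ L ⊔ LinearMap.range (c ^ a) := by
        have h5 : t z1 = (t z1 - (c ^ a) w - (c ^ p) v) + (c ^ a) (w + (c ^ (p - a)) v) := by
          rw [map_add, ← Module.End.mul_apply (c ^ a), ← pow_add, Nat.add_sub_of_le (by omega)]
          abel
        rw [h5]
        exact Submodule.add_mem_sup hv ⟨_, rfl⟩
      obtain ⟨u', hu'⟩ := ih (by omega) z1 h4
      obtain ⟨l', hl', _, ⟨w', rfl⟩, h6⟩ := Submodule.mem_sup.1 hu'
      refine ⟨u + c u', ?_⟩
      have h7 : z - (t ^ (p - 1)) (u + c u') = (l + c l') + (c ^ (a + 1)) w' := by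
        have h8 : z1 = (t ^ (p - 1)) u' + l' + (c ^ a) w' := by rw [add_assoc, h6]; abel
        rw [hz', h8]
        simp only [map_add, htcp, pow_succ' c a, Module.End.mul_apply]
        abel
      rw [h7]
      exact Submodule.add_mem_sup (L.add_mem hl (hLc _ hl')) ⟨_, rfl⟩
  exact key p hp le_rfl

/-- The obstruction to lifting a cycle from the quotient by c to the quotient by c^p can be removed.
If t z = l + c w, then t^(p-1) gives c t^(p-1) w ∈ L, so `hc` makes t^(p-1) w vanish modulo L and
c^p. Acyclicity then writes w as t v, and z - c v is a cycle modulo L and c^p. -/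
theorem of_sup_range_pow {c : Module.End k T} (hp : 1 ≤ p) (htc : Commute t c)
    (hLc : ∀ z ∈ L, c z ∈ L) (hLt : ∀ z ∈ L, t z ∈ L) (htp : t ^ p = 0)
    (hc : ∀ w, (c ^ p) w ∈ L → ∃ v, w - (c ^ p) v ∈ L)
    (h : IsAcyclicMod p t (L ⊔ LinearMap.range (c ^ p))) :
    IsAcyclicMod p t (L ⊔ LinearMap.range c) := by
  have htc' : ∀ z, t (c z) = c (t z) := fun z => LinearMap.congr_fun htc z
  have htcp : ∀ (a : ℕ) z, (t ^ a) (c z) = c ((t ^ a) z) := fun a z =>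
    LinearMap.congr_fun (htc.pow_left a).eq z
  have htcq : ∀ z, t ((c ^ p) z) = (c ^ p) (t z) := fun z =>
    LinearMap.congr_fun (htc.pow_right p).eq z
  intro z hz
  obtain ⟨l, hl, _, ⟨w, rfl⟩, h1⟩ := Submodule.mem_sup.1 hz
  have h2 : c ((t ^ (p - 1)) w) ∈ L := by
    have h3 : (t ^ (p - 1)) (t z) = 0 := by
      rw [← Module.End.mul_apply, ← pow_succ, Nat.sub_add_cancel hp, htp]
      rfl
    rw [← h1, map_add, htcp] at h3
    rw [eq_neg_of_add_eq_zero_right h3]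
    exact L.neg_mem (pow_apply_mem hLt _ _ hl)
  have h3 : (t ^ (p - 1)) w ∈ L ⊔ LinearMap.range (c ^ p) := by
    obtain ⟨v, hv⟩ := hc ((t ^ (p - 1)) w) (by
      rw [← Nat.sub_add_cancel hp, pow_succ, Module.End.mul_apply]
      exact pow_apply_mem hLc _ _ h2)
    rw [← sub_add_cancel ((t ^ (p - 1)) w) ((c ^ p) v)]
    exact Submodule.add_mem_sup hv ⟨_, rfl⟩
  obtain ⟨v, hv⟩ := h.exists_of_pow_mem (Nat.sub_le _ _) w h3
  rw [Nat.sub_sub_self hp, pow_one] at hv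
  obtain ⟨l', hl', _, ⟨v', rfl⟩, h4⟩ := Submodule.mem_sup.1 hv
  have h5 : t (z - c v) = (l + c l') + (c ^ p) (c v') := by
    have h6 : w = t v + l' + (c ^ p) v' := by rw [add_assoc, h4]; abel
    rw [map_sub, ← h1, h6, htc', map_add, map_add, ← Module.End.mul_apply c (c ^ p), ← pow_succ',
      pow_succ, Module.End.mul_apply]
    abel
  obtain ⟨y, hy⟩ := h (z - c v) (h5 ▸ Submodule.add_mem_sup (L.add_mem hl (hLc _ hl')) ⟨_, rfl⟩)
  refine ⟨y, ?_⟩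
  have h6 : L ⊔ LinearMap.range (c ^ p) ≤ L ⊔ LinearMap.range c := by
    refine sup_le_sup_left ?_ _
    rintro _ ⟨w, rfl⟩
    exact ⟨(c ^ (p - 1)) w, by rw [← Module.End.mul_apply, ← pow_succ', Nat.sub_add_cancel hp]⟩
  have h7 : z - (t ^ (p - 1)) y = (z - c v - (t ^ (p - 1)) y) + c v := by abel
  rw [h7]
  exact Submodule.add_mem _ (h6 hy) (Submodule.mem_sup_right ⟨_, rfl⟩)

theorem iSup_mem_of_forall {ι : Type*} {g : ι → Module.End k T} {c : Module.End k T}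
    (h : ∀ i, Commute c (g i)) : ∀ z ∈ ⨆ i, LinearMap.range (g i), c z ∈ ⨆ i, LinearMap.range (g i) := by
  intro z hz
  induction hz using Submodule.iSup_induction' with
  | mem i z hz =>
    obtain ⟨w, rfl⟩ := hz
    refine Submodule.mem_iSup_of_mem i ⟨c w, ?_⟩
    exact (LinearMap.congr_fun (h i).eq w).symm
  | zero => simp
  | add x y _ _ hx hy => rw [map_add]; exact Submodule.add_mem _ hx hy

/-- For commuting `g₁, …, gₙ` such that each `gⱼ` behaves like a variable of a truncated polynomial
algebra modulo the other ones, acyclicity modulo the `gᵢ` and modulo the `gᵢ^p` are equivalent. -/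
theorem iSup_range_iff {n : ℕ} (g : Fin n → Module.End k T) (hp : 1 ≤ p)
    (hg : ∀ i j, Commute (g i) (g j)) (htg : ∀ i, Commute t (g i)) (htp : t ^ p = 0)
    (hc : ∀ (j : Fin n) (w : T),
      (g j ^ p) w ∈ ⨆ i : {i // i ≠ j}, LinearMap.range (g i ^ (if i.1 < j then 1 else p)) →
      ∃ v, w - (g j ^ p) v ∈ ⨆ i : {i // i ≠ j}, LinearMap.range (g i ^ (if i.1 < j then 1 else p))) :
    IsAcyclicMod p t (⨆ i, LinearMap.range (g i)) ↔
      IsAcyclicMod p t (⨆ i, LinearMap.range (g i ^ p)) := by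
  -- The operators are treated one at a time: those of index below m enter with exponent 1, the
  -- others with exponent p. Going from m to m + 1 changes only the m-th, and the remaining ranges
  -- form the submodule L occurring in `hc`.
  have key : ∀ m, m ≤ n → (IsAcyclicMod p t (⨆ i : Fin n,
      LinearMap.range (g i ^ (if i.1 < m then 1 else p))) ↔
        IsAcyclicMod p t (⨆ i, LinearMap.range (g i ^ p))) := by
    intro m hm
    induction m with
    | zero => simp
    | succ m ih =>
      rw [← ih (by omega)]
      let j : Fin n := ⟨m, hm⟩
      let L := ⨆ i : {i // i ≠ j}, LinearMap.range (g i ^ (if i.1 < j then 1 else p))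
      have hsplit : ∀ f : Fin n → Submodule k T, ⨆ i, f i = (⨆ i : {i // i ≠ j}, f i) ⊔ f j := by
        intro f
        rw [iSup_split_single f j, sup_comm, iSup_subtype]
      have h1 : (⨆ i : Fin n, LinearMap.range (g i ^ (if i.1 < m + 1 then 1 else p))) =
          L ⊔ LinearMap.range (g j) := by
        rw [hsplit]
        congr 1
        · refine iSup_congr fun i => ?_
          have : (i.1.1 < m + 1) ↔ i.1 < j := by
            have := i.2
            rw [Ne, Fin.ext_iff] at this
            rw [Fin.lt_def]
            change _ ↔ i.1.1 < m
            change ¬ i.1.1 = m at this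
            omega
          simp only [this]
        · simp [j]
      have h2 : (⨆ i : Fin n, LinearMap.range (g i ^ (if i.1 < m then 1 else p))) =
          L ⊔ LinearMap.range (g j ^ p) := by
        rw [hsplit]
        congr 1
        simp [j]
      rw [h1, h2]
      have hLt : ∀ z ∈ L, t z ∈ L := iSup_mem_of_forall fun i => (htg i).pow_right _
      have hLc : ∀ z ∈ L, g j z ∈ L := iSup_mem_of_forall fun i => (hg j i).pow_right _
      exact ⟨sup_range_pow hp (htg j) hLc hLt htp (hc j),
        of_sup_range_pow hp (htg j) hLc hLt htp (hc j)⟩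
  have := key n le_rfl
  simpa using this

/-- Quotients of T have so far been recorded as submodules, so that several of them can be compared
inside one space. This returns to the quotient spaces themselves. -/
theorem ker_iff {T' : Type*} [AddCommGroup T'] [Module k T'] (φ : T →ₗ[k] T')
    (hφ : Function.Surjective φ) (t' : Module.End k T')
    (h : ∀ z, φ (t z) = t' (φ z)) :
    IsAcyclicMod p t (LinearMap.ker φ) ↔ ∀ z, t' z = 0 → ∃ w, (t' ^ (p - 1)) w = z := by
  have hpow : ∀ (a : ℕ) z, φ ((t ^ a) z) = (t' ^ a) (φ z) := by
    intro a
    induction a with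
    | zero => simp
    | succ a ih => intro z; rw [pow_succ', pow_succ', Module.End.mul_apply, Module.End.mul_apply, h, ih]
  constructor
  · intro H z hz
    obtain ⟨z, rfl⟩ := hφ z
    obtain ⟨w, hw⟩ := H z (by rw [LinearMap.mem_ker, h, hz])
    refine ⟨φ w, ?_⟩
    rw [LinearMap.mem_ker, map_sub, hpow, sub_eq_zero] at hw
    exact hw.symm
  · intro H z hz
    rw [LinearMap.mem_ker, h] at hz
    obtain ⟨w, hw⟩ := H _ hz
    obtain ⟨w, rfl⟩ := hφ w
    exact ⟨w, by rw [LinearMap.mem_ker, map_sub, hpow, hw, sub_self]⟩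

end IsAcyclicMod

/-- Acyclicity can be checked on the associated graded of a finite filtration `F`. -/
theorem acyclic_of_filtration {p m : ℕ} (hp : 1 ≤ p) (τ D A B : Module.End k T) (hτ : τ ^ p = 0)
    (F : ℕ → Submodule k T) (h0 : F 0 = ⊤) (hm : F m = ⊥)
    (hid : ∀ z, z = (D ^ (p - 1)) (A z) + B (D z))
    (hD : ∀ j, ∀ z ∈ F j, D z ∈ F j) (hA : ∀ j, ∀ z ∈ F j, A z ∈ F j)
    (hB : ∀ j, ∀ z ∈ F j, B z ∈ F j) (hF : ∀ j, ∀ z ∈ F j, τ z - D z ∈ F (j + 1))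
    (hanti : ∀ j, F (j + 1) ≤ F j) (z : T) (hz : τ z = 0) : ∃ w, (τ ^ (p - 1)) w = z := by
  -- τ and D agree on each layer F j / F (j + 1), hence so do their powers.
  have hpow : ∀ (a : ℕ) j, ∀ z ∈ F j, (τ ^ a) z - (D ^ a) z ∈ F (j + 1) := by
    intro a j
    induction a with
    | zero => intro z _; simp
    | succ a ih =>
      intro z hz
      have h1 : τ z ∈ F j := by
        rw [← sub_add_cancel (τ z) (D z)]
        exact Submodule.add_mem _ (hanti _ (hF j z hz)) (hD j z hz)
      have h2 : (τ ^ (a + 1)) z - (D ^ (a + 1)) z =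
          ((τ ^ a) (τ z) - (D ^ a) (τ z)) + (D ^ a) (τ z - D z) := by
        rw [pow_succ, pow_succ, Module.End.mul_apply, Module.End.mul_apply, map_sub]
        abel
      rw [h2]
      exact Submodule.add_mem _ (ih _ h1) (IsAcyclicMod.pow_apply_mem (hD _) _ _ (hF j z hz))
  -- Successive approximation. The error y in F j is killed by τ, so D y already lies in F (j + 1);
  -- by `hid`, y agrees with D^(p-1) (A y), and so with τ^(p-1) (A y), up to F (j + 1). Acyclicity
  -- of D is used through the operators A and B because these respect the filtration.
  have key : ∀ j, ∃ w, z - (τ ^ (p - 1)) w ∈ F j := by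
    intro j
    induction j with
    | zero => exact ⟨0, by rw [h0]; trivial⟩
    | succ j ih =>
      obtain ⟨w, hw⟩ := ih
      set y := z - (τ ^ (p - 1)) w with hy
      have hty : τ y = 0 := by
        rw [hy, map_sub, hz, ← Module.End.mul_apply, ← pow_succ', Nat.sub_add_cancel hp, hτ]
        simp
      have hDy : D y ∈ F (j + 1) := by
        have := hF j y hw
        rw [hty, zero_sub] at this
        simpa using Submodule.neg_mem _ this
      refine ⟨w + A y, ?_⟩
      have h1 : z - (τ ^ (p - 1)) (w + A y) =
          B (D y) - ((τ ^ (p - 1)) (A y) - (D ^ (p - 1)) (A y)) := by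
        have h2 : z = (τ ^ (p - 1)) w + ((D ^ (p - 1)) (A y) + B (D y)) := by
          rw [← hid y, hy]; abel
        conv_lhs => rw [h2]
        rw [map_add]
        abel
      rw [h1]
      exact Submodule.sub_mem _ (hB _ _ hDy) (hpow _ j _ (hA _ _ hw))
  obtain ⟨w, hw⟩ := key m
  rw [hm, Submodule.mem_bot, sub_eq_zero] at hw
  exact ⟨w, hw.symm⟩

end Acyclic

/-- If the kernel of `u` is the image of `u^(p-1)`, then `1 = u^(p-1) A + B u` for some `A`, `B`. -/
theorem exists_contraction {K : Type*} [Field K] {V : Type*} [AddCommGroup V] [Module K V] {p : ℕ}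
    (u : Module.End K V) (h : ∀ z, u z = 0 → ∃ w, (u ^ (p - 1)) w = z) :
    ∃ A B : Module.End K V, ∀ z, z = (u ^ (p - 1)) (A z) + B (u z) := by
  obtain ⟨B₀, hB₀⟩ := u.rangeRestrict.exists_rightInverse_of_surjective u.range_rangeRestrict
  obtain ⟨C, hC⟩ := Submodule.exists_isCompl (LinearMap.range u)
  let B : Module.End K V := B₀ ∘ₗ Submodule.projectionOnto _ _ hC
  -- B inverts u on its range and vanishes on a complement, so u B u = u. Hence 1 - B u maps into
  -- ker u, which is the image of u^(p-1) and can be factored through it by A.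
  have hB : ∀ z, u (B (u z)) = u z := by
    intro z
    have h1 : Submodule.projectionOnto _ _ hC (u z) = ⟨u z, ⟨z, rfl⟩⟩ :=
      Submodule.projectionOnto_apply_left hC ⟨u z, ⟨z, rfl⟩⟩
    have h2 := congrArg Subtype.val (LinearMap.congr_fun hB₀ ⟨u z, ⟨z, rfl⟩⟩)
    change u (B₀ (Submodule.projectionOnto _ _ hC (u z))) = _
    rw [h1]
    exact h2
  let v := u ^ (p - 1)
  obtain ⟨A₀, hA₀⟩ := v.rangeRestrict.exists_rightInverse_of_surjective v.range_rangeRestrict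
  have hmem : ∀ z, z - B (u z) ∈ LinearMap.range v := by
    intro z
    exact h _ (by rw [map_sub, hB, sub_self])
  let A : Module.End K V := A₀ ∘ₗ LinearMap.codRestrict _ (LinearMap.id - B ∘ₗ u) hmem
  refine ⟨A, B, fun z => ?_⟩
  have h2 := congrArg Subtype.val (LinearMap.congr_fun hA₀ ⟨z - B (u z), hmem z⟩)
  have h3 : v (A z) = z - B (u z) := h2
  change z = v (A z) + _
  rw [h3]; abel

theorem Finsupp.supported_le {k ι N : Type*} [CommRing k] [AddCommGroup N] [Module k N] {s : Set ι}
    {G : Submodule k (ι →₀ N)} (h : ∀ a ∈ s, ∀ m, Finsupp.single a m ∈ G) :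
    Finsupp.supported N k s ≤ G := by
  intro z hz
  rw [← Finsupp.sum_single z]
  exact Submodule.sum_mem _ fun a ha => h a ((Finsupp.mem_supported k z).1 hz ha) _

/-- By right exactness of the tensor product, the kernel is generated by the tensors s ⊗ m with s in
ker f. -/
theorem LinearMap.ker_rTensor_le {k F A N : Type*} [CommRing k] [AddCommGroup F] [Module k F]
    [AddCommGroup A] [Module k A] [AddCommGroup N] [Module k N] (f : F →ₗ[k] A)
    (hf : Function.Surjective f) (G : Submodule k (F ⊗[k] N))
    (hG : ∀ s ∈ LinearMap.ker f, ∀ m, s ⊗ₜ m ∈ G) : LinearMap.ker (f.rTensor N) ≤ G := by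
  have hex : Function.Exact ((LinearMap.ker f).subtype.rTensor N) (f.rTensor N) :=
    rTensor_exact N f.exact_subtype_ker_map hf
  intro z hz
  obtain ⟨y, rfl⟩ := (hex _).1 hz
  clear hz
  induction y using TensorProduct.induction_on with
  | zero => simp
  | add y y' h h' => rw [map_add]; exact Submodule.add_mem _ h h'
  | tmul y m => exact hG y.1 y.2 m

theorem Finsupp.mem_supported_of_rTensor_eq_zero {k ι A N : Type*} [CommRing k] [AddCommGroup A]
    [Module k A] [AddCommGroup N] [Module k N] [DecidableEq ι] (f : (ι →₀ k) →ₗ[k] A)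
    (hf : Function.Surjective f) (s : Set ι) (hs : LinearMap.ker f = Finsupp.supported k k s)
    (z : (ι →₀ k) ⊗[k] N) (hz : f.rTensor N z = 0) :
    TensorProduct.finsuppScalarLeft k N ι z ∈ Finsupp.supported N k s := by
  refine LinearMap.ker_rTensor_le f hf
    ((Finsupp.supported N k s).comap (TensorProduct.finsuppScalarLeft k N ι).toLinearMap) ?_ hz
  intro y hy m
  rw [hs, Finsupp.mem_supported'] at hy
  rw [Submodule.mem_comap, Finsupp.mem_supported']
  intro a ha
  rw [LinearEquiv.coe_coe, TensorProduct.finsuppScalarLeft_apply_tmul_apply, hy a ha, zero_smul]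

/-! ### Truncated polynomial algebras and the operators xᵢ^d ⊗ 1 - 1 ⊗ zᵢ -/

section TruncatedBasis
variable {k : Type u} [Field k] {A : Type u} [CommRing A] [Algebra k A] {n : ℕ}

/-- `A` is the truncated polynomial algebra `k[x₁, …, xₙ] / (x₁^D, …, xₙ^D)`. -/
structure IsTruncBasis (k : Type u) [Field k] {A : Type u} [CommRing A] [Algebra k A] {n : ℕ}
    (x : Fin n → A) (D : ℕ) : Prop where
  surjective : Function.Surjective
    (Finsupp.linearCombination k fun a : Fin n → ℕ => ∏ i, x i ^ a i)
  ker_eq : LinearMap.ker (Finsupp.linearCombination k fun a : Fin n → ℕ => ∏ i, x i ^ a i) =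
    Finsupp.supported k k {a | ∃ i, D ≤ a i}

variable (k) in
/-- The map `∑ a, Xᵃ nₐ ↦ ∑ a, xᵃ ⊗ nₐ`. -/
noncomputable def monomialMap (x : Fin n → A) (N : Type u) [AddCommGroup N] [Module k N] :
    ((Fin n → ℕ) →₀ N) →ₗ[k] A ⊗[k] N :=
  Finsupp.lsum ℕ fun a => TensorProduct.mk k A N (∏ i, x i ^ a i)

variable {N : Type u} [AddCommGroup N] [Module k N] {x : Fin n → A} {D : ℕ}

theorem monomialMap_single (a : Fin n → ℕ) (m : N) :
    monomialMap k x N (Finsupp.single a m) = (∏ i, x i ^ a i) ⊗ₜ m := by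
  simp [monomialMap]

theorem monomialMap_eq (N : Type u) [AddCommGroup N] [Module k N] :
    monomialMap k x N = (Finsupp.linearCombination k fun a : Fin n → ℕ => ∏ i, x i ^ a i).rTensor N ∘ₗ
      (TensorProduct.finsuppScalarLeft k N (Fin n → ℕ)).symm.toLinearMap := by
  refine Finsupp.lhom_ext fun a m => ?_
  rw [monomialMap_single]
  simp

theorem IsTruncBasis.monomialMap_surjective (hx : IsTruncBasis k x D) :
    Function.Surjective (monomialMap k x N) := by
  rw [monomialMap_eq, LinearMap.coe_comp]
  exact (LinearMap.rTensor_surjective N hx.surjective).comp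
    (TensorProduct.finsuppScalarLeft k N (Fin n → ℕ)).symm.surjective

theorem IsTruncBasis.pow_eq_zero (hx : IsTruncBasis k x D) (i : Fin n) : x i ^ D = 0 := by
  have h : Finsupp.single (Pi.single i D : Fin n → ℕ) (1 : k) ∈
      Finsupp.supported k k {a : Fin n → ℕ | ∃ i, D ≤ a i} := by
    refine Finsupp.single_mem_supported _ _ ⟨i, ?_⟩
    simp
  rw [← hx.ker_eq, LinearMap.mem_ker] at h
  simpa [Finsupp.linearCombination_single, Pi.single_apply, pow_ite, Finset.prod_ite_eq'] using h

/-- Elements of A ⊗ N may thus be handled as polynomials with coefficients in N, taken modulo the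
monomials in which some exponent reaches D. -/
theorem IsTruncBasis.ker_monomialMap (hx : IsTruncBasis k x D) :
    LinearMap.ker (monomialMap k x N) = Finsupp.supported N k {a | ∃ i, D ≤ a i} := by
  apply le_antisymm
  · intro z hz
    have h1 := Finsupp.mem_supported_of_rTensor_eq_zero (N := N) _ hx.surjective _ hx.ker_eq
      ((TensorProduct.finsuppScalarLeft k N (Fin n → ℕ)).symm z) (by
        have := LinearMap.mem_ker.1 hz
        rwa [monomialMap_eq] at this)
    rwa [LinearEquiv.apply_symm_apply] at h1
  · refine Finsupp.supported_le ?_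
    rintro a ⟨i, hi⟩ m
    rw [LinearMap.mem_ker, monomialMap_single, ← Finset.mul_prod_erase _ _ (Finset.mem_univ i),
      ← Nat.add_sub_of_le hi, pow_add, hx.pow_eq_zero, zero_mul, zero_mul, TensorProduct.zero_tmul]

variable {d : ℕ} {Z : Type*} [CommRing Z] (ζ : Z →+* Module.End k N) (z : Fin n → Z)

variable (k) in
/-- The shift `Xᵃ m ↦ Xᵃ⁺ᵇ m`. -/
noncomputable def monomialShift (N : Type u) [AddCommGroup N] [Module k N] (b : Fin n → ℕ) :
    Module.End k ((Fin n → ℕ) →₀ N) :=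
  Finsupp.lmapDomain N k (· + b)

theorem monomialShift_single (b a : Fin n → ℕ) (m : N) :
    monomialShift k N b (Finsupp.single a m) = Finsupp.single (a + b) m := by
  simp [monomialShift]

theorem monomialMap_shift (b : Fin n → ℕ) (w : (Fin n → ℕ) →₀ N) :
    monomialMap k x N (monomialShift k N b w) =
      (LinearMap.mulLeft k (∏ i, x i ^ b i)).rTensor N (monomialMap k x N w) := by
  induction w using Finsupp.induction_linear with
  | zero => simp
  | add f g hf hg => simp only [map_add, hf, hg]
  | single a m =>
    rw [monomialShift_single, monomialMap_single, monomialMap_single, LinearMap.rTensor_tmul,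
      LinearMap.mulLeft_apply, ← Finset.prod_mul_distrib]
    simp [pow_add, mul_comm]

/-- The reduction which replaces `Xᵢ^d` by `zᵢ` for `i < j`. -/
noncomputable def monomialReduce (d : ℕ) (j : Fin n) : Module.End k ((Fin n → ℕ) →₀ N) :=
  Finsupp.lsum ℕ fun a => Finsupp.lsingle (fun i => if i < j then a i % d else a i) ∘ₗ
    ζ (∏ i, if i < j then z i ^ (a i / d) else 1)

theorem monomialReduce_single (j : Fin n) (a : Fin n → ℕ) (m : N) :
    monomialReduce ζ z d j (Finsupp.single a m) = Finsupp.single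
      (fun i => if i < j then a i % d else a i)
        (ζ (∏ i, if i < j then z i ^ (a i / d) else 1) m) := by
  simp [monomialReduce]

/-- The reduction identifies Xᵢ^d with zᵢ for i < j: shifting the exponent by d leaves the remainder
alone and raises the quotient by one. It is a polynomial model of passing to the quotient by the
operators of index below j. -/
theorem monomialReduce_shift_of_lt (hd : 0 < d) {i j : Fin n} (hij : i < j)
    (w : (Fin n → ℕ) →₀ N) :
    monomialReduce ζ z d j (monomialShift k N (Pi.single i d) w) =
      monomialReduce ζ z d j (Finsupp.mapRange.linearMap (ζ (z i)) w) := by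
  induction w using Finsupp.induction_linear with
  | zero => simp
  | add f g hf hg => simp only [map_add, hf, hg]
  | single a m =>
    rw [monomialShift_single, Finsupp.mapRange.linearMap_apply, Finsupp.mapRange_single,
      monomialReduce_single, monomialReduce_single, ← Module.End.mul_apply, ← map_mul]
    congr 1
    · ext l
      by_cases hl : l = i
      · subst hl; simp [hij]
      · simp [hl]
    · congr 2
      rw [← Finset.mul_prod_erase _ _ (Finset.mem_univ i),
        ← Finset.mul_prod_erase (a := i) _ (fun l => if l < j then z l ^ (a l / d) else 1) (Finset.mem_univ i)]
      rw [mul_right_comm]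
      congr 1
      · simp [hij, Nat.add_div_right _ hd, pow_succ]
      · refine Finset.prod_congr rfl fun l hl => ?_
        simp [(Finset.mem_erase.1 hl).1]

theorem monomialReduce_shift_of_le {i j : Fin n} (hij : ¬ i < j) (b : ℕ) (w : (Fin n → ℕ) →₀ N) :
    monomialReduce ζ z d j (monomialShift k N (Pi.single i b) w) =
      monomialShift k N (Pi.single i b) (monomialReduce ζ z d j w) := by
  induction w using Finsupp.induction_linear with
  | zero => simp
  | add f g hf hg => simp only [map_add, hf, hg]
  | single a m =>
    have hl : ∀ l, l < j → (Pi.single i b : Fin n → ℕ) l = 0 := by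
      intro l hl
      rw [Pi.single_apply, if_neg]
      rintro rfl
      exact hij hl
    rw [monomialShift_single, monomialReduce_single, monomialReduce_single, monomialShift_single]
    congr 1
    · ext l
      by_cases h : l < j
      · simp [h, hl l h]
      · simp [h]
    · congr 2
      refine Finset.prod_congr rfl fun l _ => ?_
      by_cases h : l < j
      · simp [h, hl l h]
      · simp [h]

variable (x d) in
/-- The endomorphism `xᵢ^d ⊗ 1 - 1 ⊗ zᵢ` of `A ⊗ N`. -/
noncomputable def diffEnd (i : Fin n) : Module.End k (A ⊗[k] N) :=
  (LinearMap.mulLeft k (x i ^ d)).rTensor N - (ζ (z i)).lTensor A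

theorem diffEnd_commute_aux (a : A) (c : Module.End k N) :
    Commute ((LinearMap.mulLeft k a).rTensor N : Module.End k (A ⊗[k] N)) (c.lTensor A) := by
  change _ * _ = _ * _
  ext b m
  simp

theorem diffEnd_commute (i j : Fin n) :
    Commute (diffEnd (k := k) x d ζ z i) (diffEnd x d ζ z j) := by
  have h1 : Commute ((LinearMap.mulLeft k (x i ^ d)).rTensor N : Module.End k (A ⊗[k] N))
      ((LinearMap.mulLeft k (x j ^ d)).rTensor N) := by
    change _ * _ = _ * _
    ext b m
    simp [mul_left_comm]
  have h2 : Commute ((ζ (z i)).lTensor A : Module.End k (A ⊗[k] N)) ((ζ (z j)).lTensor A) := by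
    change _ * _ = _ * _
    ext b m
    simp only [TensorProduct.AlgebraTensorModule.curry_apply, LinearMap.restrictScalars_self,
      TensorProduct.curry_apply, Module.End.mul_apply, LinearMap.lTensor_tmul]
    rw [← Module.End.mul_apply, ← Module.End.mul_apply, ← map_mul, ← map_mul, mul_comm]
  exact Commute.sub_left (R := Module.End k (A ⊗[k] N))
    (Commute.sub_right (R := Module.End k (A ⊗[k] N)) h1 (diffEnd_commute_aux _ _))
    (Commute.sub_right (R := Module.End k (A ⊗[k] N)) (diffEnd_commute_aux _ _).symm h2)

/-- The two summands commute, so the p-th power in characteristic p is the difference of p-th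
powers, and zᵢ^p = 0 removes the second one. The p-th power therefore no longer involves N. -/
theorem diffEnd_pow (p : ℕ) [Fact p.Prime] [CharP k p] (hz : ∀ i, z i ^ p = 0) (i : Fin n) :
    diffEnd (k := k) x d ζ z i ^ p = (LinearMap.mulLeft k (x i ^ (d * p))).rTensor N := by
  have h1 : diffEnd (k := k) x d ζ z i ^ p + ((ζ (z i)).lTensor A : Module.End k (A ⊗[k] N)) ^ p =
      ((LinearMap.mulLeft k (x i ^ d)).rTensor N) ^ p := by
    have hc : Commute (diffEnd (k := k) x d ζ z i) ((ζ (z i)).lTensor A : Module.End k (A ⊗[k] N)) :=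
      Commute.sub_left (R := Module.End k (A ⊗[k] N))
        (diffEnd_commute_aux (x i ^ d) (ζ (z i))) (Commute.refl _)
    rw [← add_pow_char_of_commute_algebra (k := k) (E := Module.End k (A ⊗[k] N)) _ _ hc]
    congr 1
    exact sub_add_cancel (G := Module.End k (A ⊗[k] N)) _ _
  have h2 : ((ζ (z i)).lTensor A : Module.End k (A ⊗[k] N)) ^ p = 0 := by
    rw [LinearMap.lTensor_pow, ← map_pow, hz, map_zero, LinearMap.lTensor_zero]
  rw [h2, add_zero] at h1
  rw [h1, LinearMap.rTensor_pow, LinearMap.pow_mulLeft, ← pow_mul]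

theorem diffEnd_monomialMap (i : Fin n) (w : (Fin n → ℕ) →₀ N) :
    diffEnd x d ζ z i (monomialMap k x N w) = monomialMap k x N
      (monomialShift k N (Pi.single i d) w - Finsupp.mapRange.linearMap (ζ (z i)) w) := by
  have h1 : ((ζ (z i)).lTensor A) (monomialMap k x N w) =
      monomialMap k x N (Finsupp.mapRange.linearMap (ζ (z i)) w) := by
    induction w using Finsupp.induction_linear with
    | zero => simp
    | add f g hf hg => simp only [map_add, hf, hg]
    | single a m =>
      rw [monomialMap_single, Finsupp.mapRange.linearMap_apply, Finsupp.mapRange_single,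
        monomialMap_single, LinearMap.lTensor_tmul]
  rw [map_sub, monomialMap_shift, ← h1, diffEnd, LinearMap.sub_apply]
  congr 4
  simp [Pi.single_apply, pow_ite, Finset.prod_ite_eq']

theorem monomialMap_shift_pow (p : ℕ) [Fact p.Prime] [CharP k p] (hz : ∀ i, z i ^ p = 0)
    (i : Fin n) (w : (Fin n → ℕ) →₀ N) :
    monomialMap k x N (monomialShift k N (Pi.single i (d * p)) w) =
      (diffEnd x d ζ z i ^ p) (monomialMap k x N w) := by
  rw [monomialMap_shift, diffEnd_pow ζ z p hz]
  congr 3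
  simp [Pi.single_apply, pow_ite, Finset.prod_ite_eq']

/-- Replacing one factor Xᵢ^d by zᵢ changes the class by an element in the range of the i-th
operator and lowers the degree of the monomial, so induction on the total degree applies. -/
theorem sub_monomialReduce_mem (hd : 0 < d) (j : Fin n) (w : (Fin n → ℕ) →₀ N) :
    monomialMap k x N w - monomialMap k x N (monomialReduce ζ z d j w) ∈
      ⨆ i : {i // i < j}, LinearMap.range (diffEnd (k := k) x d ζ z i) := by
  have hs : ∀ (s : ℕ) (a : Fin n → ℕ) (m : N), (∑ i, a i = s) →
      monomialMap k x N (Finsupp.single a m) -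
        monomialMap k x N (monomialReduce ζ z d j (Finsupp.single a m)) ∈
      ⨆ i : {i // i < j}, LinearMap.range (diffEnd (k := k) x d ζ z i) := by
    intro s
    induction s using Nat.strong_induction_on with
    | h s ih =>
      intro a m ha
      by_cases h : ∃ i < j, d ≤ a i
      · obtain ⟨i, hij, hi⟩ := h
        obtain ⟨b, rfl⟩ : ∃ b : Fin n → ℕ, a = b + Pi.single i d := by
          refine ⟨a - Pi.single i d, ?_⟩
          rw [tsub_add_cancel_of_le]
          intro l
          by_cases hl : l = i
          · subst hl; simpa using hi
          · simp [hl]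
        have h1 := diffEnd_monomialMap (x := x) (d := d) ζ z i (Finsupp.single b m)
        rw [map_sub, Finsupp.mapRange.linearMap_apply, Finsupp.mapRange_single] at h1
        rw [← monomialShift_single (k := k), monomialReduce_shift_of_lt ζ z hd hij,
          Finsupp.mapRange.linearMap_apply, Finsupp.mapRange_single, ← sub_add_sub_cancel, ← h1]
        refine Submodule.add_mem _ (Submodule.mem_iSup_of_mem ⟨i, hij⟩ ⟨_, rfl⟩)
          (ih _ ?_ b _ rfl)
        rw [← ha]
        simp only [Pi.add_apply, Finset.sum_add_distrib]
        simp [hd]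
      · push Not at h
        rw [monomialReduce_single]
        have h1 : (fun i => if i < j then a i % d else a i) = a := by
          ext i
          split_ifs with hi
          · exact Nat.mod_eq_of_lt (h i hi)
          · rfl
        have h2 : (∏ i, if i < j then z i ^ (a i / d) else 1) = 1 := by
          refine Finset.prod_eq_one fun i _ => ?_
          split_ifs with hi
          · rw [Nat.div_eq_of_lt (h i hi), pow_zero]
          · rfl
        rw [h1, h2, map_one, Module.End.one_apply, sub_self]
        exact Submodule.zero_mem _
  induction w using Finsupp.induction_linear with
  | zero => simp
  | add f g hf hg =>
    simp only [map_add]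
    rw [add_sub_add_comm]
    exact Submodule.add_mem _ hf hg
  | single a m => exact hs _ a m rfl

/-- The operators `xᵢ^d ⊗ 1 - 1 ⊗ zᵢ` on `A ⊗ N` behave like the variables of a truncated polynomial
algebra. -/
theorem IsTruncBasis.diffEnd_regular {p q : ℕ} [Fact p.Prime] [CharP k p] (hd : 0 < d)
    (hx : IsTruncBasis k x (d * q)) (hpq : p + p ≤ q) (hz : ∀ i, z i ^ p = 0) (j : Fin n)
    (w : A ⊗[k] N)
    (hw : (diffEnd x d ζ z j ^ p) w ∈ ⨆ i : {i // i ≠ j},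
      LinearMap.range (diffEnd (k := k) x d ζ z i ^ (if i.1 < j then 1 else p))) :
    ∃ v, w - (diffEnd x d ζ z j ^ p) v ∈ ⨆ i : {i // i ≠ j},
      LinearMap.range (diffEnd (k := k) x d ζ z i ^ (if i.1 < j then 1 else p)) := by
  set L := ⨆ i : {i // i ≠ j},
      LinearMap.range (diffEnd (k := k) x d ζ z i ^ (if i.1 < j then 1 else p)) with hL
  have hp : 0 < p := (Fact.out : p.Prime).pos
  -- U lists the reduced monomials divisible by Xᵢ^(d p) for some i > j, or by Xⱼ^e. G consists of
  -- the polynomials whose reduction involves only U (d q); it contains the kernel of the monomial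
  -- map and enough lifts to cover L.
  let U (e : ℕ) : Set (Fin n → ℕ) := {a | (∃ i, j < i ∧ d * p ≤ a i) ∨ e ≤ a j}
  let G := (Finsupp.supported N k (U (d * q))).comap (monomialReduce ζ z d j)
  have hpow : ∀ i (e : ℕ), p ≤ e → z i ^ e = 0 := fun i e he => pow_eq_zero_of_le he (hz i)
  -- A factor Xᵢ^(d q) with i < j reduces to a power of zᵢ of exponent at least q ≥ p, which is
  -- zero. With i = j it stays in U (d q), and with i > j it is divisible by Xᵢ^(d p).
  have hker : LinearMap.ker (monomialMap k x N) ≤ G := by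
    rw [hx.ker_monomialMap]
    refine Finsupp.supported_le ?_
    rintro a ⟨i, hi⟩ m
    rw [Submodule.mem_comap, monomialReduce_single]
    by_cases hij : i < j
    · have h1 : (∏ i, if i < j then z i ^ (a i / d) else 1) = 0 := by
        refine Finset.prod_eq_zero (Finset.mem_univ i) ?_
        rw [if_pos hij]
        refine hpow _ _ (le_trans (le_trans (Nat.le_add_left _ _) hpq) ?_)
        rw [Nat.le_div_iff_mul_le hd, mul_comm]
        exact hi
      rw [h1, map_zero, LinearMap.zero_apply, Finsupp.single_zero]
      exact Submodule.zero_mem _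
    · refine Finsupp.single_mem_supported _ _ ?_
      rcases eq_or_lt_of_le (not_lt.1 hij) with h | h
      · right
        subst h
        simpa using hi
      · left
        refine ⟨i, h, ?_⟩
        simp only [if_neg hij]
        exact le_trans (Nat.mul_le_mul_left _ (by omega)) hi
  -- For i < j the generators of L lift to polynomials with zero reduction. For i > j the p-th power
  -- is multiplication by xᵢ^(d p), and the lift lands in the first half of U.
  have hLG : L ≤ G.map (monomialMap k x N) := by
    refine iSup_le ?_
    rintro ⟨i, hij⟩ _ ⟨y, rfl⟩
    obtain ⟨y, rfl⟩ := hx.monomialMap_surjective y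
    simp only
    split_ifs with h
    · rw [pow_one, diffEnd_monomialMap]
      refine ⟨_, ?_, rfl⟩
      rw [SetLike.mem_coe, Submodule.mem_comap]
      rw [map_sub, monomialReduce_shift_of_lt ζ z hd h, sub_self]
      exact Submodule.zero_mem _
    · rw [← monomialMap_shift_pow ζ z p hz]
      refine ⟨_, ?_, rfl⟩
      rw [SetLike.mem_coe, Submodule.mem_comap]
      rw [monomialReduce_shift_of_le ζ z h]
      generalize monomialReduce ζ z d j y = y
      have hji : j < i := lt_of_le_of_ne (not_lt.1 h) (Ne.symm hij)
      induction y using Finsupp.induction_linear with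
      | zero => simp
      | add f g hf hg => rw [map_add]; exact Submodule.add_mem _ hf hg
      | single a m =>
        rw [monomialShift_single]
        exact Finsupp.single_mem_supported _ _ (Or.inl ⟨i, hji, by simp⟩)
  obtain ⟨w, rfl⟩ := hx.monomialMap_surjective w
  obtain ⟨g, hg, hgw⟩ := hLG hw
  rw [← monomialMap_shift_pow ζ z p hz] at hgw
  have h1 : monomialShift k N (Pi.single j (d * p)) w ∈ G := by
    rw [← sub_add_cancel (monomialShift k N (Pi.single j (d * p)) w) g]
    exact Submodule.add_mem _ (hker (by rw [LinearMap.mem_ker, map_sub, hgw, sub_self])) hg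
  rw [Submodule.mem_comap, monomialReduce_shift_of_le ζ z (lt_irrefl j)] at h1
  -- The monomials of the reduction of w that avoid the indices above j have exponent at least d q -
  -- d p in Xⱼ, and d q - d p ≥ d p because 2 p ≤ q.
  have h2 : monomialReduce ζ z d j w ∈ Finsupp.supported N k (U (d * p)) := by
    rw [Finsupp.mem_supported'] at h1 ⊢
    intro a ha
    have h3 := h1 (a + Pi.single j (d * p)) ?_
    · rwa [monomialShift, Finsupp.lmapDomain_apply,
        Finsupp.mapDomain_apply (add_left_injective _)] at h3
    · rintro (⟨i, hi, h⟩ | h)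
      · refine ha (Or.inl ⟨i, hi, ?_⟩)
        rwa [Pi.add_apply, Pi.single_eq_of_ne hi.ne', add_zero] at h
      · refine ha (Or.inr ?_)
        rw [Pi.add_apply, Pi.single_eq_same] at h
        have := Nat.mul_le_mul_left d hpq
        rw [mul_add] at this
        omega
  -- Conversely, each monomial in U (d p) is a multiple of xᵢ^(d p) with i > j or of xⱼ^(d p), hence
  -- lies in the range of a p-th power.
  have h3 : ∀ y ∈ Finsupp.supported N k (U (d * p)), monomialMap k x N y ∈
      L ⊔ LinearMap.range (diffEnd (k := k) x d ζ z j ^ p) := by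
    have hsh : ∀ (i : Fin n) (a : Fin n → ℕ) (m : N), d * p ≤ a i →
        monomialMap k x N (Finsupp.single a m) ∈
          LinearMap.range (diffEnd (k := k) x d ζ z i ^ p) := by
      intro i a m hi
      refine ⟨monomialMap k x N (Finsupp.single (a - Pi.single i (d * p)) m), ?_⟩
      rw [← monomialMap_shift_pow ζ z p hz, monomialShift_single, tsub_add_cancel_of_le]
      intro l
      by_cases hl : l = i
      · subst hl; simpa using hi
      · simp [hl]
    refine Finsupp.supported_le (G := (L ⊔ LinearMap.range (diffEnd (k := k) x d ζ z j ^ p)).comap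
      (monomialMap k x N)) ?_
    rintro a (⟨i, hi, h⟩ | h) m
    · refine Submodule.mem_sup_left (Submodule.mem_iSup_of_mem ⟨i, hi.ne'⟩ ?_)
      rw [if_neg (not_lt.2 hi.le)]
      exact hsh i a m h
    · exact Submodule.mem_sup_right (hsh j a m h)
  obtain ⟨l, hl, _, ⟨v, rfl⟩, h4⟩ := Submodule.mem_sup.1 (h3 _ h2)
  refine ⟨v, ?_⟩
  have h5 : monomialMap k x N w - (diffEnd x d ζ z j ^ p) v =
      (monomialMap k x N w - monomialMap k x N (monomialReduce ζ z d j w)) + l := by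
    rw [← h4]; abel
  rw [h5]
  refine Submodule.add_mem _ ?_ hl
  have h6 : (⨆ i : {i // i < j}, LinearMap.range (diffEnd (k := k) x d ζ z i)) ≤ L := by
    refine iSup_le ?_
    rintro ⟨i, hi⟩
    refine le_trans ?_ (le_iSup _ (⟨i, hi.ne⟩ : {i // i ≠ j}))
    simp [hi]
  exact h6 (sub_monomialReduce_mem ζ z hd j w)

end TruncatedBasis

/-! ### Local coordinates at the identity and Frobenius kernels of smooth groups -/

section LocalAlgebras
variable {k : Type u} [Field k] {E : Type u} [CommRing E] [Algebra k E]

/-- If `E = k ⊕ I` with `I` nilpotent, elements of `I` which span `I` modulo `I ^ 2` generate `E`. -/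
theorem adjoin_eq_top_of_isNilpotent {I : Ideal E} (hI : IsNilpotent I)
    (hE : ∀ e : E, ∃ c : k, e - algebraMap k E c ∈ I) {n : ℕ} (x : Fin n → E)
    (h : ∀ e ∈ I, ∃ c : Fin n → k, e - ∑ i, c i • x i ∈ I ^ 2) :
    Algebra.adjoin k (Set.range x) = ⊤ := by
  set S := Algebra.adjoin k (Set.range x) with hS
  have hlin : ∀ c : Fin n → k, ∑ i, c i • x i ∈ S := fun c =>
    Subalgebra.sum_mem _ fun i _ => Subalgebra.smul_mem _ (Algebra.subset_adjoin (Set.mem_range_self i)) _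
  -- A product of an element of I^(j+1) and one of I is approximated factor by factor: both errors
  -- contribute only to the next power of I. Nilpotence stops the approximation.
  have h1 : ∀ j, ∀ e ∈ I ^ (j + 1), ∃ s ∈ S, e - s ∈ I ^ (j + 2) := by
    intro j
    induction j with
    | zero =>
      intro e he
      rw [zero_add, pow_one] at he
      obtain ⟨c, hc⟩ := h e he
      exact ⟨_, hlin c, hc⟩
    | succ j ih =>
      intro e he
      rw [pow_succ] at he
      refine Submodule.mul_induction_on he ?_ ?_
      · intro a ha b hb
        obtain ⟨s, hs, has⟩ := ih a ha
        obtain ⟨c, hc⟩ := h b hb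
        have hcI : ∑ i, c i • x i ∈ I := by
          rw [← sub_sub_cancel b (∑ i, c i • x i)]
          exact I.sub_mem hb (Ideal.pow_le_self two_ne_zero hc)
        refine ⟨s * ∑ i, c i • x i, S.mul_mem hs (hlin c), ?_⟩
        have h2 : a * b - s * ∑ i, c i • x i =
            a * (b - ∑ i, c i • x i) + (a - s) * ∑ i, c i • x i := by ring
        rw [h2]
        refine Ideal.add_mem _ ?_ ?_
        · have := Ideal.mul_mem_mul ha hc
          rwa [← pow_add] at this
        · have := Ideal.mul_mem_mul has hcI
          rwa [← pow_succ] at this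
      · rintro a b ⟨s, hs, h⟩ ⟨s', hs', h'⟩
        exact ⟨s + s', S.add_mem hs hs', by rw [add_sub_add_comm]; exact Ideal.add_mem _ h h'⟩
  have h2 : ∀ j, ∀ e : E, ∃ s ∈ S, e - s ∈ I ^ (j + 1) := by
    intro j
    induction j with
    | zero =>
      intro e
      obtain ⟨c, hc⟩ := hE e
      exact ⟨_, S.algebraMap_mem c, by simpa using hc⟩
    | succ j ih =>
      intro e
      obtain ⟨s, hs, h⟩ := ih e
      obtain ⟨s', hs', h'⟩ := h1 j _ h
      exact ⟨s + s', S.add_mem hs hs', by rwa [← sub_sub]⟩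
  obtain ⟨m, hm⟩ := hI
  rw [eq_top_iff]
  intro e _
  obtain ⟨s, hs, h⟩ := h2 m e
  have : I ^ (m + 1) = 0 := by rw [pow_succ, hm, zero_mul]
  rw [this, Ideal.zero_eq_bot, Ideal.mem_bot, sub_eq_zero] at h
  rwa [h]

theorem finite_of_isNilpotent [Algebra.FiniteType k E] {I : Ideal E} (hI : IsNilpotent I)
    (hE : ∀ e : E, ∃ c : k, e - algebraMap k E c ∈ I) : Module.Finite k E := by
  have : Algebra.IsIntegral k E := by
    refine ⟨fun e => ?_⟩
    obtain ⟨c, hc⟩ := hE e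
    obtain ⟨m, hm⟩ := hI
    have h1 : (e - algebraMap k E c) ^ m = 0 := by
      have := Ideal.pow_mem_pow hc m
      rwa [hm] at this
    have h2 : IsIntegral k (e - algebraMap k E c) := by
      refine IsIntegral.of_pow (n := m + 1) (by omega) ?_
      rw [pow_succ, h1, zero_mul]
      exact isIntegral_zero
    have := h2.add (isIntegral_algebraMap (x := c))
    rwa [sub_add_cancel] at this
  exact Algebra.IsIntegral.finite

end LocalAlgebras

section Polynomials
variable {k : Type u} [Field k] {n : ℕ}

/-- The polynomial with given coefficients. -/
noncomputable def polyOfCoeffs (w : (Fin n → ℕ) →₀ k) : MvPolynomial (Fin n) k :=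
  w.sum fun a c => MvPolynomial.monomial (Finsupp.equivFunOnFinite.symm a) c

theorem coeff_polyOfCoeffs (w : (Fin n → ℕ) →₀ k) (a : Fin n → ℕ) :
    (polyOfCoeffs w).coeff (Finsupp.equivFunOnFinite.symm a) = w a := by
  classical
  rw [polyOfCoeffs, Finsupp.sum, MvPolynomial.coeff_sum]
  simp only [MvPolynomial.coeff_monomial, EmbeddingLike.apply_eq_iff_eq]
  rw [Finset.sum_ite_eq']
  split_ifs with h
  · rfl
  · exact (Finsupp.notMem_support_iff.1 h).symm

theorem aeval_polyOfCoeffs {E : Type u} [CommRing E] [Algebra k E] (x : Fin n → E)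
    (w : (Fin n → ℕ) →₀ k) : MvPolynomial.aeval x (polyOfCoeffs w) =
      Finsupp.linearCombination k (fun a : Fin n → ℕ => ∏ i, x i ^ a i) w := by
  rw [polyOfCoeffs, Finsupp.sum, map_sum, Finsupp.linearCombination_apply, Finsupp.sum]
  refine Finset.sum_congr rfl fun a _ => ?_
  rw [MvPolynomial.aeval_monomial, Finsupp.prod_fintype _ _ (by simp), Algebra.smul_def]
  rfl

theorem linearCombination_surjective_of_adjoin {E : Type u} [CommRing E] [Algebra k E]
    (x : Fin n → E) (h : Algebra.adjoin k (Set.range x) = ⊤) :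
    Function.Surjective (Finsupp.linearCombination k fun a : Fin n → ℕ => ∏ i, x i ^ a i) := by
  rw [← LinearMap.range_eq_top, eq_top_iff]
  intro e _
  rw [Algebra.adjoin_range_eq_range_aeval] at h
  obtain ⟨P, rfl⟩ : e ∈ (MvPolynomial.aeval (R := k) x).range := h ▸ Algebra.mem_top
  change MvPolynomial.aeval x P ∈ _
  clear * -
  induction P using MvPolynomial.induction_on' with
  | monomial a c =>
    refine ⟨Finsupp.single a c, ?_⟩
    rw [Finsupp.linearCombination_single, MvPolynomial.aeval_monomial,
      Finsupp.prod_fintype _ _ (by simp), Algebra.smul_def]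
  | add p q hp hq => rw [map_add]; exact Submodule.add_mem _ hp hq

variable (k n) in
/-- The ideal `(X₁^D, …, Xₙ^D)`. -/
noncomputable def truncIdeal (D : ℕ) : Ideal (MvPolynomial (Fin n) k) :=
  Ideal.span (Set.range fun i => MvPolynomial.X i ^ D)

/-- The ideal is generated by monomials, so membership can be tested on each monomial of the
polynomial. -/
theorem exists_le_of_mem_truncIdeal {D : ℕ} {w : (Fin n → ℕ) →₀ k}
    (h : polyOfCoeffs w ∈ truncIdeal k n D) : w ∈ Finsupp.supported k k {a | ∃ i, D ≤ a i} := by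
  rw [Finsupp.mem_supported]
  intro a ha
  have h1 : truncIdeal k n D = Ideal.span ((fun s => MvPolynomial.monomial s (1 : k)) ''
      Set.range fun i : Fin n => Finsupp.single i D) := by
    rw [truncIdeal, ← Set.range_comp]
    congr 2
    ext1 i
    simp [MvPolynomial.X_pow_eq_monomial]
  rw [h1, MvPolynomial.mem_ideal_span_monomial_image] at h
  obtain ⟨_, ⟨i, rfl⟩, hi⟩ := h (Finsupp.equivFunOnFinite.symm a) (by
    rw [MvPolynomial.mem_support_iff, coeff_polyOfCoeffs]
    exact Finsupp.mem_support_iff.1 ha)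
  exact ⟨i, by simpa using hi i⟩

end Polynomials

section TruncRing
variable (k : Type u) [Field k] (p : ℕ) [Fact p.Prime] [CharP k p] (n s : ℕ)

/-- The algebra `k[X₁, …, Xₙ] / (X₁^(p^s), …, Xₙ^(p^s))`. -/
abbrev TruncRing : Type u := MvPolynomial (Fin n) k ⧸ truncIdeal k n (p ^ s)

/-- The class of a variable. -/
noncomputable def TruncRing.var (i : Fin n) : TruncRing k p n s := Ideal.Quotient.mk _ (MvPolynomial.X i)

/-- The ideal generated by the variables. -/
noncomputable def TruncRing.ideal : Ideal (TruncRing k p n s) := Ideal.span (Set.range (TruncRing.var k p n s))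

namespace TruncRing
variable {k p n s}

theorem pow_eq_zero {e : TruncRing k p n s} (he : e ∈ TruncRing.ideal k p n s) : e ^ p ^ s = 0 := by
  have hp : p ^ s ≠ 0 := pow_ne_zero _ (Fact.out : p.Prime).ne_zero
  induction he using Submodule.span_induction with
  | mem x hx =>
    obtain ⟨i, rfl⟩ := hx
    rw [var, ← map_pow]
    exact Ideal.Quotient.eq_zero_iff_mem.2 (Ideal.subset_span ⟨i, rfl⟩)
  | zero => exact zero_pow hp
  | add x y _ _ hx hy => rw [add_pow_char_pow_of_algebra k, hx, hy, add_zero]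
  | smul a x _ hx => rw [smul_eq_mul, mul_pow, hx, mul_zero]

theorem ideal_isNilpotent : IsNilpotent (TruncRing.ideal k p n s) := by
  refine (Ideal.FG.isNilpotent_iff_le_nilradical (I := TruncRing.ideal k p n s)
    (Submodule.fg_span (Set.finite_range _))).2 ?_
  exact fun e he => ⟨_, pow_eq_zero he⟩

theorem exists_sub_mem (e : TruncRing k p n s) :
    ∃ c : k, e - algebraMap k _ c ∈ TruncRing.ideal k p n s := by
  obtain ⟨P, rfl⟩ := Ideal.Quotient.mk_surjective e
  induction P using MvPolynomial.induction_on with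
  | C a => exact ⟨a, by convert Ideal.zero_mem _; exact sub_self _⟩
  | add P Q hP hQ =>
    obtain ⟨c, hc⟩ := hP
    obtain ⟨d, hd⟩ := hQ
    refine ⟨c + d, ?_⟩
    rw [map_add, map_add, add_sub_add_comm]
    exact Ideal.add_mem _ hc hd
  | mul_X P i _ =>
    refine ⟨0, ?_⟩
    rw [map_zero, sub_zero, map_mul]
    exact Ideal.mul_mem_left _ _ (Ideal.subset_span ⟨i, rfl⟩)

theorem exists_sub_mem_sq (e : TruncRing k p n s) (he : e ∈ TruncRing.ideal k p n s) :
    ∃ c : Fin n → k, e - ∑ i, c i • var k p n s i ∈ TruncRing.ideal k p n s ^ 2 := by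
  classical
  induction he using Submodule.span_induction with
  | mem x hx =>
    obtain ⟨i, rfl⟩ := hx
    refine ⟨Pi.single i 1, ?_⟩
    simp [Pi.single_apply]
  | zero => exact ⟨0, by simp⟩
  | add x y _ _ hx hy =>
    obtain ⟨c, hc⟩ := hx
    obtain ⟨d, hd⟩ := hy
    refine ⟨c + d, ?_⟩
    simp only [Pi.add_apply, add_smul, Finset.sum_add_distrib]
    rw [add_sub_add_comm]
    exact Ideal.add_mem _ hc hd
  | smul a x hx h =>
    obtain ⟨c, hc⟩ := h
    obtain ⟨b, hb⟩ := exists_sub_mem a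
    refine ⟨fun i => b * c i, ?_⟩
    have h1 : a • x - ∑ i, (b * c i) • var k p n s i =
        (a - algebraMap k _ b) * x + algebraMap k _ b * (x - ∑ i, c i • var k p n s i) := by
      have h2 : ∑ i, (b * c i) • var k p n s i =
          algebraMap k (TruncRing k p n s) b * ∑ i, c i • var k p n s i := by
        rw [← Algebra.smul_def, Finset.smul_sum]
        simp only [mul_smul]
      rw [h2, smul_eq_mul]
      ring
    rw [h1]
    refine Ideal.add_mem _ ?_ (Ideal.mul_mem_left _ _ hc)
    rw [pow_two]
    exact Ideal.mul_mem_mul hb hx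

instance : Module.Finite k (TruncRing k p n s) :=
  finite_of_isNilpotent ideal_isNilpotent exists_sub_mem

/-- An endomorphism of the truncated polynomial algebra which is the identity modulo the square of
the ideal of the variables is injective. -/
theorem mem_truncIdeal_of_aeval_eq_zero (y : Fin n → TruncRing k p n s)
    (hy : ∀ i, y i - var k p n s i ∈ TruncRing.ideal k p n s ^ 2) (P : MvPolynomial (Fin n) k)
    (hP : MvPolynomial.aeval y P = 0) : P ∈ truncIdeal k n (p ^ s) := by
  have hyI : ∀ i, y i ∈ TruncRing.ideal k p n s := by
    intro i
    rw [← sub_add_cancel (y i) (var k p n s i)]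
    exact Ideal.add_mem _ (Ideal.pow_le_self two_ne_zero (hy i)) (Ideal.subset_span ⟨i, rfl⟩)
  have hle : ∀ P ∈ truncIdeal k n (p ^ s), MvPolynomial.aeval y P = 0 := by
    have : truncIdeal k n (p ^ s) ≤ RingHom.ker (MvPolynomial.aeval (R := k) y) := by
      refine Ideal.span_le.2 ?_
      rintro _ ⟨i, rfl⟩
      simp only [SetLike.mem_coe, RingHom.mem_ker, map_pow, MvPolynomial.aeval_X]
      exact pow_eq_zero (hyI i)
    exact fun P hP => this hP
  let Ψ : TruncRing k p n s →ₐ[k] TruncRing k p n s :=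
    Ideal.Quotient.liftₐ _ (MvPolynomial.aeval y) hle
  -- The yᵢ span the ideal of the variables modulo its square, so they generate the algebra. Finite
  -- dimension then turns surjectivity of Ψ into injectivity.
  have hsurj : Function.Surjective Ψ := by
    have h1 := adjoin_eq_top_of_isNilpotent ideal_isNilpotent exists_sub_mem y (by
      intro e he
      obtain ⟨c, hc⟩ := exists_sub_mem_sq e he
      refine ⟨c, ?_⟩
      have h2 : e - ∑ i, c i • y i = (e - ∑ i, c i • var k p n s i) -
          ∑ i, c i • (y i - var k p n s i) := by
        simp only [smul_sub, Finset.sum_sub_distrib]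
        abel
      rw [h2]
      refine Ideal.sub_mem _ hc (Ideal.sum_mem _ fun i _ => ?_)
      exact Submodule.smul_of_tower_mem _ _ (hy i))
    rw [Algebra.adjoin_range_eq_range_aeval] at h1
    intro e
    obtain ⟨P, rfl⟩ : e ∈ (MvPolynomial.aeval (R := k) y).range := h1 ▸ Algebra.mem_top
    exact ⟨Ideal.Quotient.mk _ P, rfl⟩
  have hinj : Function.Injective Ψ.toLinearMap := LinearMap.injective_iff_surjective.2 hsurj
  refine Ideal.Quotient.eq_zero_iff_mem.1 (hinj ?_)
  rw [map_zero]
  exact hP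

end TruncRing
end TruncRing

section Smooth
variable (k : Type u) [Field k] (p : ℕ) [Fact p.Prime] [CharP k p] (R : Type u) [CommRing R]
  [HopfAlgebra k R]

/-- The augmentation ideal. -/
def augIdeal : Ideal R := RingHom.ker (Bialgebra.counitAlgHom k R)

variable {k R}

theorem mem_augIdeal {x : R} : x ∈ augIdeal k R ↔ counit (R := k) x = 0 := RingHom.mem_ker

theorem sub_counit_mem (x : R) : x - algebraMap k R (counit (R := k) x) ∈ augIdeal k R := by
  rw [mem_augIdeal]; simp

/-- Local coordinates at the identity. -/
structure IsCoordinates {n : ℕ} (x : Fin n → R) (δ : R →ₗ[k] (Fin n → k)) : Prop where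
  counit_eq_zero : ∀ i, counit (R := k) (x i) = 0
  apply_coord : ∀ i, δ (x i) = Pi.single i 1
  apply_one : δ 1 = 0
  apply_mul : ∀ a b, δ (a * b) = counit (R := k) a • δ b + counit (R := k) b • δ a
  sub_mem : ∀ a ∈ augIdeal k R, a - ∑ i, δ a i • x i ∈ augIdeal k R ^ 2

/-- The xᵢ lift a basis of the cotangent space m/m² at the identity, and δ gives the coordinates of
a - ε(a) in that basis. The derivation rule holds since the deviation from it is a product of two
elements of m. -/
theorem exists_isCoordinates [Algebra.FiniteType k R] :
    ∃ (n : ℕ) (x : Fin n → R) (δ : R →ₗ[k] (Fin n → k)), IsCoordinates x δ := by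
  set m := augIdeal k R with hm
  let W := R ⧸ m ^ 2
  let π : R →ₐ[k] W := Ideal.Quotient.mkₐ k (m ^ 2)
  have hπ : ∀ {a}, π a = 0 ↔ a ∈ m ^ 2 := Ideal.Quotient.eq_zero_iff_mem
  -- R/m² is of finite type and its augmentation ideal squares to zero, so it is finite dimensional,
  -- and with it the cotangent space.
  have : Module.Finite k W := by
    refine finite_of_isNilpotent (I := m.map π) ⟨2, ?_⟩ ?_
    · rw [← Ideal.map_pow, Ideal.zero_eq_bot, eq_bot_iff, Ideal.map_le_iff_le_comap]
      exact fun a ha => hπ.2 ha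
    · intro e
      obtain ⟨a, rfl⟩ := Ideal.Quotient.mk_surjective e
      refine ⟨counit (R := k) a, ?_⟩
      have := Ideal.mem_map_of_mem π (sub_counit_mem (k := k) a)
      rwa [map_sub, AlgHom.commutes] at this
  let V : Submodule k W := (m.restrictScalars k).map π.toLinearMap
  let b := Module.finBasis k V
  have hx : ∀ i, ∃ x ∈ m, π x = (b i : W) := fun i => (b i).2
  choose x hxm hxb using hx
  let ρ : R →ₗ[k] R := LinearMap.id - (Algebra.linearMap k R) ∘ₗ counit
  have hρ : ∀ a, ρ a = a - algebraMap k R (counit (R := k) a) := fun a => rfl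
  let δ₀ : R →ₗ[k] V := LinearMap.codRestrict V (π.toLinearMap ∘ₗ ρ) fun a =>
    ⟨ρ a, sub_counit_mem a, rfl⟩
  have hδ₀ : ∀ a, (δ₀ a : W) = π (ρ a) := fun a => rfl
  let δ : R →ₗ[k] (Fin (Module.finrank k V) → k) := b.equivFun.toLinearMap ∘ₗ δ₀
  have hδ : ∀ a, δ a = b.equivFun (δ₀ a) := fun a => rfl
  have hρm : ∀ a ∈ m, ρ a = a := by
    intro a ha
    rw [hρ, mem_augIdeal.1 ha, map_zero, sub_zero]
  refine ⟨_, x, δ, fun i => mem_augIdeal.1 (hxm i), ?_, ?_, ?_, ?_⟩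
  · intro i
    have : δ₀ (x i) = b i := by
      apply Subtype.ext
      rw [hδ₀, hρm _ (hxm i), hxb]
    rw [hδ, this]
    ext j
    rw [Module.Basis.equivFun_self]
    simp [Pi.single_apply, eq_comm]
  · have : δ₀ 1 = 0 := by
      apply Subtype.ext
      rw [hδ₀, hρ]
      simp
    rw [hδ, this, map_zero]
  · intro a c
    have : δ₀ (a * c) = counit (R := k) a • δ₀ c + counit (R := k) c • δ₀ a := by
      apply Subtype.ext
      rw [Submodule.coe_add, Submodule.coe_smul, Submodule.coe_smul, hδ₀, hδ₀, hδ₀,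
        ← map_smul π, ← map_smul π, ← map_add π, ← sub_eq_zero, ← map_sub π, hπ]
      have : ρ (a * c) - (counit (R := k) a • ρ c + counit (R := k) c • ρ a) = ρ a * ρ c := by
        simp only [hρ, Bialgebra.counit_mul, map_mul, Algebra.smul_def]
        ring
      rw [this, pow_two]
      exact Ideal.mul_mem_mul (sub_counit_mem a) (sub_counit_mem c)
    rw [hδ, this, map_add, map_smul, map_smul]
    rfl
  · intro a ha
    rw [← hπ, map_sub, map_sum]
    have h1 := congrArg Subtype.val (b.sum_equivFun (δ₀ a))
    rw [hδ₀, hρm a ha] at h1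
    rw [← h1, sub_eq_zero, Submodule.coe_sum]
    refine Finset.sum_congr rfl fun i _ => ?_
    rw [map_smul, hxb, hδ]
    rfl

/-- The local coordinates generate `k[𝔾_(s)]`. -/
theorem IsCoordinates.adjoin_eq_top [Algebra.FiniteType k R] {n : ℕ} {x : Fin n → R}
    {δ : R →ₗ[k] (Fin n → k)} (hx : IsCoordinates x δ) (s : ℕ) :
    Algebra.adjoin k (Set.range fun i => FrobeniusKernel.mk k p s R (x i)) = ⊤ := by
  have hs := FrobeniusKernel.mk_surjective k p s R
  have hmem : ∀ {y}, y ∈ (augIdeal k R).map (FrobeniusKernel.mk k p s R) ↔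
      ∃ a ∈ augIdeal k R, FrobeniusKernel.mk k p s R a = y :=
    Ideal.mem_map_iff_of_surjective _ hs
  have : IsNoetherianRing (FrobeniusKernel k p s R) := IsNoetherianRing.of_finite k _
  refine adjoin_eq_top_of_isNilpotent (I := (augIdeal k R).map (FrobeniusKernel.mk k p s R)) ?_ ?_ _ ?_
  · rw [Ideal.FG.isNilpotent_iff_le_nilradical (IsNoetherian.noetherian _)]
    intro y hy
    obtain ⟨a, ha, rfl⟩ := hmem.1 hy
    exact ⟨_, FrobeniusKernel.mk_pow_eq_zero k p s R a (mem_augIdeal.1 ha)⟩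
  · intro e
    obtain ⟨a, rfl⟩ := hs e
    refine ⟨counit (R := k) a, ?_⟩
    have := Ideal.mem_map_of_mem (FrobeniusKernel.mk k p s R) (sub_counit_mem (k := k) a)
    rwa [map_sub, AlgHomClass.commutes] at this
  · intro e he
    obtain ⟨a, ha, rfl⟩ := hmem.1 he
    refine ⟨δ a, ?_⟩
    have := Ideal.mem_map_of_mem (FrobeniusKernel.mk k p s R) (hx.sub_mem a ha)
    rw [Ideal.map_pow] at this
    simpa using this

/-- The Frobenius kernels of a smooth group scheme have truncated polynomial coordinate algebras. -/
theorem IsCoordinates.isTruncBasis [Algebra.Smooth k R] {n : ℕ} {x : Fin n → R}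
    {δ : R →ₗ[k] (Fin n → k)} (hx : IsCoordinates x δ) (s : ℕ) :
    IsTruncBasis k (fun i => FrobeniusKernel.mk k p s R (x i)) (p ^ s) where
  surjective := linearCombination_surjective_of_adjoin _ (hx.adjoin_eq_top p s)
  ker_eq := by
    apply le_antisymm
    · intro w hw
      let I := TruncRing.ideal k p n s
      let var := TruncRing.var k p n s
      have hvar : ∀ i, var i ∈ I := fun i => Ideal.subset_span ⟨i, rfl⟩
      let π : TruncRing k p n s →ₐ[k] TruncRing k p n s ⧸ I ^ 2 := Ideal.Quotient.mkₐ k (I ^ 2)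
      have hπ : ∀ {a}, π a = 0 ↔ a ∈ I ^ 2 := Ideal.Quotient.eq_zero_iff_mem
      let θl : R →ₗ[k] TruncRing k p n s :=
        (Algebra.linearMap k _) ∘ₗ counit + (Fintype.linearCombination k var) ∘ₗ δ
      have hθl : ∀ a, θl a = algebraMap k _ (counit (R := k) a) + ∑ i, δ a i • var i := by
        intro a
        simp [θl, Fintype.linearCombination_apply]
      have hsum : ∀ c : Fin n → k, ∑ i, c i • var i ∈ I := fun c =>
        Ideal.sum_mem _ fun i _ => Submodule.smul_of_tower_mem _ _ (hvar i)
      -- By the derivation rule, the first order Taylor expansion a ↦ ε(a) + ∑ δᵢ(a) Xᵢ is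
      -- multiplicative, but only modulo I².
      let θ : R →ₐ[k] TruncRing k p n s ⧸ I ^ 2 := AlgHom.ofLinearMap (π.toLinearMap ∘ₗ θl)
        (by
          change π (θl 1) = 1
          rw [hθl, hx.apply_one]
          simp)
        (by
          intro a c
          change π (θl (a * c)) = π (θl a) * π (θl c)
          rw [← map_mul, ← sub_eq_zero, ← map_sub, hπ]
          have h1 : θl (a * c) - θl a * θl c =
              - ((∑ i, δ a i • var i) * ∑ i, δ c i • var i) := by
            rw [hθl, hθl, hθl, hx.apply_mul]
            simp only [Pi.add_apply, Pi.smul_apply, smul_eq_mul, add_smul, mul_smul,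
              Finset.sum_add_distrib, ← Finset.smul_sum, Bialgebra.counit_mul, map_mul]
            have h2 : ∀ (d : k) (y : TruncRing k p n s), d • y = algebraMap k _ d * y :=
              fun d y => Algebra.smul_def d y
            rw [h2, h2]
            ring
          rw [h1, pow_two]
          exact Ideal.neg_mem_iff _ |>.2 (Ideal.mul_mem_mul (hsum _) (hsum _)))
      have hI : IsNilpotent (I ^ 2) := by
        obtain ⟨m, hm⟩ := TruncRing.ideal_isNilpotent (k := k) (p := p) (n := n) (s := s)
        refine ⟨m, ?_⟩
        change (I ^ 2) ^ m = 0
        rw [← pow_mul, mul_comm, pow_mul, show I ^ m = ⊥ from hm, pow_two, Ideal.bot_mul]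
        rfl
      -- Smoothness lifts the first order expansion through the nilpotent ideal I². The lift sends
      -- xᵢ to Xᵢ plus terms in I² and factors through k[𝔾_(s)], so a relation between the xᵢ there
      -- becomes a relation between the perturbed variables.
      let φ := Algebra.FormallySmooth.lift (I ^ 2) hI θ
      have hφ : ∀ a, φ a - θl a ∈ I ^ 2 := by
        intro a
        rw [← hπ, map_sub, sub_eq_zero]
        exact Algebra.FormallySmooth.mk_lift (I ^ 2) hI θ a
      have hφm : ∀ a, counit (R := k) a = 0 → φ a ∈ I := by
        intro a ha
        rw [← sub_add_cancel (φ a) (θl a)]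
        refine Ideal.add_mem _ (Ideal.pow_le_self two_ne_zero (hφ a)) ?_
        rw [hθl, ha, map_zero, zero_add]
        exact hsum _
      let φ' : FrobeniusKernel k p s R →ₐ[k] TruncRing k p n s :=
        FrobeniusKernel.lift φ fun a ha => TruncRing.pow_eq_zero (hφm a ha)
      refine exists_le_of_mem_truncIdeal (TruncRing.mem_truncIdeal_of_aeval_eq_zero
        (fun i => φ (x i)) (fun i => ?_) _ ?_)
      · have := hφ (x i)
        rw [hθl, hx.counit_eq_zero, hx.apply_coord] at this
        simpa [Pi.single_apply] using this
      · rw [LinearMap.mem_ker, ← aeval_polyOfCoeffs] at hw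
        have := congrArg φ' hw
        rw [map_zero, ← AlgHom.comp_apply, MvPolynomial.comp_aeval] at this
        exact this
    · refine Finsupp.supported_le ?_
      rintro a ⟨i, hi⟩ c
      rw [LinearMap.mem_ker, Finsupp.linearCombination_single,
        ← Finset.mul_prod_erase _ _ (Finset.mem_univ i), ← Nat.add_sub_of_le hi, pow_add,
        FrobeniusKernel.mk_pow_eq_zero k p s R _ (hx.counit_eq_zero i), zero_mul, zero_mul, smul_zero]

end Smooth

/-! ### Nilpotence of the augmentation ideal dual to a unipotent Hopf algebra -/

section UnipotentHopf
variable {K : Type u} [Field K] {S : Type u} [CommRing S] [HopfAlgebra K S]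

/-- The map `s ↦ ∑ s₁ η(s₂)`. -/
noncomputable def rightContract (η : Module.Dual K S) : Module.End K S :=
  (TensorProduct.rid K S).toLinearMap ∘ₗ η.lTensor S ∘ₗ comul

theorem rightContract_repr (η : Module.Dual K S) {s : S} {ι : Type*} (rs : Coalgebra.Repr K s ι) :
    rightContract η s = ∑ i ∈ rs.index, η (rs.right i) • rs.left i := by
  rw [rightContract, LinearMap.comp_apply, LinearMap.comp_apply, ← rs.eq]
  simp

theorem rightContract_counit (s : S) : rightContract (counit (R := K) (A := S)) s = s := by
  simp [rightContract]

theorem rightContract_one (η : Module.Dual K S) : rightContract η 1 = η 1 • 1 := by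
  simp [rightContract, Algebra.TensorProduct.one_def]

theorem rightContract_mul_rightContract (f g : Module.Dual K S) {s t : S} {ι κ : Type*}
    (rs : Coalgebra.Repr K s ι) (rt : Coalgebra.Repr K t κ) :
    rightContract f s * rightContract g t = ∑ i ∈ rs.index, ∑ j ∈ rt.index,
      (f (rs.right i) * g (rt.right j)) • (rs.left i * rt.left j) := by
  rw [rightContract_repr f rs, rightContract_repr g rt, Finset.sum_mul_sum]
  simp only [smul_mul_smul_comm]

section Basis
variable {ι : Type*} [Fintype ι] (e : Module.Basis ι K S)

/-- The coordinates of `s - ε(s)`. -/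
noncomputable def reducedCoord (i : ι) : Module.Dual K S :=
  e.coord i ∘ₗ (LinearMap.id - Algebra.linearMap K S ∘ₗ counit)

theorem reducedCoord_one (i : ι) : reducedCoord e i 1 = 0 := by
  simp [reducedCoord]

theorem sum_reducedCoord (s : S) :
    ∑ i, reducedCoord e i s • e i = s - algebraMap K S (counit (R := K) s) :=
  e.sum_repr _

/-- Write s = ε(s) + (s - ε(s)) and expand the second part in the basis. Read in the dual algebra,
this is the coproduct of η as 1 ⊗ η plus terms whose left factors vanish at 1. -/
theorem dual_mul_eq (η : Module.Dual K S) (s t : S) :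
    η (s * t) = counit (R := K) s * η t +
      ∑ i, reducedCoord e i s * (η ∘ₗ LinearMap.mulLeft K (e i)) t := by
  have h : s * t = counit (R := K) s • t + (∑ i, reducedCoord e i s • e i) * t := by
    rw [sum_reducedCoord, Algebra.smul_def]
    ring
  rw [h, map_add, map_smul, smul_eq_mul, Finset.sum_mul, map_sum]
  simp only [smul_mul_assoc, map_smul, smul_eq_mul]
  rfl

/-- The part `y ↦ η(eᵢ (y - ε(y)))` of the splitting of `η(x y)`. -/
noncomputable def reducedMul (η : Module.Dual K S) (i : ι) : Module.Dual K S :=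
  (η ∘ₗ LinearMap.mulLeft K (e i)) ∘ₗ (LinearMap.id - Algebra.linearMap K S ∘ₗ counit)

theorem reducedMul_one (η : Module.Dual K S) (i : ι) : reducedMul e η i 1 = 0 := by
  simp [reducedMul]

/-- Splitting off the counit from both arguments leaves functionals that vanish at 1 on either side.
Contraction with each of them lowers the degree, so the last term loses degree in both factors. -/
theorem dual_mul_eq_reduced (η : Module.Dual K S) (hη : η 1 = 0) (s t : S) :
    η (s * t) = η s * counit (R := K) t + counit (R := K) s * η t +
      ∑ i, reducedCoord e i s * reducedMul e η i t := by
  have h1 : ∀ i, reducedMul e η i t = (η ∘ₗ LinearMap.mulLeft K (e i)) t -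
      counit (R := K) t * (η ∘ₗ LinearMap.mulLeft K (e i)) 1 := by
    intro i
    rw [reducedMul, LinearMap.comp_apply, LinearMap.sub_apply, map_sub]
    congr 1
    change (η ∘ₗ LinearMap.mulLeft K (e i)) (algebraMap K S (counit (R := K) t)) = _
    rw [Algebra.algebraMap_eq_smul_one, map_smul, smul_eq_mul]
  have h2 := dual_mul_eq e η s 1
  rw [mul_one, hη, mul_zero, zero_add] at h2
  rw [dual_mul_eq e η s t, h2]
  simp only [h1, mul_sub, Finset.sum_sub_distrib, Finset.sum_mul]
  rw [add_comm (∑ i, _) (_ * η t), add_assoc]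
  congr 1
  rw [← add_sub_assoc, add_comm, add_sub_assoc, eq_comm, add_eq_left, sub_eq_zero]
  refine Finset.sum_congr rfl fun i _ => ?_
  ring

theorem rightContract_mul (η : Module.Dual K S) (hη : η 1 = 0) (s t : S) :
    rightContract η (s * t) = rightContract η s * t + s * rightContract η t +
      ∑ i, rightContract (reducedCoord e i) s * rightContract (reducedMul e η i) t := by
  have h1 := rightContract_mul_rightContract η counit (ℛ K s) (ℛ K t)
  have h2 := rightContract_mul_rightContract counit η (ℛ K s) (ℛ K t)
  rw [rightContract_counit] at h1 h2
  rw [h1, h2, rightContract_repr η ((ℛ K s).mul (ℛ K t))]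
  simp only [rightContract_mul_rightContract _ _ (ℛ K s) (ℛ K t)]
  rw [← Finset.sum_add_distrib, Finset.sum_comm (s := Finset.univ) (t := (ℛ K s).index)]
  simp only [Coalgebra.Repr.mul_index, Finset.sum_product, Coalgebra.Repr.mul_left,
    Coalgebra.Repr.mul_right]
  rw [← Finset.sum_add_distrib]
  refine Finset.sum_congr rfl fun a _ => ?_
  rw [Finset.sum_comm (s := Finset.univ), ← Finset.sum_add_distrib, ← Finset.sum_add_distrib]
  refine Finset.sum_congr rfl fun b _ => ?_
  rw [dual_mul_eq_reduced e η hη, add_smul, add_smul, Finset.sum_smul]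

end Basis

variable (K S) in
/-- The ascending filtration of `S` for which functionals which vanish at `1` lower the degree. -/
noncomputable def unipotentFiltration : ℕ → Submodule K S
  | 0 => ⊥
  | w + 1 => ⨅ η : {η : Module.Dual K S // η 1 = 0},
      (unipotentFiltration w).comap (rightContract η.1)

theorem mem_unipotentFiltration_succ {w : ℕ} {s : S} : s ∈ unipotentFiltration K S (w + 1) ↔
    ∀ η : Module.Dual K S, η 1 = 0 → rightContract η s ∈ unipotentFiltration K S w := by
  simp [unipotentFiltration]

theorem unipotentFiltration_mono : Monotone (unipotentFiltration K S) := by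
  refine monotone_nat_of_le_succ fun w => ?_
  induction w with
  | zero => exact bot_le
  | succ w ih =>
    intro s hs
    rw [mem_unipotentFiltration_succ] at hs ⊢
    exact fun η hη => ih (hs η hη)

/-- Induction on a + b: by `rightContract_mul`, contracting a product with η lowers the degree of
the first factor, of the second, or of both. -/
theorem mul_mem_unipotentFiltration [Module.Finite K S] : ∀ (n a b : ℕ), a + b = n → ∀ s t : S,
    s ∈ unipotentFiltration K S a → t ∈ unipotentFiltration K S b →
      s * t ∈ unipotentFiltration K S (a + b) := by
  intro n
  induction n using Nat.strong_induction_on with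
  | _ n ih =>
    intro a b hab s t hs ht
    rcases a with _ | a
    · rw [(Submodule.mem_bot K).1 hs, zero_mul]
      exact Submodule.zero_mem _
    rcases b with _ | b
    · rw [(Submodule.mem_bot K).1 ht, mul_zero]
      exact Submodule.zero_mem _
    have hs' := mem_unipotentFiltration_succ.1 hs
    have ht' := mem_unipotentFiltration_succ.1 ht
    change s * t ∈ unipotentFiltration K S ((a + 1 + b) + 1)
    rw [mem_unipotentFiltration_succ]
    intro η hη
    rw [rightContract_mul (Module.finBasis K S) η hη]
    refine Submodule.add_mem _ (Submodule.add_mem _ ?_ ?_) (Submodule.sum_mem _ fun i _ => ?_)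
    · have := ih (a + (b + 1)) (by omega) a (b + 1) rfl _ _ (hs' η hη) ht
      rwa [show a + 1 + b = a + (b + 1) by omega]
    · exact ih (a + 1 + b) (by omega) (a + 1) b rfl _ _ hs (ht' η hη)
    · refine unipotentFiltration_mono (show a + b ≤ a + 1 + b by omega) ?_
      exact ih (a + b) (by omega) a b rfl _ _ (hs' _ (reducedCoord_one _ i))
        (ht' _ (reducedMul_one _ η i))

/-- The entries of the unitriangular matrix have finite degree and generate the algebra. Finite
degree is preserved by sums and products, and finite dimension makes one bound serve a whole basis.
-/
theorem IsUnipotentHopf.exists_eq_top [Module.Finite K S] (h : IsUnipotentHopf K S) :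
    ∃ w, unipotentFiltration K S w = ⊤ := by
  obtain ⟨n, X, hX1, hX0, hXc, hX⟩ := h.exists_embedding
  have hone : (1 : S) ∈ unipotentFiltration K S 1 := by
    refine mem_unipotentFiltration_succ.2 fun η hη => ?_
    rw [rightContract_one, hη, zero_smul]
    exact Submodule.zero_mem _
  -- The degree is the column index plus one. In ∑ η(X l j) X i l the terms l > j vanish by
  -- triangularity, and the term l = j because X j j = 1 and η 1 = 0; only earlier columns remain.
  have hentry : ∀ (m : ℕ) (i j : Fin n), j.1 = m → X i j ∈ unipotentFiltration K S (m + 1) := by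
    intro m
    induction m using Nat.strong_induction_on with
    | _ m ih =>
      intro i j hj
      refine mem_unipotentFiltration_succ.2 fun η hη => ?_
      have h1 : rightContract η (X i j) = ∑ l, η (X l j) • X i l := by
        rw [rightContract, LinearMap.comp_apply, LinearMap.comp_apply, hXc]
        simp
      rw [h1]
      refine Submodule.sum_mem _ fun l _ => ?_
      rcases lt_trichotomy l j with hl | rfl | hl
      · refine Submodule.smul_mem _ _ (unipotentFiltration_mono ?_ (ih l.1 (by omega) i l rfl))
        omega
      · rw [hX1, hη, zero_smul]
        exact Submodule.zero_mem _
      · rw [hX0 _ _ hl, map_zero, zero_smul]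
        exact Submodule.zero_mem _
  have hall : ∀ s : S, ∃ w, s ∈ unipotentFiltration K S w := by
    intro s
    have hs : s ∈ Algebra.adjoin K {y : S | ∃ i j, y = X i j} := hX ▸ Algebra.mem_top
    induction hs using Algebra.adjoin_induction with
    | mem x hx =>
      obtain ⟨i, j, rfl⟩ := hx
      exact ⟨_, hentry _ i j rfl⟩
    | algebraMap c =>
      refine ⟨1, ?_⟩
      rw [Algebra.algebraMap_eq_smul_one]
      exact Submodule.smul_mem _ _ hone
    | add x y _ _ hx hy =>
      obtain ⟨v, hv⟩ := hx
      obtain ⟨w, hw⟩ := hy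
      exact ⟨max v w, Submodule.add_mem _ (unipotentFiltration_mono (le_max_left v w) hv)
        (unipotentFiltration_mono (le_max_right v w) hw)⟩
    | mul x y _ _ hx hy =>
      obtain ⟨v, hv⟩ := hx
      obtain ⟨w, hw⟩ := hy
      exact ⟨v + w, mul_mem_unipotentFiltration _ v w rfl _ _ hv hw⟩
  choose w hw using hall
  let e := Module.finBasis K S
  refine ⟨Finset.univ.sup fun i => w (e i), ?_⟩
  rw [eq_top_iff, ← e.span_eq, Submodule.span_le]
  rintro _ ⟨i, rfl⟩
  exact unipotentFiltration_mono (Finset.le_sup (f := fun i => w (e i)) (Finset.mem_univ i)) (hw _)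

/-- Each contraction lowers the degree by one. In dual terms, long products of elements of the
augmentation ideal of the group algebra vanish. -/
theorem prod_rightContract_eq_zero {w : ℕ} (hw : unipotentFiltration K S w = ⊤)
    (l : List (Module.Dual K S)) (hl : ∀ η ∈ l, η 1 = 0) (hlw : l.length = w) :
    (l.map rightContract).prod = 0 := by
  have key : ∀ (l : List (Module.Dual K S)), (∀ η ∈ l, η 1 = 0) → ∀ (v : ℕ), ∀ s ∈
      unipotentFiltration K S (v + l.length),
      (l.map rightContract).prod s ∈ unipotentFiltration K S v := by
    intro l
    induction l with
    | nil => intro _ v s hs; simpa using hs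
    | cons η l ih =>
      intro hl v s hs
      rw [List.map_cons, List.prod_cons, Module.End.mul_apply]
      have h1 := ih (fun η h => hl η (List.mem_cons_of_mem _ h)) (v + 1) s (by
        rw [List.length_cons] at hs
        rwa [show v + 1 + l.length = v + (l.length + 1) by omega])
      exact mem_unipotentFiltration_succ.1 h1 η (hl η List.mem_cons_self)
  ext s
  have := key l hl 0 s (by rw [zero_add, hlw, hw]; trivial)
  exact (Submodule.mem_bot K).1 this

end UnipotentHopf

/-! ### Coproducts of elements of π-points -/

section UnipotentElements
variable {k : Type u} [Field k] {H : Type u} [Ring H] [Bialgebra k H]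

variable (k H) in
/-- The coproduct of `K ⊗ H`, with values in `K ⊗ (H ⊗ H)`. -/
noncomputable def baseComul (K : Type u) [Field K] [Algebra k K] : K ⊗[k] H →ₐ[K] K ⊗[k] (H ⊗[k] H) :=
  Algebra.TensorProduct.map (AlgHom.id K K) (Bialgebra.comulAlgHom k H)

variable (k H) in
/-- The map `c ⊗ h ↦ c ⊗ (h ⊗ 1)`. -/
noncomputable def baseLeft (K : Type u) [Field K] [Algebra k K] : K ⊗[k] H →ₐ[K] K ⊗[k] (H ⊗[k] H) :=
  Algebra.TensorProduct.map (AlgHom.id K K) Algebra.TensorProduct.includeLeft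

variable (k H) in
/-- The map `c ⊗ h ↦ c ⊗ (1 ⊗ h)`. -/
noncomputable def baseRight (K : Type u) [Field K] [Algebra k K] : K ⊗[k] H →ₐ[K] K ⊗[k] (H ⊗[k] H) :=
  Algebra.TensorProduct.map (AlgHom.id K K) Algebra.TensorProduct.includeRight

theorem baseComul_tmul (K : Type u) [Field K] [Algebra k K] (c : K) (h : H) :
    baseComul k H K (c ⊗ₜ h) = c ⊗ₜ comul (R := k) h := by
  simp [baseComul]

theorem baseLeft_tmul (K : Type u) [Field K] [Algebra k K] (c : K) (h : H) :
    baseLeft k H K (c ⊗ₜ h) = c ⊗ₜ (h ⊗ₜ 1) := by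
  simp [baseLeft]

theorem baseRight_tmul (K : Type u) [Field K] [Algebra k K] (c : K) (h : H) :
    baseRight k H K (c ⊗ₜ h) = c ⊗ₜ (1 ⊗ₜ h) := by
  simp [baseRight]

/-- The coproduct of `b` is `1 ⊗ b + ∑ i, ηᵢ ⊗ uᵢ` for some `ηᵢ` such that all sufficiently long
products of them vanish. -/
def IsUnipotentElement {K : Type u} [Field K] [Algebra k K] (b : K ⊗[k] H) : Prop :=
  ∃ (n m : ℕ) (η u : Fin n → K ⊗[k] H),
    baseComul k H K b = baseRight k H K b + ∑ i, baseLeft k H K (η i) * baseRight k H K (u i) ∧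
    ∀ l : List (Fin n), l.length = m → (l.map η).prod = 0

theorem isUnipotentElement_zero {K : Type u} [Field K] [Algebra k K] :
    IsUnipotentElement (0 : K ⊗[k] H) :=
  -- The length must be 1 rather than 0: no list of length 1 exists over an empty index set, while
  -- the empty product is 1.
  ⟨0, 1, Fin.elim0, Fin.elim0, by simp, fun l hl => by
    rcases l with _ | ⟨i, l⟩
    · simp at hl
    · exact i.elim0⟩

theorem IsUnipotentElement.map {K Ω : Type u} [Field K] [Algebra k K] [Field Ω] [Algebra k Ω]
    (f : K →ₐ[k] Ω) {b : K ⊗[k] H} (hb : IsUnipotentElement b) :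
    IsUnipotentElement (Algebra.TensorProduct.map f (AlgHom.id k H) b) := by
  obtain ⟨n, m, η, u, h, hη⟩ := hb
  let F := Algebra.TensorProduct.map f (AlgHom.id k H)
  let F₂ := Algebra.TensorProduct.map f (AlgHom.id k (H ⊗[k] H))
  have h1 : ∀ z, F₂ (baseComul k H K z) = baseComul k H Ω (F z) := fun z =>
    map_map_comm (Bialgebra.comulAlgHom k H) f z
  have h2 : ∀ z, F₂ (baseLeft k H K z) = baseLeft k H Ω (F z) := fun z =>
    map_map_comm _ f z
  have h3 : ∀ z, F₂ (baseRight k H K z) = baseRight k H Ω (F z) := fun z =>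
    map_map_comm _ f z
  refine ⟨n, m, fun i => F (η i), fun i => F (u i), ?_, fun l hl => ?_⟩
  · change baseComul k H Ω (F b) = baseRight k H Ω (F b) + _
    rw [← h1, h, map_add, h3, map_sum]
    simp only [map_mul, h2, h3]
  · have := congrArg F (hη l hl)
    rwa [map_list_prod, List.map_map, map_zero] at this

end UnipotentElements

namespace GroupAlg
variable {k : Type u} [Field k] {B : Type u} [CommRing B] [HopfAlgebra k B] [Module.Finite k B]
  {K : Type u} [Field K] [Algebra k K]

/-- The dual basis of a basis of `B`. -/
noncomputable def dualVec (i : Fin (Module.finrank k B)) : GroupAlg k B :=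
  (toDual k B).symm ((Module.finBasis k B).coord i)

theorem sum_dualVec (h : GroupAlg k B) :
    h = ∑ i, toDual k B h (Module.finBasis k B i) • dualVec i := by
  apply (toDual k B).injective
  rw [map_sum]
  simp only [map_smul, dualVec, LinearEquiv.apply_symm_apply]
  exact ((Module.finBasis k B).sum_dual_apply_smul_coord _).symm

theorem tmul_smul_eq {Y : Type u} [AddCommGroup Y] [Module k Y] (c : K) (a : k) (y : Y) :
    c ⊗ₜ[k] (a • y) = (c * algebraMap k K a) • ((1 : K) ⊗ₜ[k] y) := by
  rw [TensorProduct.smul_tmul', smul_eq_mul, mul_one, ← TensorProduct.smul_tmul, Algebra.smul_def,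
    mul_comm]

theorem sum_baseChangeToDual (g : K ⊗[k] GroupAlg k B) :
    g = ∑ i, baseChangeToDual K g (1 ⊗ₜ Module.finBasis k B i) • (1 ⊗ₜ[k] dualVec i) := by
  induction g using TensorProduct.induction_on with
  | zero => simp
  | add x y hx hy =>
    simp only [map_add, LinearMap.add_apply, add_smul, Finset.sum_add_distrib, ← hx, ← hy]
  | tmul c h =>
    conv_lhs => rw [sum_dualVec h, TensorProduct.tmul_sum]
    refine Finset.sum_congr rfl fun i _ => ?_
    rw [baseChangeToDual_tmul, one_mul, tmul_smul_eq]

theorem baseChangeToDual_injective : Function.Injective (baseChangeToDual (k := k) (B := B) K) := by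
  intro g g' h
  rw [sum_baseChangeToDual g, sum_baseChangeToDual g', h]

theorem baseChangeToDual_surjective (ψ : Module.Dual K (K ⊗[k] B)) :
    ∃ g, baseChangeToDual (k := k) (B := B) K g = ψ := by
  refine ⟨∑ i, ψ (1 ⊗ₜ Module.finBasis k B i) • (1 ⊗ₜ[k] dualVec i), ?_⟩
  refine ((Module.finBasis k B).baseChange K).ext fun j => ?_
  rw [Module.Basis.baseChange_apply, map_sum, LinearMap.sum_apply]
  simp only [map_smul, LinearMap.smul_apply, baseChangeToDual_tmul, dualVec,
    LinearEquiv.apply_symm_apply, Module.Basis.coord_apply, Module.Basis.repr_self]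
  simp [Finsupp.single_apply]

variable (k B K) in
/-- `baseChangeToDual` as an equivalence. -/
noncomputable def baseChangeDualEquiv : K ⊗[k] GroupAlg k B ≃ₗ[K] Module.Dual K (K ⊗[k] B) :=
  LinearEquiv.ofBijective (baseChangeToDual K)
    ⟨baseChangeToDual_injective, baseChangeToDual_surjective⟩

/-- The coproduct of `1 ⊗ b`. -/
noncomputable def baseRepr (K : Type u) [Field K] [Algebra k K] {b : B} {ι : Type*}
    (rb : Coalgebra.Repr k b ι) : Coalgebra.Repr K (1 ⊗ₜ[k] b : K ⊗[k] B) ι where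
  index := rb.index
  left i := 1 ⊗ₜ rb.left i
  right i := 1 ⊗ₜ rb.right i
  eq := by
    rw [TensorProduct.comul_tmul, ← rb.eq, TensorProduct.tmul_sum, map_sum]
    simp

theorem baseChangeToDual_mul (g g' : K ⊗[k] GroupAlg k B) {b : B} {ι : Type*}
    (rb : Coalgebra.Repr k b ι) : baseChangeToDual K (g * g') (1 ⊗ₜ b) = ∑ i ∈ rb.index,
      baseChangeToDual K g (1 ⊗ₜ rb.left i) * baseChangeToDual K g' (1 ⊗ₜ rb.right i) := by
  induction g using TensorProduct.induction_on with
  | zero => simp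
  | add x y hx hy => simp only [add_mul, map_add, LinearMap.add_apply, hx, hy, Finset.sum_add_distrib]
  | tmul c h =>
    induction g' using TensorProduct.induction_on with
    | zero => simp
    | add x y hx hy =>
      simp only [mul_add, map_add, LinearMap.add_apply, hx, hy, Finset.sum_add_distrib]
    | tmul c' h' =>
      rw [Algebra.TensorProduct.tmul_mul_tmul, baseChangeToDual_tmul, toDual_mul _ _ rb, map_sum,
        Finset.mul_sum, Finset.mul_sum]
      refine Finset.sum_congr rfl fun i _ => ?_
      rw [baseChangeToDual_tmul, baseChangeToDual_tmul, map_mul]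
      ring

variable (k B) in
/-- Evaluation of the elements of `K ⊗ (kG ⊗ kG)` at `b ⊗ b'`. -/
noncomputable def basePairing (K : Type u) [Field K] [Algebra k K] (b b' : B) :
    K ⊗[k] (GroupAlg k B ⊗[k] GroupAlg k B) →ₗ[K] K :=
  (TensorProduct.AlgebraTensorModule.rid k K K).toLinearMap ∘ₗ
    LinearMap.baseChange K (LinearMap.applyₗ (b ⊗ₜ[k] b') ∘ₗ (pairing k B).toLinearMap)

theorem basePairing_tmul (b b' : B) (c : K) (z : GroupAlg k B ⊗[k] GroupAlg k B) :
    basePairing k B K b b' (c ⊗ₜ z) = c * algebraMap k K (pairing k B z (b ⊗ₜ b')) := by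
  simp [basePairing, Algebra.smul_def, mul_comm]

theorem ext_basePairing {z w : K ⊗[k] (GroupAlg k B ⊗[k] GroupAlg k B)}
    (h : ∀ b b', basePairing k B K b b' z = basePairing k B K b b' w) : z = w := by
  have key : ∀ z : K ⊗[k] (GroupAlg k B ⊗[k] GroupAlg k B), z = ∑ i, ∑ j,
      basePairing k B K (Module.finBasis k B i) (Module.finBasis k B j) z •
        (1 ⊗ₜ[k] (dualVec i ⊗ₜ[k] dualVec j)) := by
    intro z
    induction z using TensorProduct.induction_on with
    | zero => simp
    | add x y hx hy => simp only [map_add, add_smul, Finset.sum_add_distrib, ← hx, ← hy]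
    | tmul c y =>
      induction y using TensorProduct.induction_on with
      | zero => simp
      | add x y hx hy =>
        simp only [TensorProduct.tmul_add, map_add, add_smul, Finset.sum_add_distrib, ← hx, ← hy]
      | tmul f g =>
        conv_lhs => rw [sum_dualVec f, sum_dualVec g, TensorProduct.sum_tmul, TensorProduct.tmul_sum]
        refine Finset.sum_congr rfl fun i _ => ?_
        rw [TensorProduct.tmul_sum, TensorProduct.tmul_sum]
        refine Finset.sum_congr rfl fun j _ => ?_
        rw [basePairing_tmul, pairing_tmul, TensorProduct.smul_tmul_smul, tmul_smul_eq]
  rw [key z, key w]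
  simp only [h]

theorem basePairing_baseComul (b b' : B) (g : K ⊗[k] GroupAlg k B) :
    basePairing k B K b b' (baseComul k _ K g) = baseChangeToDual K g (1 ⊗ₜ (b * b')) := by
  induction g using TensorProduct.induction_on with
  | zero => simp
  | add x y hx hy => simp only [map_add, LinearMap.add_apply, hx, hy]
  | tmul c h =>
    rw [baseComul_tmul, basePairing_tmul, pairing_comul, baseChangeToDual_tmul, one_mul]
    rfl

theorem basePairing_baseLeft_mul_baseRight (b b' : B) (g g' : K ⊗[k] GroupAlg k B) :
    basePairing k B K b b' (baseLeft k _ K g * baseRight k _ K g') =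
      baseChangeToDual K g (1 ⊗ₜ b) * baseChangeToDual K g' (1 ⊗ₜ b') := by
  induction g using TensorProduct.induction_on with
  | zero => simp
  | add x y hx hy => simp only [map_add, add_mul, LinearMap.add_apply, hx, hy]
  | tmul c h =>
    induction g' using TensorProduct.induction_on with
    | zero => simp
    | add x y hx hy => simp only [map_add, mul_add, LinearMap.add_apply, hx, hy]
    | tmul c' h' =>
      rw [baseLeft_tmul, baseRight_tmul, Algebra.TensorProduct.tmul_mul_tmul,
        Algebra.TensorProduct.tmul_mul_tmul, mul_one, one_mul, basePairing_tmul, pairing_tmul,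
        baseChangeToDual_tmul, baseChangeToDual_tmul, map_mul]
      ring

theorem baseChangeToDual_one (b : B) :
    baseChangeToDual K (1 : K ⊗[k] GroupAlg k B) (1 ⊗ₜ b) = algebraMap k K (counit (R := k) b) := by
  rw [Algebra.TensorProduct.one_def, baseChangeToDual_tmul, toDual_one, one_mul, one_mul]

theorem basePairing_baseRight (b b' : B) (g : K ⊗[k] GroupAlg k B) :
    basePairing k B K b b' (baseRight k _ K g) =
      algebraMap k K (counit (R := k) b) * baseChangeToDual K g (1 ⊗ₜ b') := by
  have := basePairing_baseLeft_mul_baseRight b b' 1 g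
  rwa [map_one, one_mul, baseChangeToDual_one] at this

section Pullback
variable {S : Type u} [CommRing S] [HopfAlgebra K S] (π : K ⊗[k] B →ₐc[K] S)

/-- The element of `K ⊗ kG` which corresponds to a functional on a quotient `S` of `K ⊗ B`. -/
noncomputable def pullback (η : Module.Dual K S) : K ⊗[k] GroupAlg k B :=
  (baseChangeDualEquiv k B K).symm (η ∘ₗ (π : K ⊗[k] B →ₗ[K] S))

theorem baseChangeToDual_pullback (η : Module.Dual K S) (y : K ⊗[k] B) :
    baseChangeToDual K (pullback π η) y = η (π y) :=
  LinearMap.congr_fun ((baseChangeDualEquiv k B K).apply_symm_apply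
    (η ∘ₗ (π : K ⊗[k] B →ₗ[K] S))) y

theorem ext_baseChangeToDual {g g' : K ⊗[k] GroupAlg k B}
    (h : ∀ b : B, baseChangeToDual K g (1 ⊗ₜ b) = baseChangeToDual K g' (1 ⊗ₜ b)) : g = g' := by
  apply baseChangeToDual_injective
  refine ((Module.finBasis k B).baseChange K).ext fun j => ?_
  rw [Module.Basis.baseChange_apply, h]

theorem counit_apply_one_tmul (b : B) :
    counit (R := K) (π (1 ⊗ₜ b)) = algebraMap k K (counit (R := k) b) := by
  rw [CoalgHomClass.counit_comp_apply, TensorProduct.counit_tmul, Algebra.smul_def]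
  simp

theorem pullback_counit : pullback π (counit (R := K) (A := S)) = 1 := by
  refine ext_baseChangeToDual fun b => ?_
  rw [baseChangeToDual_pullback, baseChangeToDual_one, counit_apply_one_tmul]

/-- Convolution is (η η')(s) = η(∑ s₁ η'(s₂)). Expressing the second factor by `rightContract` turns
products of functionals into compositions of operators on S, to which the unipotent filtration
applies. -/
theorem pullback_mul (η η' : Module.Dual K S) :
    pullback π η * pullback π η' = pullback π (η ∘ₗ rightContract η') := by
  refine ext_baseChangeToDual fun b => ?_
  have h1 : comul (R := K) (π (1 ⊗ₜ b)) = ∑ i ∈ (ℛ k b).index,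
      π (1 ⊗ₜ (ℛ k b).left i) ⊗ₜ[K] π (1 ⊗ₜ (ℛ k b).right i) := by
    rw [← CoalgHomClass.map_comp_comul_apply, ← (baseRepr K (ℛ k b)).eq, map_sum]
    rfl
  rw [baseChangeToDual_mul _ _ (ℛ k b), baseChangeToDual_pullback, LinearMap.comp_apply,
    rightContract_repr η' ⟨(ℛ k b).index, _, _, h1.symm⟩, map_sum]
  refine Finset.sum_congr rfl fun i _ => ?_
  rw [baseChangeToDual_pullback, baseChangeToDual_pullback, map_smul, smul_eq_mul, mul_comm]

theorem pullback_mul_prod (l : List (Module.Dual K S)) (η : Module.Dual K S) :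
    pullback π η * (l.map (pullback π)).prod = pullback π (η ∘ₗ (l.map rightContract).prod) := by
  induction l generalizing η with
  | nil => simp [Module.End.one_eq_id]
  | cons η' l ih =>
    rw [List.map_cons, List.map_cons, List.prod_cons, List.prod_cons, ← mul_assoc, pullback_mul, ih,
      LinearMap.comp_assoc]
    rfl

end Pullback
end GroupAlg

open GroupAlg in
-- The value of β is a functional θ on S = K[C]. Splitting θ(s t) along a basis of S gives the
-- coproduct, with left factors ηᵢ in the augmentation ideal of KC. That ideal is nilpotent since C
-- is unipotent, and w bounds the length of nonzero products.
theorem IsPiPoint.isUnipotentElement {k : Type u} [Field k] {B : Type u} [CommRing B]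
    [HopfAlgebra k B] [Module.Finite k B] {p : ℕ} {K : Type u} [Field K] [Algebra k K]
    {β : TruncPoly K p →ₐ[K] K ⊗[k] GroupAlg k B} (hβ : IsPiPoint β) (x : TruncPoly K p) :
    IsUnipotentElement (β x) := by
  obtain ⟨S, _, _, π, hπ, _, hS, hθ⟩ := hβ.factors
  obtain ⟨θ, hθ⟩ := hθ x
  have : Module.Finite K S := Module.Finite.of_surjective (π : K ⊗[k] B →ₗ[K] S) hπ
  obtain ⟨w, hw⟩ := hS.exists_eq_top
  let e := Module.finBasis K S
  refine ⟨_, w, fun i => pullback π (reducedCoord e i),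
    fun i => pullback π (θ ∘ₗ LinearMap.mulLeft K (e i)), ?_, fun l hl => ?_⟩
  · refine ext_basePairing fun b b' => ?_
    rw [basePairing_baseComul, map_add, basePairing_baseRight, map_sum, hθ, hθ]
    simp only [basePairing_baseLeft_mul_baseRight, baseChangeToDual_pullback]
    have h1 : (1 ⊗ₜ[k] (b * b') : K ⊗[k] B) = 1 ⊗ₜ b * 1 ⊗ₜ b' := by simp
    rw [h1, map_mul, dual_mul_eq e, counit_apply_one_tmul]
  -- The counit is the unit of the dual algebra, so starting from it yields the bare product of the
  -- ηᵢ.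
  · have h1 := pullback_mul_prod π (l.map (reducedCoord e)) counit
    rw [pullback_counit, one_mul, List.map_map] at h1
    change (l.map (pullback π ∘ reducedCoord e)).prod = 0
    rw [h1, prod_rightContract_eq_zero hw, LinearMap.comp_zero]
    · rw [pullback, LinearMap.zero_comp, map_zero]
    · intro η hη
      obtain ⟨i, _, rfl⟩ := List.mem_map.1 hη
      exact reducedCoord_one e i
    · rw [List.length_map, hl]

/-! ### Equivariance and invariants of the coadjoint action -/

section CoadjointAction
open WithConv Algebra.TensorProduct
variable {k : Type u} [Field k] {A A' B : Type u} [CommRing A] [HopfAlgebra k A]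
  [CommRing A'] [HopfAlgebra k A'] [CommRing B] [HopfAlgebra k B]

/-- Homomorphisms of group schemes commute with conjugation. The one point to check is compatibility
with inverses, obtained from uniqueness of inverses in the convolution monoid. -/
theorem conjHom_comp {C : Type u} [CommRing C] [Algebra k C] (φ : A →ₐc[k] A')
    (g x : A' →ₐ[k] C) : (conjHom g x).comp (φ : A →ₐ[k] A') =
      conjHom (g.comp (φ : A →ₐ[k] A')) (x.comp (φ : A →ₐ[k] A')) := by
  have hmul : ∀ f f' : WithConv (A' →ₐ[k] C), toConv ((f * f').ofConv.comp (φ : A →ₐ[k] A')) =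
      toConv (f.ofConv.comp (φ : A →ₐ[k] A')) * toConv (f'.ofConv.comp (φ : A →ₐ[k] A')) := by
    intro f f'
    rw [AlgHom.convMul_comp_bialgHom_distrib]
  have hone : toConv ((1 : WithConv (A' →ₐ[k] C)).ofConv.comp (φ : A →ₐ[k] A')) = 1 := by
    apply WithConv.ext
    ext y
    simp [AlgHom.convOne_def, Algebra.ofId_apply]
  have hinv : toConv ((g.comp (HopfAlgebra.antipodeAlgHom k A')).comp (φ : A →ₐ[k] A')) =
      toConv ((g.comp (φ : A →ₐ[k] A')).comp (HopfAlgebra.antipodeAlgHom k A)) := by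
    refine left_inv_eq_right_inv (a := toConv (g.comp (φ : A →ₐ[k] A'))) ?_ (conv_mul_inv _)
    have := hmul (toConv (g.comp (HopfAlgebra.antipodeAlgHom k A'))) (toConv g)
    rw [conv_inv_mul, hone] at this
    exact this.symm
  apply WithConv.toConv_injective
  rw [conjHom, hmul, hmul]
  exact congrArg (· * _ * _) hinv

theorem conjHom_of_one {C : Type u} [CommRing C] [Algebra k C] (g : A →ₐ[k] C) :
    conjHom g (1 : WithConv (A →ₐ[k] C)).ofConv = (1 : WithConv (A →ₐ[k] C)).ofConv := by
  rw [conjHom, toConv_ofConv, mul_one, conv_inv_mul]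

theorem map_contract (f : A →ₗ[k] A') (z : A ⊗[k] B) (h : GroupAlg k B) :
    f (contract z h) = contract (f.rTensor B z) h := by
  induction z using TensorProduct.induction_on with
  | zero => rw [map_zero, contract_zero, map_zero, contract_zero]
  | add x y hx hy => rw [contract_add, map_add, map_add, contract_add, hx, hy]
  | tmul a b => rw [contract_tmul, map_smul, LinearMap.rTensor_tmul, contract_tmul]

theorem contract_tmul_one_mul (a : A) (z : A ⊗[k] B) (h : GroupAlg k B) :
    contract (a ⊗ₜ 1 * z) h = a * contract z h := by
  induction z using TensorProduct.induction_on with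
  | zero => rw [mul_zero, contract_zero, mul_zero]
  | add x y hx hy => rw [mul_add, contract_add, contract_add, hx, hy, mul_add]
  | tmul c b =>
    rw [Algebra.TensorProduct.tmul_mul_tmul, one_mul, contract_tmul, contract_tmul, mul_smul_comm]

/-- Makes the restriction k[𝔾_(r+2)] → k[𝔾_(r+1)] equivariant, so that the actions on the two
algebras can be compared. -/
theorem coadjointAct_comp (φ : A →ₐc[k] A') (π : A' →ₐc[k] B) (h : GroupAlg k B) (y : A) :
    φ (coadjointAct (π.comp φ) h y) = coadjointAct π h (φ y) := by
  rw [coadjointAct_apply, coadjointAct_apply]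
  have h1 : (Algebra.TensorProduct.map (φ : A →ₐ[k] A') (AlgHom.id k B)).comp
      (conjCoaction ((π.comp φ : A →ₐc[k] B) : A →ₐ[k] B)) =
        (conjCoaction (π : A' →ₐ[k] B)).comp (φ : A →ₐ[k] A') := by
    rw [conjCoaction, conjCoaction, comp_conjHom, conjHom_comp]
    congr 1 <;> ext <;> simp
  have h2 := DFunLike.congr_fun h1 y
  exact (map_contract (φ : A →ₗ[k] A') _ h).trans (congrArg (contract · h) h2)

/-- Conjugation fixes the identity element, so evaluation there is an invariant functional. It later
provides the projection of k[𝔾_(r+1)] ⊗ V onto V. -/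
theorem counit_coadjointAct [Module.Finite k B] (π : A →ₐc[k] B) (h : GroupAlg k B) (y : A) :
    counit (R := k) (coadjointAct π h y) = counit (R := k) h * counit (R := k) y := by
  have h1 : (Algebra.TensorProduct.map (Bialgebra.counitAlgHom k A) (AlgHom.id k B)).comp
      (conjCoaction (π : A →ₐ[k] B)) = (1 : WithConv (A →ₐ[k] k ⊗[k] B)).ofConv := by
    rw [conjCoaction, comp_conjHom]
    have h2 : (Algebra.TensorProduct.map (Bialgebra.counitAlgHom k A) (AlgHom.id k B)).comp
        includeLeft = (1 : WithConv (A →ₐ[k] k ⊗[k] B)).ofConv := by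
      ext x
      simp [AlgHom.convOne_def, Algebra.ofId_apply]
    rw [h2, conjHom_of_one]
  have h3 := DFunLike.congr_fun h1 y
  have key : ∀ z : A ⊗[k] B, counit (R := k) (contract z h) = (TensorProduct.rid k k)
      ((GroupAlg.toDual k B h).lTensor k
        (Algebra.TensorProduct.map (Bialgebra.counitAlgHom k A) (AlgHom.id k B) z)) := by
    intro z
    induction z using TensorProduct.induction_on with
    | zero => simp [contract_zero]
    | add x y hx hy => rw [contract_add, map_add, hx, hy, map_add, map_add, map_add]
    | tmul a b => simp [contract_tmul]
  rw [coadjointAct_apply, key]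
  refine (congrArg (fun w => (TensorProduct.rid k k) ((GroupAlg.toDual k B h).lTensor k w)) h3).trans ?_
  simp [AlgHom.convOne_def, Algebra.ofId_apply, GroupAlg.counit_apply]

theorem coadjointAct_one [Module.Finite k B] (π : A →ₐc[k] B) (h : GroupAlg k B) :
    coadjointAct π h 1 = counit (R := k) h • 1 := by
  rw [← Algebra.algebraMap_eq_smul_one]
  exact (coadjointModuleAlgebra π).act_one h

/-- On 𝔾_(r) every p^r-th power of a function is constant. By `pow_tensor` the coaction of x^(p^r)
therefore has trivial second factor, and the counit axiom identifies its first factor as x^(p^r). -/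
theorem coadjointAct_pow_mul {p r : ℕ} [Fact p.Prime] [CharP k p] {R : Type u} [CommRing R]
    [HopfAlgebra k R] (π : A →ₐc[k] FrobeniusKernel k p r R)
    (h : GroupAlg k (FrobeniusKernel k p r R)) (x y : A) :
    coadjointAct π h (x ^ p ^ r * y) = x ^ p ^ r * coadjointAct π h y := by
  rw [coadjointAct_apply, map_mul, map_pow, pow_tensor]
  have h1 := DFunLike.congr_fun (conjCoaction_counit (π : A →ₐ[k] FrobeniusKernel k p r R)
    (by simp)) x
  rw [coadjointAct_apply, contract_tmul_one_mul]
  congr 2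

end CoadjointAction

/-! ### Diagonal actions on tensor products -/

section DiagonalAction
variable {k : Type u} [Field k] {K : Type u} [Field K] [Algebra k K]
  {A A' V H : Type u} [AddCommGroup A] [Module k A] [AddCommGroup A'] [Module k A']
  [AddCommGroup V] [Module k V] [Ring H] [Bialgebra k H]
  (act : H →ₐ[k] Module.End k A) (act' : H →ₐ[k] Module.End k A')
  (σ : K ⊗[k] H →ₐ[k] Module.End k V)

/-- The action of `K ⊗ (H ⊗ H)` on `A ⊗ V`, through the action of `H` on `A` on the left and the
action of `K ⊗ H` on `V` on the right. -/
noncomputable def diagRep : K ⊗[k] (H ⊗[k] H) →ₐ[k] Module.End k (A ⊗[k] V) :=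
  (Module.endTensorEndAlgHom (R := k) (S := k) (A := k) (M := A) (N := V)).comp
    ((Algebra.TensorProduct.map act σ).comp
      (Algebra.TensorProduct.leftComm k K H H).toAlgHom)

theorem diagRep_tmul (c : K) (h h' : H) (a : A) (v : V) :
    diagRep act σ (c ⊗ₜ (h ⊗ₜ h')) (a ⊗ₜ v) = act h a ⊗ₜ σ (c ⊗ₜ h') v := rfl

@[elab_as_elim]
theorem tensor₃_induction {H' : Type u} [AddCommGroup H'] [Module k H']
    {P : K ⊗[k] (H ⊗[k] H') → Prop} (h0 : P 0)
    (ha : ∀ x y, P x → P y → P (x + y)) (ht : ∀ c h h', P (c ⊗ₜ (h ⊗ₜ h')))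
    (w : K ⊗[k] (H ⊗[k] H')) : P w := by
  induction w using TensorProduct.induction_on with
  | zero => exact h0
  | add x y hx hy => exact ha _ _ hx hy
  | tmul c z =>
    induction z using TensorProduct.induction_on with
    | zero => rwa [TensorProduct.tmul_zero]
    | add x y hx hy => rw [TensorProduct.tmul_add]; exact ha _ _ hx hy
    | tmul h h' => exact ht c h h'

theorem diagRep_baseRight (g : K ⊗[k] H) :
    diagRep act σ (baseRight k H K g) = (σ g).lTensor A := by
  induction g using TensorProduct.induction_on with
  | zero => simp
  | add x y hx hy => simp only [map_add, LinearMap.lTensor_add, hx, hy]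
  | tmul c h =>
    ext a v
    rw [baseRight_tmul]
    simp [diagRep_tmul]

theorem commute_lTensor_diagRep (f : Module.End k V) (hf : ∀ g, Commute f (σ g))
    (w : K ⊗[k] (H ⊗[k] H)) :
    Commute (f.lTensor A : Module.End k (A ⊗[k] V)) (diagRep act σ w) := by
  induction w using tensor₃_induction with
  | h0 => rw [map_zero]; exact Commute.zero_right (G₀ := Module.End k (A ⊗[k] V)) _
  | ha x y hx hy => rw [map_add]; exact Commute.add_right (R := Module.End k (A ⊗[k] V)) hx hy
  | ht c h h' =>
    change _ * _ = _ * _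
    ext a v
    have := LinearMap.congr_fun (hf (c ⊗ₜ h')).eq v
    simp only [Module.End.mul_apply] at this
    simp [diagRep_tmul, this]

theorem commute_rTensor_diagRep (f : Module.End k A) (hf : ∀ h, Commute f (act h))
    (w : K ⊗[k] (H ⊗[k] H)) :
    Commute (f.rTensor V : Module.End k (A ⊗[k] V)) (diagRep act σ w) := by
  induction w using tensor₃_induction with
  | h0 => rw [map_zero]; exact Commute.zero_right (G₀ := Module.End k (A ⊗[k] V)) _
  | ha x y hx hy => rw [map_add]; exact Commute.add_right (R := Module.End k (A ⊗[k] V)) hx hy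
  | ht c h h' =>
    change _ * _ = _ * _
    ext a v
    have := LinearMap.congr_fun (hf h).eq a
    simp only [Module.End.mul_apply] at this
    simp [diagRep_tmul, this]

variable {act act'} in
theorem rTensor_diagRep (φ : A →ₗ[k] A') (hφ : ∀ h a, φ (act h a) = act' h (φ a))
    (w : K ⊗[k] (H ⊗[k] H)) (z : A ⊗[k] V) :
    φ.rTensor V (diagRep act σ w z) = diagRep act' σ w (φ.rTensor V z) := by
  induction w using tensor₃_induction with
  | h0 => simp
  | ha x y hx hy => simp only [map_add, LinearMap.add_apply, hx, hy]
  | ht c h h' =>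
    induction z using TensorProduct.induction_on with
    | zero => simp
    | add x y hx hy => simp only [map_add, hx, hy]
    | tmul a v => simp [diagRep_tmul, hφ]

variable (k H K) in
/-- The map `c ⊗ (h ⊗ h') ↦ ε(h) c ⊗ h'`. -/
noncomputable def baseCounit : K ⊗[k] (H ⊗[k] H) →ₗ[k] K ⊗[k] H :=
  ((TensorProduct.lid k H).toLinearMap ∘ₗ counit.rTensor H).lTensor K

theorem baseCounit_tmul (c : K) (h h' : H) :
    baseCounit k K H (c ⊗ₜ (h ⊗ₜ h')) = c ⊗ₜ (counit (R := k) h • h') := by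
  simp [baseCounit]

theorem baseCounit_baseComul (g : K ⊗[k] H) : baseCounit k K H (baseComul k H K g) = g := by
  induction g using TensorProduct.induction_on with
  | zero => simp
  | add x y hx hy => simp only [map_add, hx, hy]
  | tmul c h => simp [baseComul_tmul, baseCounit]

/-- On an invariant vector the left tensor factor acts through the counit. Applied to a coproduct,
where the counit axiom gives back the original element, this makes v ↦ e ⊗ v equivariant. -/
theorem diagRep_tmul_of_invariant (e : A) (he : ∀ h, act h e = counit (R := k) h • e)
    (w : K ⊗[k] (H ⊗[k] H)) (v : V) :
    diagRep act σ w (e ⊗ₜ v) = e ⊗ₜ σ (baseCounit k K H w) v := by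
  induction w using tensor₃_induction with
  | h0 => simp
  | ha x y hx hy => simp only [map_add, LinearMap.add_apply, hx, hy, TensorProduct.tmul_add]
  | ht c h h' =>
    have h1 : σ (c ⊗ₜ (counit (R := k) h • h')) = counit (R := k) h • σ (c ⊗ₜ h') := by
      rw [TensorProduct.tmul_smul]
      exact map_smul σ _ _
    rw [diagRep_tmul, baseCounit_tmul, he, TensorProduct.smul_tmul, h1]
    rfl

/-- The dual statement: an invariant functional ε makes a ⊗ v ↦ ε(a) v equivariant. -/
theorem lid_rTensor_diagRep (ε : A →ₗ[k] k) (hε : ∀ h a, ε (act h a) = counit (R := k) h * ε a)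
    (w : K ⊗[k] (H ⊗[k] H)) (z : A ⊗[k] V) :
    TensorProduct.lid k V (ε.rTensor V (diagRep act σ w z)) =
      σ (baseCounit k K H w) (TensorProduct.lid k V (ε.rTensor V z)) := by
  induction w using tensor₃_induction with
  | h0 => simp
  | ha x y hx hy => simp only [map_add, LinearMap.add_apply, hx, hy]
  | ht c h h' =>
    induction z using TensorProduct.induction_on with
    | zero => simp
    | add x y hx hy => simp only [map_add, hx, hy]
    | tmul a v =>
      have h1 : σ (c ⊗ₜ (counit (R := k) h • h')) = counit (R := k) h • σ (c ⊗ₜ h') := by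
        rw [TensorProduct.tmul_smul]
        exact map_smul σ _ _
      rw [diagRep_tmul, baseCounit_tmul, LinearMap.rTensor_tmul, LinearMap.rTensor_tmul,
        TensorProduct.lid_tmul, TensorProduct.lid_tmul, hε, h1, mul_smul, LinearMap.smul_apply,
        map_smul, smul_comm]

end DiagonalAction

/-! ### Representations of smash products on tensor products -/

namespace SmashProduct
variable {k : Type u} [Field k] {A H : Type u} [Ring A] [Algebra k A] [Ring H] [Bialgebra k H]
  [LeftModuleAlgebra k A H] {N : Type u} [AddCommGroup N] [Module k N] (σ : H →ₐ[k] Module.End k N)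

variable (A) in
/-- The diagonal action of `H` on `A ⊗ N`. -/
noncomputable def diagonal : H →ₐ[k] Module.End k (A ⊗[k] N) :=
  (Module.endTensorEndAlgHom (R := k) (S := k) (A := k) (M := A) (N := N)).comp
    ((Algebra.TensorProduct.map (LeftModuleAlgebra.act (k := k) (A := A)) σ).comp
      (Bialgebra.comulAlgHom k H))

theorem diagonal_tmul {h : H} {ι : Type*} (rh : Coalgebra.Repr k h ι) (a : A) (n : N) :
    diagonal A σ h (a ⊗ₜ n) = ∑ i ∈ rh.index,
      LeftModuleAlgebra.act (k := k) (rh.left i) a ⊗ₜ σ (rh.right i) n := by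
  change Module.endTensorEndAlgHom (R := k) (S := k) (A := k) (M := A) (N := N)
    (Algebra.TensorProduct.map (LeftModuleAlgebra.act (k := k) (A := A)) σ (comul (R := k) h))
      (a ⊗ₜ n) = _
  rw [← rh.eq, map_sum, map_sum, LinearMap.sum_apply]
  rfl

/-- The rule h(f z) = ∑ h₁(f) h₂(z), which is the commutation relation of the smash product. It
combines the module algebra law with coassociativity. -/
theorem diagonal_mul_tmul (h : H) (f : A) (z : A ⊗[k] N) {ι : Type*}
    (rh : Coalgebra.Repr k h ι) :
    diagonal A σ h ((LinearMap.mulLeft k f).rTensor N z) = ∑ i ∈ rh.index,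
      (LinearMap.mulLeft k (LeftModuleAlgebra.act (k := k) (rh.left i) f)).rTensor N
        (diagonal A σ (rh.right i) z) := by
  induction z using TensorProduct.induction_on with
  | zero => simp
  | add x y hx hy => simp only [map_add, hx, hy, Finset.sum_add_distrib]
  | tmul a n =>
    rw [LinearMap.rTensor_tmul, LinearMap.mulLeft_apply, diagonal_tmul σ rh]
    have hl : ∀ i ∈ rh.index, (LeftModuleAlgebra.act (k := k) (rh.left i) (f * a) ⊗ₜ[k]
        σ (rh.right i) n : A ⊗[k] N) = ∑ j ∈ (ℛ k (rh.left i)).index,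
          (LeftModuleAlgebra.act (k := k) ((ℛ k (rh.left i)).left j) f *
            LeftModuleAlgebra.act (k := k) ((ℛ k (rh.left i)).right j) a) ⊗ₜ σ (rh.right i) n := by
      intro i _
      rw [act_mul_repr _ _ _ (ℛ k (rh.left i)), TensorProduct.sum_tmul]
    have hr : ∀ i ∈ rh.index, (LinearMap.mulLeft k
        (LeftModuleAlgebra.act (k := k) (rh.left i) f)).rTensor N
          (diagonal A σ (rh.right i) (a ⊗ₜ n)) = ∑ j ∈ (ℛ k (rh.right i)).index,
            (LeftModuleAlgebra.act (k := k) (rh.left i) f *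
              LeftModuleAlgebra.act (k := k) ((ℛ k (rh.right i)).left j) a) ⊗ₜ
                σ ((ℛ k (rh.right i)).right j) n := by
      intro i _
      rw [diagonal_tmul σ (ℛ k (rh.right i)), map_sum]
      rfl
    rw [Finset.sum_congr rfl hl, Finset.sum_congr rfl hr]
    have := Coalgebra.sum_tmul_tmul_eq rh (fun i => ℛ k (rh.left i)) (fun i => ℛ k (rh.right i))
    let L := (LeftModuleAlgebra.act (k := k) (A := A) (H := H)).toLinearMap
    let F : H ⊗[k] (H ⊗[k] H) →ₗ[k] A ⊗[k] N :=
      (LinearMap.mul' k A).rTensor N ∘ₗ (TensorProduct.assoc k A A N).symm.toLinearMap ∘ₗ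
        TensorProduct.map (L.flip f)
          (TensorProduct.map (L.flip a) (σ.toLinearMap.flip n))
    have h2 := congrArg F this
    simp only [map_sum] at h2
    exact h2

/-- The linear map of `SmashProduct.rep`. -/
noncomputable def repLinear : SmashProduct k A H →ₗ[k] Module.End k (A ⊗[k] N) :=
  (TensorProduct.lift (LinearMap.mk₂ k (fun (f : A) (h : H) =>
      ((LinearMap.mulLeft k f).rTensor N * diagonal A σ h : Module.End k (A ⊗[k] N)))
    (fun f f' h => by
      rw [← add_mul, ← LinearMap.rTensor_add]
      congr 2
      ext; simp [add_mul])
    (fun c f h => by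
      rw [← smul_mul_assoc, ← LinearMap.rTensor_smul]
      congr 2
      ext; simp)
    (fun f h h' => by rw [map_add, mul_add])
    (fun c f h => by rw [map_smul, mul_smul_comm])) : A ⊗[k] H →ₗ[k] Module.End k (A ⊗[k] N))

theorem repLinear_tmul (f : A) (h : H) (z : A ⊗[k] N) : repLinear σ (tmul f h) z =
    (LinearMap.mulLeft k f).rTensor N (diagonal A σ h z) := rfl

/-- The representation of `A # H` on `A ⊗ N`, for an `H`-module `N`, in which `A` acts by
multiplication and `H` diagonally. -/
noncomputable def rep : SmashProduct k A H →ₐ[k] Module.End k (A ⊗[k] N) :=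
  AlgHom.ofLinearMap (repLinear σ)
    (by
      refine LinearMap.ext fun z => ?_
      refine (repLinear_tmul σ 1 1 z).trans ?_
      rw [LinearMap.mulLeft_one, LinearMap.rTensor_id, map_one]
      rfl)
    (by
      intro x y
      refine LinearMap.ext fun z => ?_
      induction x using induction with
      | h0 => simp
      | ha x x' hx hx' => rw [add_mul, map_add, map_add, LinearMap.add_apply, hx, hx', add_mul]; rfl
      | ht f h =>
        induction y using induction with
        | h0 => simp
        | ha x x' hx hx' => rw [mul_add, map_add, map_add, LinearMap.add_apply, hx, hx', mul_add]; rfl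
        | ht f' h' =>
          rw [tmul_mul_tmul f f' h h' (ℛ k h), map_sum, LinearMap.sum_apply, Module.End.mul_apply,
            repLinear_tmul, repLinear_tmul, diagonal_mul_tmul σ _ _ _ (ℛ k h), map_sum]
          refine Finset.sum_congr rfl fun i _ => ?_
          rw [repLinear_tmul, map_mul, LinearMap.mulLeft_mul, LinearMap.rTensor_comp]
          rfl)

theorem rep_tmul (f : A) (h : H) (z : A ⊗[k] N) : rep σ (tmul f h) z =
    (LinearMap.mulLeft k f).rTensor N (diagonal A σ h z) := rfl

end SmashProduct

section QuotientRep
variable {k : Type u} [Field k] {E : Type u} [Ring E] [Algebra k E] {W : Type u} [AddCommGroup W]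
  [Module k W]

/-- The quotient of a representation by an invariant subspace. -/
noncomputable def quotientRep (ρ : E →ₐ[k] Module.End k W) (L : Submodule k W)
    (hL : ∀ e, ∀ w ∈ L, ρ e w ∈ L) : E →ₐ[k] Module.End k (W ⧸ L) :=
  AlgHom.ofLinearMap
    { toFun := fun e => L.mapQ L (ρ e) (hL e)
      map_add' := fun e e' => by
        ext w
        simp
      map_smul' := fun c e => by
        ext w
        simp }
    (by
      ext w
      simp)
    (by
      intro e e'
      ext w
      simp)

end QuotientRep

/-! ### Coordinates on the quotient of consecutive Frobenius kernels -/

section QuotientCoordinates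
variable {k : Type u} [Field k] {p : ℕ} [Fact p.Prime] [CharP k p] {R : Type u} [CommRing R]
  [HopfAlgebra k R]

/-- Write y as a polynomial in the xᵢ. Its image vanishes, and the images of the xᵢ satisfy only the
truncation relations, so every monomial that occurs has an exponent at least D. For Frobenius
kernels this gives generators of the kernel of restriction. -/
theorem IsTruncBasis.ker_le {A A' : Type u} [CommRing A] [Algebra k A] [CommRing A']
    [Algebra k A'] {n D : ℕ} {x : Fin n → A} (hx : Function.Surjective
      (Finsupp.linearCombination k fun a : Fin n → ℕ => ∏ i, x i ^ a i)) (φ : A →ₐ[k] A')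
    (hx' : IsTruncBasis k (fun i => φ (x i)) D) (y : A) (hy : φ y = 0) :
    y ∈ ⨆ i, LinearMap.range (LinearMap.mulLeft k (x i ^ D)) := by
  obtain ⟨w, rfl⟩ := hx y
  have h1 : φ.toLinearMap ∘ₗ (Finsupp.linearCombination k fun a : Fin n → ℕ => ∏ i, x i ^ a i) =
      Finsupp.linearCombination k fun a : Fin n → ℕ => ∏ i, φ (x i) ^ a i := by
    ext a
    simp
  have h2 : w ∈ Finsupp.supported k k {a : Fin n → ℕ | ∃ i, D ≤ a i} := by
    rw [← hx'.ker_eq, LinearMap.mem_ker, ← h1]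
    exact hy
  suffices Finsupp.supported k k {a : Fin n → ℕ | ∃ i, D ≤ a i} ≤
      (⨆ i, LinearMap.range (LinearMap.mulLeft k (x i ^ D))).comap
        (Finsupp.linearCombination k fun a : Fin n → ℕ => ∏ i, x i ^ a i) from this h2
  refine Finsupp.supported_le ?_
  rintro a ⟨i, hi⟩ c
  rw [Submodule.mem_comap, Finsupp.linearCombination_single]
  refine Submodule.smul_mem _ _ (Submodule.mem_iSup_of_mem i ?_)
  rw [← Finset.mul_prod_erase _ _ (Finset.mem_univ i), ← Nat.add_sub_of_le hi, pow_add, mul_assoc]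
  exact ⟨_, rfl⟩

/-- The map `f ↦ 1 ⊗ f` to the Frobenius twist. -/
noncomputable def FrobeniusTwist.ofRing (k : Type u) [Field k] (p r : ℕ) [Fact p.Prime] [CharP k p]
    (R : Type u) [CommRing R] [HopfAlgebra k R] : R →+* FrobeniusTwist k p r R :=
  (Algebra.TensorProduct.includeRight : R →ₐ[k] TwistField k p r ⊗[k] R).toRingHom

theorem FrobeniusTwist.ofRing_apply {r : ℕ} (f : R) :
    FrobeniusTwist.ofRing k p r R f = FrobeniusTwist.tmul 1 f := rfl

theorem FrobeniusTwist.tmul_eq_smul {r : ℕ} (c : k) (f : R) :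
    (FrobeniusTwist.tmul c f : FrobeniusTwist k p r R) = c • FrobeniusTwist.tmul 1 f := by
  have h := TensorProduct.smul_tmul' (R := k) (R' := TwistField k p r) (M := TwistField k p r)
    (N := R) c 1 f
  exact (h.trans (congrArg (fun d : TwistField k p r => (d ⊗ₜ[k] f : TwistField k p r ⊗[k] R))
    (mul_one (M := TwistField k p r) c))).symm

theorem FrobeniusTwist.ofRing_algebraMap {r : ℕ} (c : k) :
    FrobeniusTwist.ofRing k p r R (algebraMap k R c) = algebraMap k _ (c ^ p ^ r) :=
  (Algebra.TensorProduct.includeRight : R →ₐ[k] TwistField k p r ⊗[k] R).commutes c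

/-- The map f ↦ 1 ⊗ f is a ring map but only semilinear, scalars being raised to the power p^r, so
generators cannot be transported by an algebra map. Polynomials in the xᵢ are followed directly:
their coefficients still go to scalars. -/
theorem adjoin_quotientCoord_eq_top {n r : ℕ} {x : Fin n → R}
    (hx : Algebra.adjoin k (Set.range fun i => FrobeniusKernel.mk k p 1 R (x i)) = ⊤) :
    Algebra.adjoin k (Set.range fun i => (FrobeniusKernel.mk k p 1 _ (FrobeniusTwist.tmul 1 (x i)) :
      QuotientCoord k p r R)) = ⊤ := by
  let ψ : R →+* QuotientCoord k p r R :=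
    (FrobeniusKernel.mk k p 1 (FrobeniusTwist k p r R) :
      FrobeniusTwist k p r R →ₐ[k] QuotientCoord k p r R).toRingHom.comp
      (FrobeniusTwist.ofRing k p r R)
  have hψ : ∀ f, ψ f = FrobeniusKernel.mk k p 1 _ (FrobeniusTwist.tmul 1 f) := fun f => rfl
  set S := Algebra.adjoin k (Set.range fun i =>
    (FrobeniusKernel.mk k p 1 _ (FrobeniusTwist.tmul 1 (x i)) : QuotientCoord k p r R)) with hS
  have hker : ∀ f ∈ frobeniusIdeal k p 1 R, ψ f = 0 := by
    have : frobeniusIdeal k p 1 R ≤ RingHom.ker ψ := by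
      refine Ideal.span_le.2 ?_
      rintro _ ⟨y, hy, rfl⟩
      refine (map_pow ψ y _).trans (FrobeniusKernel.mk_pow_eq_zero k p 1 _ _ ?_)
      rw [FrobeniusTwist.ofRing_apply, FrobeniusTwist.counit_tmul, hy,
        zero_pow (pow_ne_zero _ (Fact.out : p.Prime).ne_zero), mul_zero]
    exact fun f hf => this hf
  have hpoly : ∀ P : MvPolynomial (Fin n) k, ψ (MvPolynomial.aeval x P) ∈ S := by
    intro P
    induction P using MvPolynomial.induction_on with
    | C a =>
      have : ψ (algebraMap k R a) = algebraMap k _ (a ^ p ^ r) := by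
        change FrobeniusKernel.mk k p 1 _ (FrobeniusTwist.ofRing k p r R (algebraMap k R a)) = _
        rw [FrobeniusTwist.ofRing_algebraMap, AlgHomClass.commutes]
      rw [MvPolynomial.algHom_C, this]
      exact S.algebraMap_mem _
    | add P Q hP hQ => rw [map_add, map_add]; exact S.add_mem hP hQ
    | mul_X P i hP =>
      rw [map_mul, map_mul, MvPolynomial.aeval_X]
      exact S.mul_mem hP (Algebra.subset_adjoin ⟨i, rfl⟩)
  have hall : ∀ f, ψ f ∈ S := by
    intro f
    rw [Algebra.adjoin_range_eq_range_aeval] at hx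
    obtain ⟨P, hP⟩ : FrobeniusKernel.mk k p 1 R f ∈ (MvPolynomial.aeval (R := k)
      fun i => FrobeniusKernel.mk k p 1 R (x i)).range := hx ▸ Algebra.mem_top
    have h1 : FrobeniusKernel.mk k p 1 R (f - MvPolynomial.aeval x P) = 0 := by
      have h2 : (FrobeniusKernel.mk k p 1 R : R →ₐ[k] _) (MvPolynomial.aeval x P) =
          MvPolynomial.aeval (fun i => FrobeniusKernel.mk k p 1 R (x i)) P := by
        rw [← AlgHom.comp_apply, MvPolynomial.comp_aeval]
        rfl
      rw [map_sub, sub_eq_zero, ← hP]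
      exact h2.symm
    have h3 := hker _ (Ideal.Quotient.eq_zero_iff_mem.1 h1)
    rw [map_sub, sub_eq_zero] at h3
    rw [h3]
    exact hpoly P
  rw [eq_top_iff]
  intro z _
  obtain ⟨y, rfl⟩ := FrobeniusKernel.mk_surjective k p 1 _ z
  induction y using FrobeniusTwist.induction with
  | h0 => rw [map_zero]; exact S.zero_mem
  | ha x y hx hy => rw [map_add]; exact S.add_mem (hx trivial) (hy trivial)
  | ht c f =>
    rw [FrobeniusTwist.tmul_eq_smul, map_smul]
    exact S.smul_mem (hall f) c

end QuotientCoordinates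

/-! ### The twisted operator on A ⊗ V and its comparison with V -/

section RestrictScalars
variable (k K V : Type u) [Field k] [Field K] [Algebra k K] [AddCommGroup V] [Module k V]
  [Module K V] [IsScalarTower k K V]

/-- `K`-linear endomorphisms as `k`-linear endomorphisms. -/
def endRestrict : Module.End K V →ₐ[k] Module.End k V :=
  AlgHom.ofLinearMap
    { toFun := fun f => f.restrictScalars k
      map_add' := fun _ _ => rfl
      map_smul' := fun _ _ => rfl } rfl (fun _ _ => rfl)

variable {k K V} in
theorem endRestrict_apply (f : Module.End K V) (v : V) : endRestrict k K V f v = f v := rfl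

end RestrictScalars

section TwistedEnd
variable {k : Type u} [Field k] {K : Type u} [Field K] [Algebra k K]
  {A A' V H : Type u} [AddCommGroup A] [Module k A] [AddCommGroup A'] [Module k A']
  [AddCommGroup V] [Module k V] [Module K V] [IsScalarTower k K V] [Ring H] [Bialgebra k H]
  (act : H →ₐ[k] Module.End k A) (act' : H →ₐ[k] Module.End k A')
  (ρ : K ⊗[k] H →ₐ[K] Module.End K V)

variable (k) in
/-- A representation of `K ⊗ H` on a `K`-space, as a representation on a `k`-space. -/
def repRestrict : K ⊗[k] H →ₐ[k] Module.End k V := (endRestrict k K V).comp (ρ.restrictScalars k)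

theorem repRestrict_apply (g : K ⊗[k] H) (v : V) : repRestrict k ρ g v = ρ g v := rfl

/-- The endomorphism of `A ⊗ V` by which `a + b` acts, where `a` is an endomorphism of `V` and `b`
acts diagonally. -/
noncomputable def twistedEnd (a : Module.End K V) (b : K ⊗[k] H) : Module.End k (A ⊗[k] V) :=
  (endRestrict k K V a).lTensor A + diagRep act (repRestrict k ρ) (baseComul k H K b)

variable {a : Module.End K V} {b : K ⊗[k] H}

theorem commute_endRestrict (ha : ∀ g, Commute a (ρ g)) (g : K ⊗[k] H) :
    Commute (endRestrict k K V a) (repRestrict k ρ g) :=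
  (ha g).map (endRestrict k K V)

theorem twistedEnd_pow {p : ℕ} [Fact p.Prime] [CharP k p] (ha : ∀ g, Commute a (ρ g))
    (hap : a ^ p = 0) (hbp : b ^ p = 0) : twistedEnd act ρ a b ^ p = 0 := by
  have hp : p ≠ 0 := (Fact.out : p.Prime).ne_zero
  have h1 := commute_lTensor_diagRep act (repRestrict k ρ) (endRestrict k K V a)
    (commute_endRestrict ρ ha) (baseComul k H K b)
  have h2 : ((endRestrict k K V a).lTensor A : Module.End k (A ⊗[k] V)) ^ p = 0 := by
    rw [LinearMap.lTensor_pow, ← map_pow, hap, map_zero, LinearMap.lTensor_zero]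
  rw [twistedEnd, add_pow_char_of_commute_algebra (k := k) _ _ h1, h2, ← map_pow, ← map_pow, hbp,
    map_zero, map_zero, add_zero]

variable {act act'} in
theorem rTensor_twistedEnd (φ : A →ₗ[k] A') (hφ : ∀ h a, φ (act h a) = act' h (φ a))
    (z : A ⊗[k] V) :
    φ.rTensor V (twistedEnd act ρ a b z) = twistedEnd act' ρ a b (φ.rTensor V z) := by
  rw [twistedEnd, twistedEnd, LinearMap.add_apply, map_add, rTensor_diagRep _ φ hφ,
    LinearMap.add_apply]
  congr 1
  rw [← LinearMap.comp_apply, ← LinearMap.comp_apply, LinearMap.rTensor_comp_lTensor,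
    LinearMap.lTensor_comp_rTensor]

theorem commute_twistedEnd_rTensor (f : Module.End k A) (hf : ∀ h, Commute f (act h)) :
    Commute (twistedEnd act ρ a b) (f.rTensor V : Module.End k (A ⊗[k] V)) := by
  refine Commute.add_left (R := Module.End k (A ⊗[k] V)) ?_
    (commute_rTensor_diagRep act (repRestrict k ρ) f hf _).symm
  change _ ∘ₗ _ = _ ∘ₗ _
  rw [LinearMap.rTensor_comp_lTensor, LinearMap.lTensor_comp_rTensor]

theorem commute_twistedEnd_lTensor (f : Module.End K V) (hfa : Commute f a)
    (hf : ∀ g, Commute f (ρ g)) :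
    Commute (twistedEnd act ρ a b)
      ((endRestrict k K V f).lTensor A : Module.End k (A ⊗[k] V)) := by
  refine Commute.add_left (R := Module.End k (A ⊗[k] V)) ?_
    (commute_lTensor_diagRep act (repRestrict k ρ) _ (commute_endRestrict ρ hf) _).symm
  change _ ∘ₗ _ = _ ∘ₗ _
  rw [← LinearMap.lTensor_comp, ← LinearMap.lTensor_comp]
  exact congrArg _ ((hfa.map (endRestrict k K V)).eq).symm

/-- The element c ⊗ (h ⊗ 1) acts on V only by the scalar c, which commutes with every K-linear
endomorphism. This makes the filtration below stable under operators coming from V. -/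
theorem commute_diagRep_baseLeft (f : Module.End K V) (g : K ⊗[k] H) :
    Commute ((endRestrict k K V f).lTensor A : Module.End k (A ⊗[k] V))
      (diagRep act (repRestrict k ρ) (baseLeft k H K g)) := by
  induction g using TensorProduct.induction_on with
  | zero => rw [map_zero, map_zero]; exact Commute.zero_right (G₀ := Module.End k (A ⊗[k] V)) _
  | add x y hx hy =>
    rw [map_add, map_add]; exact Commute.add_right (R := Module.End k (A ⊗[k] V)) hx hy
  | tmul c h =>
    change _ * _ = _ * _
    ext x v
    have h1 : ∀ v, repRestrict k ρ (c ⊗ₜ 1) v = c • v := by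
      intro v
      have : (c ⊗ₜ 1 : K ⊗[k] H) = algebraMap K _ c := rfl
      rw [repRestrict_apply, this, AlgHom.commutes]
      rfl
    rw [baseLeft_tmul]
    simp [diagRep_tmul, h1, endRestrict_apply]

/-- The filtration of `A ⊗ V` by the products of the operators `ηᵢ ⊗ 1`. -/
noncomputable def leftFiltration {n : ℕ} (η : Fin n → K ⊗[k] H) : ℕ → Submodule k (A ⊗[k] V)
  | 0 => ⊤
  | j + 1 => ⨆ i, (leftFiltration η j).map (diagRep act (repRestrict k ρ) (baseLeft k H K (η i)))

theorem leftFiltration_succ_le {n : ℕ} (η : Fin n → K ⊗[k] H) (j : ℕ) :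
    leftFiltration act ρ η (j + 1) ≤ leftFiltration act ρ η j := by
  induction j with
  | zero => exact le_top
  | succ j ih => exact iSup_mono fun i => Submodule.map_mono ih

theorem leftFiltration_stable {n : ℕ} (η : Fin n → K ⊗[k] H) (f : Module.End K V) (j : ℕ) :
    ∀ z ∈ leftFiltration act ρ η j,
      (endRestrict k K V f).lTensor A z ∈ leftFiltration act ρ η j := by
  induction j with
  | zero => exact fun _ _ => trivial
  | succ j ih =>
    suffices leftFiltration act ρ η (j + 1) ≤ (leftFiltration act ρ η (j + 1)).comap
      ((endRestrict k K V f).lTensor A) from this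
    refine iSup_le fun i => ?_
    rintro _ ⟨z, hz, rfl⟩
    refine Submodule.mem_iSup_of_mem i ⟨_, ih z hz, ?_⟩
    exact (LinearMap.congr_fun (commute_diagRep_baseLeft act ρ f (η i)).eq z).symm

theorem leftFiltration_eq_bot {n m : ℕ} (η : Fin n → K ⊗[k] H)
    (hη : ∀ l : List (Fin n), l.length = m → (l.map η).prod = 0) :
    leftFiltration (V := V) act ρ η m = ⊥ := by
  -- The statement is generalised by a left factor c, which absorbs one letter of the word at each
  -- step of the filtration. The case c = 1 is the claim.
  have key : ∀ (j : ℕ) (c : K ⊗[k] H), (∀ l : List (Fin n), l.length = j →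
      c * (l.map η).prod = 0) → leftFiltration act ρ η j ≤
        LinearMap.ker (diagRep act (repRestrict k ρ) (baseLeft k H K c)) := by
    intro j
    induction j with
    | zero =>
      intro c hc z _
      have := hc [] rfl
      rw [List.map_nil, List.prod_nil, mul_one] at this
      rw [this, map_zero, map_zero]
      rfl
    | succ j ih =>
      intro c hc
      refine iSup_le fun i => ?_
      rintro _ ⟨z, hz, rfl⟩
      have := ih (c * η i) (fun l hl => by
        have := hc (i :: l) (by rw [List.length_cons, hl])
        rwa [List.map_cons, List.prod_cons, ← mul_assoc] at this) hz
      rw [LinearMap.mem_ker, map_mul, map_mul] at this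
      exact this
  rw [eq_bot_iff]
  refine (key m 1 fun l hl => by rw [hη l hl, mul_zero]).trans ?_
  rw [map_one, map_one]
  exact fun z hz => hz

/-- Since the coproduct of b is 1 ⊗ b + ∑ ηᵢ ⊗ uᵢ, the twisted operator differs from 1 ⊗ (a + b) by
a map that goes one step down the filtration by words in the ηᵢ. That filtration is finite, and a
contraction on V extends to A ⊗ V compatibly with it. -/
theorem twistedEnd_acyclic_of_acyclic {p : ℕ} [Fact p.Prime] [CharP k p]
    (ha : ∀ g, Commute a (ρ g)) (hap : a ^ p = 0) (hbp : b ^ p = 0) (hb : IsUnipotentElement b)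
    (h : ∀ v, (a + ρ b) v = 0 → ∃ w, ((a + ρ b) ^ (p - 1)) w = v) (z : A ⊗[k] V)
    (hz : twistedEnd act ρ a b z = 0) : ∃ w, (twistedEnd act ρ a b ^ (p - 1)) w = z := by
  obtain ⟨n, m, η, u, hbc, hη⟩ := hb
  obtain ⟨C, C', hC⟩ := exists_contraction (a + ρ b) h
  have hst := leftFiltration_stable (A := A) act ρ η
  refine acyclic_of_filtration (Fact.out : p.Prime).one_le (twistedEnd act ρ a b)
    ((endRestrict k K V (a + ρ b)).lTensor A) ((endRestrict k K V C).lTensor A)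
    ((endRestrict k K V C').lTensor A) (twistedEnd_pow act ρ ha hap hbp)
    (leftFiltration act ρ η) rfl (leftFiltration_eq_bot act ρ η hη) ?_ (hst _) (hst _) (hst _) ?_
    (leftFiltration_succ_le act ρ η) z hz
  · intro z
    rw [LinearMap.lTensor_pow, ← map_pow]
    induction z using TensorProduct.induction_on with
    | zero => simp
    | add x y hx hy =>
      simp only [map_add] at hx hy ⊢
      rw [add_add_add_comm, ← hx, ← hy]
    | tmul x v =>
      simp only [LinearMap.lTensor_tmul, endRestrict_apply, ← TensorProduct.tmul_add]
      rw [← hC v]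
  · intro j z hz
    have h1 : twistedEnd act ρ a b z - (endRestrict k K V (a + ρ b)).lTensor A z =
        ∑ i, diagRep act (repRestrict k ρ) (baseLeft k H K (η i))
          ((endRestrict k K V (ρ (u i))).lTensor A z) := by
      rw [twistedEnd, hbc, map_add, map_sum, diagRep_baseRight, map_add, LinearMap.lTensor_add,
        LinearMap.add_apply, LinearMap.add_apply, LinearMap.add_apply, LinearMap.sum_apply]
      simp only [map_mul, Module.End.mul_apply, diagRep_baseRight]
      rw [← add_assoc]
      exact add_sub_cancel_left _ _
    rw [h1]
    exact Submodule.sum_mem _ fun i _ => Submodule.mem_iSup_of_mem i ⟨_, hst _ j z hz, rfl⟩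

/-- The maps v ↦ e ⊗ v and ε ⊗ 1 commute with the operators and compose to the identity, so V is a
direct summand and inherits acyclicity. -/
theorem acyclic_of_twistedEnd_acyclic {p : ℕ} (e : A)
    (he : ∀ h, act h e = counit (R := k) h • e) (ε : A →ₗ[k] k)
    (hε : ∀ h a, ε (act h a) = counit (R := k) h * ε a) (hεe : ε e = 1)
    (h : ∀ z, twistedEnd act ρ a b z = 0 → ∃ w, (twistedEnd act ρ a b ^ (p - 1)) w = z) (v : V)
    (hv : (a + ρ b) v = 0) : ∃ w, ((a + ρ b) ^ (p - 1)) w = v := by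
  have h1 : ∀ v, twistedEnd act ρ a b (e ⊗ₜ v) = e ⊗ₜ (a + ρ b) v := by
    intro v
    rw [twistedEnd, LinearMap.add_apply, diagRep_tmul_of_invariant act _ e he, baseCounit_baseComul,
      LinearMap.lTensor_tmul, ← TensorProduct.tmul_add]
    rfl
  have h2 : ∀ z, TensorProduct.lid k V (ε.rTensor V (twistedEnd act ρ a b z)) =
      (a + ρ b) (TensorProduct.lid k V (ε.rTensor V z)) := by
    intro z
    rw [twistedEnd, LinearMap.add_apply, map_add, map_add, lid_rTensor_diagRep act _ ε hε,
      baseCounit_baseComul, LinearMap.add_apply]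
    congr 1
    induction z using TensorProduct.induction_on with
    | zero => simp
    | add x y hx hy => simp only [map_add, hx, hy]
    | tmul x v =>
      simp only [LinearMap.lTensor_tmul, LinearMap.rTensor_tmul, TensorProduct.lid_tmul,
        endRestrict_apply]
      exact (map_smul (endRestrict k K V a) _ _).symm
  have h3 : ∀ (m : ℕ) z, TensorProduct.lid k V (ε.rTensor V ((twistedEnd act ρ a b ^ m) z)) =
      ((a + ρ b) ^ m) (TensorProduct.lid k V (ε.rTensor V z)) := by
    intro m
    induction m with
    | zero => intro z; simp
    | succ m ih => intro z; rw [pow_succ, pow_succ, Module.End.mul_apply, Module.End.mul_apply, ih, h2]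
  obtain ⟨w, hw⟩ := h (e ⊗ₜ v) (by rw [h1, hv, TensorProduct.tmul_zero])
  refine ⟨_, (h3 _ w).symm.trans ?_⟩
  rw [hw, LinearMap.rTensor_tmul, hεe, TensorProduct.lid_tmul, one_smul]

end TwistedEnd

/-! ### The induced module over the extended double -/

section InducedModule
variable {k : Type u} [Field k] {p r : ℕ} [Fact p.Prime] [CharP k p] {R : Type u} [CommRing R]
  [HopfAlgebra k R] (N : Type u) [AddCommGroup N] [Module k N] [Module (SubDouble k p r R) N]
  [IsScalarTower k (SubDouble k p r R) N]

namespace SubDouble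

variable (k p r R) in
/-- The action of `k[𝔾_(r+1)/𝔾_(r)]` on an `O(𝔾_(r))`-module. -/
noncomputable def coordRep : QuotientCoord k p r R →ₐ[k] Module.End k N :=
  (Algebra.lsmul k k N).comp inl

variable (k p r R) in
/-- The action of `k𝔾_(r)` on an `O(𝔾_(r))`-module. -/
noncomputable def groupRep : GroupAlg k (FrobeniusKernel k p r R) →ₐ[k] Module.End k N :=
  (Algebra.lsmul k k N).comp inr

theorem commute_coordRep_groupRep (z : QuotientCoord k p r R)
    (h : GroupAlg k (FrobeniusKernel k p r R)) :
    Commute (coordRep k p r R N z) (groupRep k p r R N h) :=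
  (commute z h).map (Algebra.lsmul k k N)

variable (k p r R) in
/-- The endomorphism `z ⊗ 1 - 1 ⊗ z` of `k[𝔾_(r+1)] ⊗ N`. -/
noncomputable def balance (z : QuotientCoord k p r R) :
    Module.End k (FrobeniusKernel k p (r + 1) R ⊗[k] N) :=
  (LinearMap.mulLeft k (frobeniusQuotientHom z)).rTensor N -
    (coordRep k p r R N z).lTensor (FrobeniusKernel k p (r + 1) R)

variable (k p r R) in
/-- The kernel of `k[𝔾_(r+1)] ⊗ N → k[𝔾_(r+1)] ⊗_Z N`, where `Z = k[𝔾_(r+1)/𝔾_(r)]`. -/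
noncomputable def balanceSub : Submodule k (FrobeniusKernel k p (r + 1) R ⊗[k] N) :=
  ⨆ z, LinearMap.range (balance k p r R N z)

theorem commute_balance_rTensor (z : QuotientCoord k p r R) (f : FrobeniusKernel k p (r + 1) R) :
    Commute (balance k p r R N z) ((LinearMap.mulLeft k f).rTensor N) := by
  change _ ∘ₗ _ = _ ∘ₗ _
  ext a n
  simp [balance, TensorProduct.tmul_sub, mul_left_comm]

variable [Algebra.FiniteType k R]

/-- Functions on 𝔾_(r+1)/𝔾_(r) are invariant under the coadjoint action, and on N they commute with
the group algebra. The relations defining the induced module are therefore stable. -/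
theorem commute_balance_diagonal (z : QuotientCoord k p r R)
    (h : GroupAlg k (FrobeniusKernel k p r R)) : Commute (balance k p r R N z)
      (SmashProduct.diagonal (FrobeniusKernel k p (r + 1) R) (groupRep k p r R N) h) := by
  change _ ∘ₗ _ = _ ∘ₗ _
  ext a n
  have h1 : ∀ (h : GroupAlg k (FrobeniusKernel k p r R)) (a : FrobeniusKernel k p (r + 1) R),
      LeftModuleAlgebra.act (k := k) h (frobeniusQuotientHom z * a) =
        frobeniusQuotientHom z * LeftModuleAlgebra.act (k := k) h a := by
    intro h a
    have h2 := congrArg (contract · h) (congrArg (· * conjCoaction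
      ((FrobeniusKernel.restrict : FrobeniusKernel k p (r + 1) R →ₐc[k] FrobeniusKernel k p r R) :
        FrobeniusKernel k p (r + 1) R →ₐ[k] FrobeniusKernel k p r R) a)
          (conjCoaction_frobeniusQuotientHom z))
    refine Eq.trans ?_ (h2.trans (contract_tmul_one_mul _ _ h))
    change contract (conjCoaction _ _) h = _
    rw [map_mul]
  have h3 : ∀ (h : GroupAlg k (FrobeniusKernel k p r R)) (n : N), coordRep k p r R N z
      (groupRep k p r R N h n) = groupRep k p r R N h (coordRep k p r R N z n) := fun h n =>
    LinearMap.congr_fun (commute_coordRep_groupRep N z h).eq n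
  change balance k p r R N z (SmashProduct.diagonal _ _ h (a ⊗ₜ n)) =
    SmashProduct.diagonal _ _ h (balance k p r R N z (a ⊗ₜ n))
  simp only [balance, LinearMap.sub_apply, map_sub, LinearMap.rTensor_tmul, LinearMap.lTensor_tmul,
    LinearMap.mulLeft_apply, SmashProduct.diagonal_tmul _ (ℛ k h), map_sum, h1, h3,
    Finset.sum_sub_distrib]

variable (k p r R) in
/-- The representation of `D̃(𝔾_(r))` on `k[𝔾_(r+1)] ⊗ N`. -/
noncomputable def tensorRep : ExtendedDouble k p r R →ₐ[k]
    Module.End k (FrobeniusKernel k p (r + 1) R ⊗[k] N) :=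
  SmashProduct.rep (A := FrobeniusKernel k p (r + 1) R) (groupRep k p r R N)

theorem commute_balance_rep (z : QuotientCoord k p r R) (e : SmashProduct k
    (FrobeniusKernel k p (r + 1) R) (GroupAlg k (FrobeniusKernel k p r R))) :
    Commute (balance k p r R N z) (SmashProduct.rep (groupRep k p r R N) e) := by
  induction e using SmashProduct.induction with
  | h0 =>
    rw [map_zero]
    exact Commute.zero_right (G₀ := Module.End k (FrobeniusKernel k p (r + 1) R ⊗[k] N)) _
  | ha x y hx hy =>
    rw [map_add]
    exact Commute.add_right (R := Module.End k (FrobeniusKernel k p (r + 1) R ⊗[k] N)) hx hy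
  | ht f h =>
    exact Commute.mul_right (S := Module.End k (FrobeniusKernel k p (r + 1) R ⊗[k] N))
      (commute_balance_rTensor N z f) (commute_balance_diagonal N z h)

theorem tensorRep_mem (e : ExtendedDouble k p r R) :
    ∀ w ∈ balanceSub k p r R N, tensorRep k p r R N e w ∈ balanceSub k p r R N := by
  suffices balanceSub k p r R N ≤ (balanceSub k p r R N).comap (tensorRep k p r R N e) from this
  refine iSup_le fun z => ?_
  rintro _ ⟨w, rfl⟩
  exact Submodule.mem_iSup_of_mem z ⟨tensorRep k p r R N e w,
    LinearMap.congr_fun (commute_balance_rep N z e).eq w⟩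

variable (k p r R) in
/-- The `D̃(𝔾_(r))`-module `k[𝔾_(r+1)] ⊗_Z N` induced from the `O(𝔾_(r))`-module `N`, where
`Z = k[𝔾_(r+1)/𝔾_(r)]`. -/
def Induced : Type u := (FrobeniusKernel k p (r + 1) R ⊗[k] N) ⧸ balanceSub k p r R N

noncomputable instance : AddCommGroup (Induced k p r R N) :=
  inferInstanceAs (AddCommGroup ((FrobeniusKernel k p (r + 1) R ⊗[k] N) ⧸ balanceSub k p r R N))

noncomputable instance : Module k (Induced k p r R N) :=
  inferInstanceAs (Module k ((FrobeniusKernel k p (r + 1) R ⊗[k] N) ⧸ balanceSub k p r R N))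

instance [Module.Finite k N] : Module.Finite k (Induced k p r R N) :=
  inferInstanceAs (Module.Finite k
    ((FrobeniusKernel k p (r + 1) R ⊗[k] N) ⧸ balanceSub k p r R N))

variable (k p r R) in
/-- The action of `D̃(𝔾_(r))` on the induced module. -/
noncomputable def inducedRep : ExtendedDouble k p r R →ₐ[k] Module.End k (Induced k p r R N) :=
  quotientRep (tensorRep k p r R N) (balanceSub k p r R N) (tensorRep_mem N)

noncomputable instance : Module (ExtendedDouble k p r R) (Induced k p r R N) :=
  Module.compHom (Induced k p r R N) (inducedRep k p r R N).toRingHom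

instance : IsScalarTower k (ExtendedDouble k p r R) (Induced k p r R N) :=
  ⟨fun c e m => LinearMap.congr_fun (map_smul (inducedRep k p r R N) c e) m⟩

variable (k p r R) in
/-- The projection to the induced module. -/
noncomputable def toInduced : FrobeniusKernel k p (r + 1) R ⊗[k] N →ₗ[k] Induced k p r R N :=
  (balanceSub k p r R N).mkQ

theorem smul_toInduced (e : ExtendedDouble k p r R) (w : FrobeniusKernel k p (r + 1) R ⊗[k] N) :
    e • toInduced k p r R N w = toInduced k p r R N (tensorRep k p r R N e w) := rfl

theorem toInduced_surjective : Function.Surjective (toInduced k p r R N) :=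
  Submodule.mkQ_surjective _

theorem ker_toInduced : LinearMap.ker (toInduced k p r R N) = balanceSub k p r R N :=
  Submodule.ker_mkQ _

theorem incl_inr_smul_toInduced (h : GroupAlg k (FrobeniusKernel k p r R))
    (w : FrobeniusKernel k p (r + 1) R ⊗[k] N) :
    incl k p r R (inr h) • toInduced k p r R N w = toInduced k p r R N
      (SmashProduct.diagonal (FrobeniusKernel k p (r + 1) R) (groupRep k p r R N) h w) := by
  have h1 : incl k p r R (inr h) = (SmashProduct.tmul 1 h : SmashProduct k
      (FrobeniusKernel k p (r + 1) R) (GroupAlg k (FrobeniusKernel k p r R))) :=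
    (inclSmash_tmul 1 h).trans (by rw [map_one])
  rw [smul_toInduced]
  congr 1
  refine (congrArg (fun e => tensorRep k p r R N e w) h1).trans ?_
  refine (SmashProduct.rep_tmul (groupRep k p r R N) 1 h w).trans ?_
  rw [LinearMap.mulLeft_one, LinearMap.rTensor_id]
  rfl

/-- The action is by multiplication on the left factor, but the balancing relation moves z to the
factor N. Hence α acts on N alone, in the form required for `twistedEnd`. -/
theorem incl_inl_smul_toInduced (z : QuotientCoord k p r R)
    (w : FrobeniusKernel k p (r + 1) R ⊗[k] N) :
    incl k p r R (inl z) • toInduced k p r R N w = toInduced k p r R N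
      ((coordRep k p r R N z).lTensor (FrobeniusKernel k p (r + 1) R) w) := by
  have h1 : incl k p r R (inl z) = (SmashProduct.tmul (frobeniusQuotientHom z) 1 : SmashProduct k
      (FrobeniusKernel k p (r + 1) R) (GroupAlg k (FrobeniusKernel k p r R))) :=
    inclSmash_tmul z 1
  rw [smul_toInduced, ← sub_eq_zero, ← map_sub, ← LinearMap.mem_ker, ker_toInduced]
  refine Submodule.mem_iSup_of_mem z ⟨w, ?_⟩
  have h2 := SmashProduct.rep_tmul (groupRep k p r R N) (frobeniusQuotientHom z) 1 w
  rw [map_one, Module.End.one_apply] at h2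
  exact congrArg (· - (coordRep k p r R N z).lTensor (FrobeniusKernel k p (r + 1) R) w)
    ((congrArg (fun e => tensorRep k p r R N e w) h1).trans h2).symm

end SubDouble
end InducedModule

section Restrict
variable (k : Type u) [Field k] (p s : ℕ) [Fact p.Prime] [CharP k p] (R : Type u) [CommRing R]
  [HopfAlgebra k R]

/-- `FrobeniusKernel.restrict` as a map of algebras. -/
noncomputable def FrobeniusKernel.restrictAlgHom :
    FrobeniusKernel k p (s + 1) R →ₐ[k] FrobeniusKernel k p s R :=
  (FrobeniusKernel.restrict : FrobeniusKernel k p (s + 1) R →ₐc[k] FrobeniusKernel k p s R)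

theorem FrobeniusKernel.restrictAlgHom_mk (f : R) : FrobeniusKernel.restrictAlgHom k p s R
    (FrobeniusKernel.mk k p (s + 1) R f) = FrobeniusKernel.mk k p s R f := rfl

end Restrict

/-! ### The two quotients of k[𝔾_(r+2)] ⊗ (K ⊗ N) -/

namespace SubDouble
variable {k : Type u} [Field k] {p r : ℕ} [Fact p.Prime] [CharP k p] {R : Type u} [CommRing R]
  [HopfAlgebra k R] {n : ℕ} (x : Fin n → R)

variable (k p r) in
/-- The functions `1 ⊗ xᵢ` on `𝔾_(r+1)/𝔾_(r)`. -/
noncomputable def quotientVar (i : Fin n) : QuotientCoord k p r R :=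
  FrobeniusKernel.mk k p 1 _ (FrobeniusTwist.tmul 1 (x i))

theorem quotientVar_pow (hx : ∀ i, counit (R := k) (x i) = 0) (i : Fin n) :
    quotientVar k p r x i ^ p = 0 := by
  have := FrobeniusKernel.mk_pow_eq_zero k p 1 (FrobeniusTwist k p r R) (FrobeniusTwist.tmul 1 (x i))
    (by rw [FrobeniusTwist.counit_tmul, hx,
      zero_pow (pow_ne_zero _ (Fact.out : p.Prime).ne_zero), mul_zero])
  rwa [pow_one] at this

theorem frobeniusQuotientHom_quotientVar (i : Fin n) :
    frobeniusQuotientHom (quotientVar k p r x i) = FrobeniusKernel.mk k p (r + 1) R (x i) ^ p ^ r := by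
  rw [quotientVar, frobeniusQuotientHom_mk_tmul, one_smul]

variable (N : Type u) [AddCommGroup N] [Module k N] [Module (SubDouble k p r R) N]
  [IsScalarTower k (SubDouble k p r R) N]

/-- The identity (y z) ⊗ 1 - 1 ⊗ (y z) = (y ⊗ 1)(z ⊗ 1 - 1 ⊗ z) + (y ⊗ 1 - 1 ⊗ y)(1 ⊗ z) reduces all
balancing relations to those of algebra generators. This leaves finitely many operators, one for
each coordinate. -/
theorem balanceSub_eq (hx : Algebra.adjoin k (Set.range (quotientVar k p r x)) = ⊤) :
    balanceSub k p r R N = ⨆ i, LinearMap.range (balance k p r R N (quotientVar k p r x i)) := by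
  apply le_antisymm
  swap
  · exact iSup_le fun i => le_iSup (fun z => LinearMap.range (balance k p r R N z)) _
  set L := ⨆ i, LinearMap.range (balance k p r R N (quotientVar k p r x i)) with hL
  have hstab : ∀ (f : FrobeniusKernel k p (r + 1) R), ∀ w ∈ L,
      (LinearMap.mulLeft k f).rTensor N w ∈ L := by
    intro f
    suffices L ≤ L.comap ((LinearMap.mulLeft k f).rTensor N) from this
    refine iSup_le fun i => ?_
    rintro _ ⟨w, rfl⟩
    exact Submodule.mem_iSup_of_mem i ⟨_, LinearMap.congr_fun
      (commute_balance_rTensor N (quotientVar k p r x i) f).eq w⟩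
  refine iSup_le fun z => ?_
  rintro _ ⟨w, rfl⟩
  have hz : z ∈ Algebra.adjoin k (Set.range (quotientVar k p r x)) := hx ▸ Algebra.mem_top
  induction hz using Algebra.adjoin_induction generalizing w with
  | mem z hz =>
    obtain ⟨i, rfl⟩ := hz
    exact Submodule.mem_iSup_of_mem i ⟨w, rfl⟩
  | algebraMap c =>
    have : balance k p r R N (algebraMap k _ c) = 0 := by
      ext a m
      simp [balance, Algebra.algebraMap_eq_smul_one, TensorProduct.smul_tmul]
    rw [this]
    exact Submodule.zero_mem _
  | add y z _ _ hy hz =>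
    have : balance k p r R N (y + z) = balance k p r R N y + balance k p r R N z := by
      ext a m
      simp [balance, add_mul, TensorProduct.add_tmul, TensorProduct.tmul_add]
      abel
    rw [this]
    exact Submodule.add_mem _ (hy w) (hz w)
  | mul y z _ _ hy hz =>
    have : balance k p r R N (y * z) w =
        (LinearMap.mulLeft k (frobeniusQuotientHom y)).rTensor N (balance k p r R N z w) +
          balance k p r R N y ((coordRep k p r R N z).lTensor _ w) := by
      induction w using TensorProduct.induction_on with
      | zero => simp
      | add v w hv hw => simp only [map_add, hv, hw]; abel
      | tmul a m => simp [balance, mul_assoc]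
    rw [this]
    exact Submodule.add_mem _ (hstab _ _ (hz w)) (hy _)

variable (K : Type u) [Field K] [Algebra k K]

variable (k p r R) in
/-- The action of `k[𝔾_(r+1)/𝔾_(r)]` on `K ⊗ N`. -/
noncomputable def baseCoordRep : QuotientCoord k p r R →ₐ[k] Module.End k (K ⊗[k] N) :=
  (endRestrict k K (K ⊗[k] N)).comp (((baseRep (E := SubDouble k p r R) K N).restrictScalars k).comp
    (Algebra.TensorProduct.includeRight.comp inl))

theorem baseCoordRep_tmul (z : QuotientCoord k p r R) (c : K) (m : N) :
    baseCoordRep k p r R N K z (c ⊗ₜ m) = c ⊗ₜ coordRep k p r R N z m := by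
  refine (baseRep_tmul K N 1 c (inl z) m).trans ?_
  rw [one_mul]
  rfl

variable (k p r) in
/-- The endomorphisms `xᵢ^(p^r) ⊗ 1 - 1 ⊗ zᵢ` of `k[𝔾_(s)] ⊗ (K ⊗ N)`. -/
noncomputable abbrev baseBalance (s : ℕ) (i : Fin n) :
    Module.End k (FrobeniusKernel k p s R ⊗[k] (K ⊗[k] N)) :=
  diffEnd (k := k) (fun i => FrobeniusKernel.mk k p s R (x i)) (p ^ r)
    (baseCoordRep k p r R N K : QuotientCoord k p r R →+* Module.End k (K ⊗[k] N))
    (quotientVar k p r x) i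

variable (k p r R) in
/-- The map `k[𝔾_(r+1)] ⊗ (K ⊗ N) → K ⊗ (k[𝔾_(r+1)] ⊗_Z N)`. -/
noncomputable def toBaseInduced [Algebra.FiniteType k R] :
    FrobeniusKernel k p (r + 1) R ⊗[k] (K ⊗[k] N) →ₗ[k] K ⊗[k] Induced k p r R N :=
  (toInduced k p r R N).lTensor K ∘ₗ
    (TensorProduct.leftComm k (FrobeniusKernel k p (r + 1) R) K N).toLinearMap

theorem leftComm_baseBalance (i : Fin n) (y : FrobeniusKernel k p (r + 1) R ⊗[k] (K ⊗[k] N)) :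
    TensorProduct.leftComm k (FrobeniusKernel k p (r + 1) R) K N (baseBalance k p r x N K (r + 1) i y) =
      (balance k p r R N (quotientVar k p r x i)).lTensor K
        (TensorProduct.leftComm k (FrobeniusKernel k p (r + 1) R) K N y) := by
  induction y using TensorProduct.induction_on with
  | zero => simp
  | add y z hy hz => simp only [map_add, hy, hz]
  | tmul a v =>
    induction v using TensorProduct.induction_on with
    | zero => simp
    | add y z hy hz => simp only [map_add, hy, hz, TensorProduct.tmul_add]
    | tmul c m =>
      simp [baseBalance, diffEnd, balance, frobeniusQuotientHom_quotientVar, baseCoordRep_tmul,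
        TensorProduct.tmul_sub]

theorem rTensor_restrict_baseBalance (s : ℕ) (i : Fin n)
    (y : FrobeniusKernel k p (s + 1) R ⊗[k] (K ⊗[k] N)) :
    (FrobeniusKernel.restrictAlgHom k p s R).toLinearMap.rTensor (K ⊗[k] N)
        (baseBalance k p r x N K (s + 1) i y) = baseBalance k p r x N K s i
      ((FrobeniusKernel.restrictAlgHom k p s R).toLinearMap.rTensor (K ⊗[k] N) y) := by
  induction y using TensorProduct.induction_on with
  | zero => simp
  | add y z hy hz => simp only [map_add, hy, hz]
  | tmul a v =>
    simp [baseBalance, diffEnd, FrobeniusKernel.restrictAlgHom_mk]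

/-- The p-th powers of the operators are multiplication by xᵢ^(p^(r+1)), as the zᵢ have p-th power
zero. These elements generate the kernel of k[𝔾_(r+2)] → k[𝔾_(r+1)]. -/
theorem ker_rTensor_restrict (hz : ∀ i, counit (R := k) (x i) = 0)
    (hx : ∀ s, IsTruncBasis k (fun i => FrobeniusKernel.mk k p s R (x i)) (p ^ s)) :
    LinearMap.ker ((FrobeniusKernel.restrictAlgHom k p (r + 1) R).toLinearMap.rTensor (K ⊗[k] N)) =
      ⨆ i, LinearMap.range (baseBalance k p r x N K (r + 2) i ^ p) := by
  have hpow : ∀ i, baseBalance k p r x N K (r + 2) i ^ p =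
      (LinearMap.mulLeft k (FrobeniusKernel.mk k p (r + 2) R (x i) ^ p ^ (r + 1))).rTensor
        (K ⊗[k] N) := by
    intro i
    rw [baseBalance, diffEnd_pow _ _ p (quotientVar_pow x hz), ← pow_succ]
  simp only [hpow]
  apply le_antisymm
  · refine LinearMap.ker_rTensor_le _ ?_ _ fun y hy v => ?_
    · intro y
      obtain ⟨f, rfl⟩ := FrobeniusKernel.mk_surjective k p (r + 1) R y
      exact ⟨FrobeniusKernel.mk k p (r + 2) R f, rfl⟩
    · have h1 := IsTruncBasis.ker_le (hx (r + 2)).surjective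
        (FrobeniusKernel.restrictAlgHom k p (r + 1) R) (hx (r + 1)) y hy
      suffices (⨆ i, LinearMap.range (LinearMap.mulLeft k
          (FrobeniusKernel.mk k p (r + 2) R (x i) ^ p ^ (r + 1)))) ≤
        (⨆ i, LinearMap.range ((LinearMap.mulLeft k (FrobeniusKernel.mk k p (r + 2) R (x i) ^
          p ^ (r + 1))).rTensor (K ⊗[k] N))).comap
            ((TensorProduct.mk k (FrobeniusKernel k p (r + 2) R) (K ⊗[k] N)).flip v) from this h1
      refine iSup_le fun i => ?_
      rintro _ ⟨w, rfl⟩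
      exact Submodule.mem_iSup_of_mem i ⟨w ⊗ₜ v, rfl⟩
  · refine iSup_le fun i => ?_
    rintro _ ⟨w, rfl⟩
    rw [LinearMap.mem_ker]
    induction w using TensorProduct.induction_on with
    | zero => simp
    | add y z hy hz => rw [map_add, map_add, hy, hz, add_zero]
    | tmul a v =>
      rw [LinearMap.rTensor_tmul, LinearMap.rTensor_tmul, LinearMap.mulLeft_apply,
        AlgHom.toLinearMap_apply, map_mul, map_pow, FrobeniusKernel.restrictAlgHom_mk,
        FrobeniusKernel.mk_pow_eq_zero k p (r + 1) R _ (hz i), zero_mul, TensorProduct.zero_tmul]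

/-- Balancing relations over k[𝔾_(r+1)] lift to ranges of the operators over k[𝔾_(r+2)]. The
ambiguity of the lift lies in the kernel of restriction, which is spanned by ranges of p-th powers
of the same operators and adds nothing new. -/
theorem ker_toBaseInduced_comp [Algebra.FiniteType k R] (hz : ∀ i, counit (R := k) (x i) = 0)
    (hx : ∀ s, IsTruncBasis k (fun i => FrobeniusKernel.mk k p s R (x i)) (p ^ s))
    (hZ : Algebra.adjoin k (Set.range (quotientVar k p r x)) = ⊤) :
    LinearMap.ker (toBaseInduced k p r R N K ∘ₗ
      (FrobeniusKernel.restrictAlgHom k p (r + 1) R).toLinearMap.rTensor (K ⊗[k] N)) =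
        ⨆ i, LinearMap.range (baseBalance k p r x N K (r + 2) i) := by
  set φ := (FrobeniusKernel.restrictAlgHom k p (r + 1) R).toLinearMap.rTensor (K ⊗[k] N) with hφ
  have hφs : Function.Surjective φ := by
    refine LinearMap.rTensor_surjective _ fun y => ?_
    obtain ⟨f, rfl⟩ := FrobeniusKernel.mk_surjective k p (r + 1) R y
    exact ⟨FrobeniusKernel.mk k p (r + 2) R f, rfl⟩
  set lc := TensorProduct.leftComm k (FrobeniusKernel k p (r + 1) R) K N with hlc
  set G := ⨆ i, LinearMap.range (baseBalance k p r x N K (r + 2) i) with hG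
  apply le_antisymm
  · have hL : ∀ y ∈ LinearMap.range ((balanceSub k p r R N).subtype.lTensor K),
        ∃ t ∈ G, φ t = lc.symm y := by
      rintro _ ⟨y, rfl⟩
      induction y using TensorProduct.induction_on with
      | zero => exact ⟨0, G.zero_mem, by simp⟩
      | add y z hy hz =>
        obtain ⟨t, ht, h⟩ := hy
        obtain ⟨t', ht', h'⟩ := hz
        exact ⟨t + t', G.add_mem ht ht', by simp only [map_add, h, h']⟩
      | tmul c l =>
        obtain ⟨l, hl⟩ := l
        rw [LinearMap.lTensor_tmul, Submodule.subtype_apply]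
        rw [balanceSub_eq x N hZ] at hl
        suffices (⨆ i, LinearMap.range (balance k p r R N (quotientVar k p r x i))) ≤
          (G.map φ).comap (lc.symm.toLinearMap ∘ₗ TensorProduct.mk k K _ c) from this hl
        refine iSup_le fun i => ?_
        rintro _ ⟨w, rfl⟩
        obtain ⟨t, ht⟩ := hφs (lc.symm (c ⊗ₜ w))
        refine ⟨_, Submodule.mem_iSup_of_mem i ⟨t, rfl⟩, ?_⟩
        rw [rTensor_restrict_baseBalance]
        apply lc.injective
        rw [leftComm_baseBalance]
        change (LinearMap.lTensor K _) (lc (φ t)) = lc (lc.symm _)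
        rw [ht, LinearEquiv.apply_symm_apply, LinearEquiv.apply_symm_apply, LinearMap.lTensor_tmul]
        rfl
    intro t ht
    have h1 : lc (φ t) ∈ LinearMap.range ((balanceSub k p r R N).subtype.lTensor K) := by
      have hex : Function.Exact ((balanceSub k p r R N).subtype.lTensor K)
          ((toInduced k p r R N).lTensor K) :=
        lTensor_exact K (LinearMap.exact_subtype_mkQ _) (toInduced_surjective N)
      exact (hex _).1 ht
    obtain ⟨t', ht', h2⟩ := hL _ h1
    rw [LinearEquiv.symm_apply_apply] at h2
    rw [← sub_add_cancel t t']
    refine G.add_mem ?_ ht'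
    have h3 : t - t' ∈ LinearMap.ker φ := by rw [LinearMap.mem_ker, map_sub, h2, sub_self]
    rw [hφ, ker_rTensor_restrict x N K hz hx] at h3
    suffices (⨆ i, LinearMap.range (baseBalance k p r x N K (r + 2) i ^ p)) ≤ G from this h3
    refine iSup_mono fun i => ?_
    rintro _ ⟨w, rfl⟩
    refine ⟨(baseBalance k p r x N K (r + 2) i ^ (p - 1)) w, ?_⟩
    rw [← Module.End.mul_apply, ← pow_succ', Nat.sub_add_cancel (Fact.out : p.Prime).one_le]
  · refine iSup_le fun i => ?_
    rintro _ ⟨w, rfl⟩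
    rw [LinearMap.mem_ker, LinearMap.comp_apply, rTensor_restrict_baseBalance, toBaseInduced,
      LinearMap.comp_apply]
    refine (congrArg ((toInduced k p r R N).lTensor K)
      (leftComm_baseBalance x N K i (φ w))).trans ?_
    have h0 : toInduced k p r R N ∘ₗ balance k p r R N (quotientVar k p r x i) = 0 := by
      refine LinearMap.ext fun w => ?_
      rw [LinearMap.comp_apply, LinearMap.zero_apply, ← LinearMap.mem_ker, ker_toInduced]
      exact Submodule.mem_iSup_of_mem _ ⟨_, rfl⟩
    rw [← LinearMap.comp_apply, ← LinearMap.lTensor_comp, h0, LinearMap.lTensor_zero]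
    rfl

end SubDouble

/-! ### The induced module over K as a quotient of the twisted action -/

namespace SubDouble
variable {k : Type u} [Field k] {p r : ℕ} [Fact p.Prime] [CharP k p] {R : Type u} [CommRing R]
  [HopfAlgebra k R] (N : Type u) [AddCommGroup N] [Module k N] [Module (SubDouble k p r R) N]
  [IsScalarTower k (SubDouble k p r R) N] {K : Type u} [Field K] [Algebra k K]

variable (k p r R K) in
/-- The base change of `inl`. -/
noncomputable def baseInl : K ⊗[k] QuotientCoord k p r R →ₐ[K] K ⊗[k] SubDouble k p r R :=
  Algebra.TensorProduct.map (AlgHom.id K K) inl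

variable (k p r R K) in
/-- The base change of `inr`. -/
noncomputable def baseInr :
    K ⊗[k] GroupAlg k (FrobeniusKernel k p r R) →ₐ[K] K ⊗[k] SubDouble k p r R :=
  Algebra.TensorProduct.map (AlgHom.id K K) inr

theorem baseInl_tmul (c : K) (z : QuotientCoord k p r R) :
    baseInl k p r R K (c ⊗ₜ z) = c ⊗ₜ inl z := by
  simp [baseInl]

theorem baseInr_tmul (c : K) (h : GroupAlg k (FrobeniusKernel k p r R)) :
    baseInr k p r R K (c ⊗ₜ h) = c ⊗ₜ inr h := by
  simp [baseInr]

theorem commute_baseInl_baseInr (α : K ⊗[k] QuotientCoord k p r R)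
    (b : K ⊗[k] GroupAlg k (FrobeniusKernel k p r R)) :
    Commute (baseInl k p r R K α) (baseInr k p r R K b) := by
  induction α using TensorProduct.induction_on with
  | zero => rw [map_zero]; exact Commute.zero_left _
  | add x y hx hy => rw [map_add]; exact hx.add_left hy
  | tmul c z =>
    induction b using TensorProduct.induction_on with
    | zero => rw [map_zero]; exact Commute.zero_right _
    | add x y hx hy => rw [map_add]; exact hx.add_right hy
    | tmul d h =>
      rw [baseInl_tmul, baseInr_tmul]
      simp only [Commute, SemiconjBy, Algebra.TensorProduct.tmul_mul_tmul, (commute z h).eq,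
        mul_comm c d]

variable (k p r R K) in
/-- The action of `K ⊗ k𝔾_(r)` on `K ⊗ N`. -/
noncomputable def baseGroupRep :
    K ⊗[k] GroupAlg k (FrobeniusKernel k p r R) →ₐ[K] Module.End K (K ⊗[k] N) :=
  (baseRep (E := SubDouble k p r R) K N).comp (baseInr k p r R K)

theorem baseGroupRep_tmul (c d : K) (h : GroupAlg k (FrobeniusKernel k p r R)) (m : N) :
    baseGroupRep k p r R N K (c ⊗ₜ h) (d ⊗ₜ m) = (c * d) ⊗ₜ groupRep k p r R N h m := by
  change baseRep (E := SubDouble k p r R) K N (baseInr k p r R K (c ⊗ₜ h)) (d ⊗ₜ m) = _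
  rw [baseInr_tmul, baseRep_tmul]
  rfl

theorem commute_baseGroupRep (α : K ⊗[k] QuotientCoord k p r R)
    (g : K ⊗[k] GroupAlg k (FrobeniusKernel k p r R)) :
    Commute (baseRep K N (baseInl k p r R K α)) (baseGroupRep k p r R N K g) :=
  (commute_baseInl_baseInr α g).map (baseRep K N)

variable [Algebra.FiniteType k R]

theorem toBaseInduced_lTensor (α : K ⊗[k] QuotientCoord k p r R)
    (y : FrobeniusKernel k p (r + 1) R ⊗[k] (K ⊗[k] N)) :
    toBaseInduced k p r R N K ((endRestrict k K (K ⊗[k] N)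
      (baseRep K N (baseInl k p r R K α))).lTensor _ y) = baseRep K (Induced k p r R N)
        (Algebra.TensorProduct.map (AlgHom.id K K) (incl k p r R) (baseInl k p r R K α))
          (toBaseInduced k p r R N K y) := by
  induction α using TensorProduct.induction_on with
  | zero => simp
  | add v w hv hw => simp only [map_add, LinearMap.lTensor_add, LinearMap.add_apply, hv, hw]
  | tmul c z =>
    induction y using TensorProduct.induction_on with
    | zero => simp
    | add v w hv hw => simp only [map_add, hv, hw]
    | tmul a v =>
      induction v using TensorProduct.induction_on with
      | zero => simp
      | add v w hv hw => simp only [map_add, TensorProduct.tmul_add, hv, hw]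
      | tmul d m =>
        rw [baseInl_tmul, LinearMap.lTensor_tmul, endRestrict_apply, baseRep_tmul]
        change (c * d) ⊗ₜ toInduced k p r R N (a ⊗ₜ (inl z • m)) = baseRep K (Induced k p r R N)
          (Algebra.TensorProduct.map (AlgHom.id K K) (incl k p r R) (c ⊗ₜ inl z))
            (d ⊗ₜ toInduced k p r R N (a ⊗ₜ m))
        rw [Algebra.TensorProduct.map_tmul, baseRep_tmul, incl_inl_smul_toInduced]
        rfl

theorem toBaseInduced_diagRep (b : K ⊗[k] GroupAlg k (FrobeniusKernel k p r R))
    (y : FrobeniusKernel k p (r + 1) R ⊗[k] (K ⊗[k] N)) :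
    toBaseInduced k p r R N K (diagRep (coadjointAct FrobeniusKernel.restrict)
      (repRestrict k (baseGroupRep k p r R N K)) (baseComul k _ K b) y) =
        baseRep K (Induced k p r R N)
          (Algebra.TensorProduct.map (AlgHom.id K K) (incl k p r R) (baseInr k p r R K b))
            (toBaseInduced k p r R N K y) := by
  induction b using TensorProduct.induction_on with
  | zero => simp
  | add v w hv hw => simp only [map_add, LinearMap.add_apply, hv, hw]
  | tmul c h =>
    induction y using TensorProduct.induction_on with
    | zero => simp
    | add v w hv hw => simp only [map_add, hv, hw]
    | tmul a v =>
      induction v using TensorProduct.induction_on with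
      | zero => simp
      | add v w hv hw => simp only [map_add, TensorProduct.tmul_add, hv, hw]
      | tmul d m =>
        have h1 : toBaseInduced k p r R N K (a ⊗ₜ (d ⊗ₜ m)) = d ⊗ₜ toInduced k p r R N (a ⊗ₜ m) :=
          rfl
        rw [baseInr_tmul, h1, Algebra.TensorProduct.map_tmul, baseRep_tmul,
          incl_inr_smul_toInduced, SmashProduct.diagonal_tmul _ (ℛ k h), baseComul_tmul,
          ← (ℛ k h).eq, TensorProduct.tmul_sum, map_sum, LinearMap.sum_apply, map_sum, map_sum,
          TensorProduct.tmul_sum]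
        refine Finset.sum_congr rfl fun i _ => ?_
        rw [diagRep_tmul, repRestrict_apply, baseGroupRep_tmul]
        rfl

theorem toBaseInduced_surjective : Function.Surjective (toBaseInduced k p r R N K) := by
  rw [toBaseInduced, LinearMap.coe_comp]
  exact (LinearMap.lTensor_surjective K (toInduced_surjective N)).comp
    (TensorProduct.leftComm k (FrobeniusKernel k p (r + 1) R) K N).surjective

theorem toBaseInduced_twistedEnd (α : K ⊗[k] QuotientCoord k p r R)
    (b : K ⊗[k] GroupAlg k (FrobeniusKernel k p r R))
    (y : FrobeniusKernel k p (r + 1) R ⊗[k] (K ⊗[k] N)) :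
    toBaseInduced k p r R N K (twistedEnd (coadjointAct FrobeniusKernel.restrict)
      (baseGroupRep k p r R N K) (baseRep K N (baseInl k p r R K α)) b y) =
        baseRep K (Induced k p r R N) (Algebra.TensorProduct.map (AlgHom.id K K) (incl k p r R)
          (baseInl k p r R K α + baseInr k p r R K b)) (toBaseInduced k p r R N K y) := by
  rw [twistedEnd, LinearMap.add_apply, map_add, toBaseInduced_lTensor, toBaseInduced_diagRep,
    map_add, map_add, LinearMap.add_apply]

end SubDouble

theorem isProjectiveVia_iff_forall {K V : Type u} [Field K] [AddCommGroup V] [Module K V]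
    [Module.Finite K V] {p : ℕ} (hp : p ≠ 0) (ρ : TruncPoly K p →ₐ[K] Module.End K V)
    (u : Module.End K V) (hu : ρ (TruncPoly.t K p) = u) :
    IsProjectiveVia ρ ↔ ∀ v, u v = 0 → ∃ w, (u ^ (p - 1)) w = v := by
  subst hu
  rw [isProjectiveVia_iff hp]
  constructor
  · exact fun h v hv => (h v).1 hv
  · refine fun h v => ⟨h v, ?_⟩
    rintro ⟨w, rfl⟩
    rw [← Module.End.mul_apply, ← pow_succ', Nat.sub_add_cancel (Nat.one_le_iff_ne_zero.2 hp)]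
    exact LinearMap.congr_fun (TruncPoly.map_t_pow ρ) w

/-! ### Comparison of a module with its induced module -/

namespace SubDouble
variable {k : Type u} [Field k] {p r : ℕ} [Fact p.Prime] [CharP k p] {R : Type u} [CommRing R]
  [HopfAlgebra k R] [Algebra.Smooth k R] (N : Type u) [AddCommGroup N] [Module k N]
  [Module (SubDouble k p r R) N] [IsScalarTower k (SubDouble k p r R) N] [Module.Finite k N]
  {K : Type u} [Field K] [Algebra k K]

set_option maxHeartbeats 800000 in
/-- Projectivity of an `O(𝔾_(r))`-module is detected on the induced `D̃(𝔾_(r))`-module. -/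
theorem isProjectiveAlong_induced_iff (φ : TruncPoly K p →ₐ[K] K ⊗[k] SubDouble k p r R)
    (α : K ⊗[k] QuotientCoord k p r R) (b : K ⊗[k] GroupAlg k (FrobeniusKernel k p r R))
    (hφ : φ (TruncPoly.t K p) = baseInl k p r R K α + baseInr k p r R K b)
    (hα : α ^ p = 0) (hbp : b ^ p = 0) (hb : IsUnipotentElement b) :
    IsProjectiveAlong (TruncPoly.along (incl k p r R) φ) (Induced k p r R N) ↔
      IsProjectiveAlong φ N := by
  have hp : p ≠ 0 := (Fact.out : p.Prime).ne_zero
  obtain ⟨n, x, δ, hx⟩ := exists_isCoordinates (k := k) (R := R)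
  have hz := hx.counit_eq_zero
  have hx' := hx.isTruncBasis p
  have hZ : Algebra.adjoin k (Set.range (quotientVar k p r x)) = ⊤ :=
    adjoin_quotientCoord_eq_top (hx.adjoin_eq_top p 1)
  let ρ := baseGroupRep k p r R N K
  let a := baseRep K N (baseInl k p r R K α)
  have ha : ∀ g, Commute a (ρ g) := commute_baseGroupRep N α
  have hap : a ^ p = 0 := by rw [← map_pow, ← map_pow, hα, map_zero, map_zero]
  let π₁ : FrobeniusKernel k p (r + 1) R →ₐc[k] FrobeniusKernel k p r R := FrobeniusKernel.restrict
  let π : FrobeniusKernel k p (r + 2) R →ₐc[k] FrobeniusKernel k p (r + 1) R :=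
    FrobeniusKernel.restrict
  let τ₁ := twistedEnd (coadjointAct π₁) ρ a b
  let τ₂ := twistedEnd (coadjointAct (π₁.comp π)) ρ a b
  let Ψ₁ := (FrobeniusKernel.restrictAlgHom k p (r + 1) R).toLinearMap.rTensor (K ⊗[k] N)
  let Ψ := toBaseInduced k p r R N K ∘ₗ Ψ₁
  let υ := baseRep K (Induced k p r R N) (Algebra.TensorProduct.map (AlgHom.id K K) (incl k p r R)
    (baseInl k p r R K α + baseInr k p r R K b))
  have hΨ₁ : ∀ y, Ψ₁ (τ₂ y) = τ₁ (Ψ₁ y) :=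
    rTensor_twistedEnd ρ (FrobeniusKernel.restrictAlgHom k p (r + 1) R).toLinearMap
      fun h y => coadjointAct_comp π π₁ h y
  have hΨ : ∀ y, Ψ (τ₂ y) = endRestrict k K _ υ (Ψ y) := fun y =>
    (congrArg _ (hΨ₁ y)).trans (toBaseInduced_twistedEnd N α b (Ψ₁ y))
  have hΨ₁s : Function.Surjective Ψ₁ := by
    refine LinearMap.rTensor_surjective _ fun y => ?_
    obtain ⟨f, rfl⟩ := FrobeniusKernel.mk_surjective k p (r + 1) R y
    exact ⟨FrobeniusKernel.mk k p (r + 2) R f, rfl⟩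
  have hΨs : Function.Surjective Ψ := by
    rw [LinearMap.coe_comp]
    exact (toBaseInduced_surjective N).comp hΨ₁s
  have hτ₂ : τ₂ ^ p = 0 := twistedEnd_pow _ ρ ha hap hbp
  -- The first part of each operator is multiplication by a p^r-th power, which is coadjoint
  -- invariant. The second comes from Z, which is commutative and commutes with the group algebra on
  -- N.
  have hcomm : ∀ i, Commute τ₂ (baseBalance k p r x N K (r + 2) i) := by
    intro i
    refine Commute.sub_right
      (R := Module.End k (FrobeniusKernel k p (r + 2) R ⊗[k] (K ⊗[k] N))) ?_ ?_
    · refine commute_twistedEnd_rTensor _ ρ _ fun h => ?_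
      refine LinearMap.ext fun y => ?_
      exact (coadjointAct_pow_mul (π₁.comp π) h (FrobeniusKernel.mk k p (r + 2) R (x i)) y).symm
    · refine commute_twistedEnd_lTensor _ ρ (baseRep K N (1 ⊗ₜ inl (quotientVar k p r x i))) ?_ ?_
      · rw [← baseInl_tmul]
        exact ((Commute.all _ α).map (baseInl k p r R K)).map (baseRep K N)
      · intro g
        rw [← baseInl_tmul]
        exact commute_baseGroupRep N _ g
  -- With d = p^r the coordinates on 𝔾_(r+2) have nilpotency order d p², so q = p² ≥ 2 p. On 𝔾_(r+1)
  -- itself one would have q = p, which is too small; this is why one more Frobenius kernel is used.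
  have key := IsAcyclicMod.iSup_range_iff (p := p) (t := τ₂) (baseBalance k p r x N K (r + 2))
    (Fact.out : p.Prime).one_le (diffEnd_commute _ _) hcomm hτ₂
    (IsTruncBasis.diffEnd_regular _ _ (pow_pos (Fact.out : p.Prime).pos r)
      (q := p ^ 2) (by rw [← pow_add]; exact hx' (r + 2))
      (by rw [← two_mul, pow_two]; exact Nat.mul_le_mul_right p (Fact.out : p.Prime).two_le)
      (quotientVar_pow x hz))
  -- The p-th powers cut out k[𝔾_(r+1)] ⊗ V and the operators themselves cut out the induced module
  -- over K, so `key` becomes the equivalence of acyclicity for these two spaces.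
  rw [← ker_rTensor_restrict x N K hz hx', ← ker_toBaseInduced_comp x N K hz hx' hZ,
    IsAcyclicMod.ker_iff Ψ₁ hΨ₁s τ₁ hΨ₁, IsAcyclicMod.ker_iff Ψ hΨs _ hΨ] at key
  have hN : IsProjectiveAlong φ N ↔ ∀ v, (a + ρ b) v = 0 → ∃ w, ((a + ρ b) ^ (p - 1)) w = v := by
    exact isProjectiveVia_iff_forall hp _ _
      ((congrArg (baseRep K N) hφ).trans (map_add (baseRep K N) _ _))
  have hM : IsProjectiveAlong (TruncPoly.along (incl k p r R) φ) (Induced k p r R N) ↔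
      ∀ v, υ v = 0 → ∃ w, (υ ^ (p - 1)) w = v := by
    exact isProjectiveVia_iff_forall hp _ _ (congrArg (fun y => baseRep K (Induced k p r R N)
      (Algebra.TensorProduct.map (AlgHom.id K K) (incl k p r R) y)) hφ)
  rw [hM, hN]
  rw [← map_pow] at key
  refine key.trans ⟨?_, ?_⟩
  -- The invariant vector is the constant function 1 and the invariant functional is evaluation at
  -- the identity.
  · exact acyclic_of_twistedEnd_acyclic (coadjointAct π₁) ρ 1 (coadjointAct_one π₁) counit
      (counit_coadjointAct π₁) Bialgebra.counit_one
  · exact twistedEnd_acyclic_of_acyclic (coadjointAct π₁) ρ ha hap hbp hb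

end SubDouble

/-! ### Equivalence classes and supports -/

section Main
variable {k : Type u} [Field k] {p r : ℕ} [Fact p.Prime] [CharP k p] {R : Type u} [CommRing R]
  [HopfAlgebra k R] [Algebra.Smooth k R]

theorem PiPair.isUnipotentElement (x : PiPair k p r R) : IsUnipotentElement (x.β (TruncPoly.t x.K p)) := by
  rcases x.β_zero_or_piPoint with h | h
  · rw [h]
    exact isUnipotentElement_zero
  · exact h.isUnipotentElement _

theorem PiPair.isProjectiveAlong_induced_iff (x : PiPair k p r R) {Ω : Type u} [Field Ω]
    [Algebra k Ω] (f : x.K →ₐ[k] Ω) (N : Type u) [AddCommGroup N] [Module k N]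
    [Module (SubDouble k p r R) N] [IsScalarTower k (SubDouble k p r R) N] [Module.Finite k N] :
    IsProjectiveAlong (TruncPoly.along (SubDouble.incl k p r R) (x.sumOver f))
      (SubDouble.Induced k p r R N) ↔ IsProjectiveAlong (x.sumOver f) N := by
  refine SubDouble.isProjectiveAlong_induced_iff N _ (TruncPoly.extend f x.α (TruncPoly.t Ω p))
    (TruncPoly.extend f x.β (TruncPoly.t Ω p))
      (by rw [PiPair.sumOver, piSum, TruncPoly.lift_t]; rfl) (TruncPoly.map_t_pow _)
      (TruncPoly.map_t_pow _) ?_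
  rw [TruncPoly.extend, TruncPoly.lift_t]
  exact x.isUnipotentElement.map f

/-- The hypothesis is tested on the induced module of N. The same field Ω serves, since projectivity
of N and of its induced module agree for both pairs after extension to Ω. -/
theorem PiPair.isEquiv_id_of_isEquiv_incl {x y : PiPair k p r R}
    (h : IsEquiv (SubDouble.incl k p r R) x y) : IsEquiv (AlgHom.id k (SubDouble k p r R)) x y := by
  obtain ⟨Ω, i, i', f, g, h⟩ := h
  have hid : ∀ φ : TruncPoly Ω p →ₐ[Ω] Ω ⊗[k] SubDouble k p r R,
      TruncPoly.along (AlgHom.id k (SubDouble k p r R)) φ = φ := by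
    intro φ
    rw [TruncPoly.along, Algebra.TensorProduct.map_id, AlgHom.id_comp]
  refine ⟨Ω, i, i', f, g, fun N _ _ _ _ _ => ?_⟩
  rw [hid, hid, ← x.isProjectiveAlong_induced_iff f N, ← y.isProjectiveAlong_induced_iff g N]
  exact h (SubDouble.Induced k p r R N)

variable (k p r R) in
theorem piMap_bijective : Function.Bijective (piMap k p r R) := by
  constructor
  · intro c d
    induction c using Quotient.inductionOn
    induction d using Quotient.inductionOn
    exact fun h => Quotient.sound (PiPair.isEquiv_id_of_isEquiv_incl (Quotient.exact h))
  · intro c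
    induction c using Quotient.inductionOn with
    | h x => exact ⟨Quotient.mk _ x, rfl⟩

/-- `piMap` keeps representatives, and for a given representative the two support conditions
coincide by `isProjectiveAlong_restrict`. Only injectivity has to be imported. -/
theorem piMap_bijOn_supp (M : Type u) [AddCommGroup M] [Module k M]
    [Module (ExtendedDouble k p r R) M] [IsScalarTower k (ExtendedDouble k p r R) M] :
    Set.BijOn (piMap k p r R) (PiO.supp (Restrict (SubDouble.incl k p r R) M)) (PiD.supp M) := by
  refine ⟨?_, (piMap_bijective k p r R).1.injOn, ?_⟩
  · rintro _ ⟨x, rfl, hx⟩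
    exact ⟨x, rfl, fun h => hx ((isProjectiveAlong_restrict _ _ M).2 h)⟩
  · rintro _ ⟨x, rfl, hx⟩
    exact ⟨Quotient.mk _ x, ⟨x, rfl, fun h => hx ((isProjectiveAlong_restrict _ _ M).1 h)⟩, rfl⟩

end Main

theorem proposition3p4 (k : Type u) [Field k] (p : ℕ) [Fact p.Prime] [CharP k p] (r : ℕ)
    (hr : 0 < r) (R : Type u) [CommRing R] [HopfAlgebra k R] [Algebra.Smooth k R]
    [ConnectedSpace (PrimeSpectrum R)] :
    Function.Bijective (piMap k p r R) ∧
      ∀ (M : Type u) [AddCommGroup M] [Module k M] [Module (ExtendedDouble k p r R) M]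
        [IsScalarTower k (ExtendedDouble k p r R) M] [Module.Finite k M],
        Set.BijOn (piMap k p r R) (PiO.supp (Restrict (SubDouble.incl k p r R) M))
          (PiD.supp M) :=
  ⟨piMap_bijective k p r R, fun M => piMap_bijOn_supp M⟩
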